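/- **Setting.** Let $M$ be a compact (boundaryless, Hausdorff, $C^\infty$) Riemannian manifold of dimension $d$, let $G$ be a $C^r$ vector field on $M$, $r\ge 1$, and let $X_t$, $t\in\mathbb R$, be its flow. Let $\Lambda\subset M$ be an attractor: $\Lambda$ is compact and invariant; there is an open set $U\supset\Lambda$ with $X_t(U)\subset U$ for $t>0$ and $\Lambda=\bigcap_{t\in\mathbb R}X_t(U)$; and some $x\in\Lambda$ has both its $\omega$-limit set and its $\alpha$-limit set equal to $\Lambda$. Suppose that $\Lambda$ is partially hyperbolic: there are a continuous $DX_t$-invariant splitting $T_\Lambda M=E^s\oplus E^{cu}$ into bundles of constant rank, $d_s=\dim E^s\ge1$, $d_{cu}=\dim E^{cu}\ge2$, and constants $C>0$, $\lambda\in(0,1)$ such that for all $t>0$ and $x\in\Lambda$ $$\|DX_t\mid E^s_x\|\le C\lambda^t,\qquad \|DX_t\mid E^s_x\|\cdot\|DX_{-t}\mid E^{cu}_{X_tx}\|\le C\lambda^t .$$ For a splitting $T_VM=\tilde E^s\oplus \tilde E^{cu}$ over a set $V$, $x\in V$ and $a>0$, put $$\mathcal C^s_x(a)=\{p+q:\ p\in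 \tilde E^s_x,\ q\in \tilde E^{cu}_x,\ \|q\|\le a\|p\|\},\qquad \mathcal C^{cu}_x(a)=\{p+q:\ p\in \tilde E^s_x,\ q\in \tilde E^{cu}_x,\ \|p\|\le a\|q\|\}.$$ **Proposition.** The splitting $T_\Lambda M=E^s\oplus E^{cu}$ extends to a continuous (not necessarily invariant) splitting over some neighbourhood of $\Lambda$. Moreover, let $T_VM=\tilde E^s\oplus\tilde E^{cu}$ be any continuous splitting over a neighbourhood $V$ of $\Lambda$ that extends $T_\Lambda M=E^s\oplus E^{cu}$, let $T$ be given by $C\lambda^T=1/150$, and let $a\in(0,\frac14]$. Then there are an open set $U_0$ with $\Lambda\subset U_0\subset V$, $X_t(U_0)\subset U_0$ for $t\ge0$ and $\bigcap_{t\ge0}X_t(U_0)=\Lambda$, and constants $c>0$, $\tilde\lambda\in(0,1)$, such that the following hold. 1. (Cone estimates.) For all $x\in U_0$: * $DX_{-t}(\mathcal C^s_{X_tx}(b))\subset\mathcal C^s_x(b)$ and $DX_t(\mathcal C^{cu}_x(b))\subset\mathcal C^{cu}_{X_tx}(b)$ for all $b\in[a,1]$ and $t\ge T$; * $\|DX_{-t}(X_tx)v\|\ge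 c\tilde\lambda^{-t}\|v\|$ for all $t>0$ and $v\in\mathcal C^s_{X_tx}(a)$; * $\dfrac{\|DX_t(x)v\|}{\|v\|}\ge c\tilde\lambda^{-t}\dfrac{\|DX_t(x)u\|}{\|u\|}$ for all $t>0$ and all nonzero $v\in\mathcal C^{cu}_x(a)$, $u\in DX_{-t}(\mathcal C^s_{X_tx}(a))$. 2. (Invariant contracting stable bundle.) The sets $$F_x=\bigcap_{t\ge0}DX_{-t}\big(\mathcal C^s_{X_tx}(a)\big),\qquad x\in U_0,$$ are linear subspaces of $T_xM$ of dimension $d_s$ that form a continuous vector bundle over $U_0$ with $T_{U_0}M=F\oplus\tilde E^{cu}$ and $F_x=E^s_x$ for $x\in\Lambda$. This bundle is invariant, $DX_t(x)F_x=F_{X_tx}$ for all $x\in U_0$, $t\ge0$, and uniformly contracting with the same constants: $$\|DX_t\mid F_x\|\le c^{-1}\tilde\lambda^t\qquad\text{for all }x\in U_0,\ t\ge0 .$$ -/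

import Mathlib

open Set Filter Topology Bundle Manifold
open scoped ContDiff

noncomputable section

namespace PHAttractor

variable {d : ℕ} {M : Type*} [TopologicalSpace M] [ChartedSpace (EuclideanSpace ℝ (Fin d)) M]

/-- `X` is the (globally defined) flow `(t, x) ↦ X t x` generated by the vector field `G`: every
curve `t ↦ X t x` is the integral curve of `G` that starts at `x`. -/
def IsFlowOf (G : ∀ x : M, TangentSpace (𝓡 d) x) (X : ℝ → M → M) : Prop :=
  ∀ x : M, X 0 x = x ∧ IsMIntegralCurve (I := 𝓡 d) (fun t => X t x) G

/-- A set is invariant if `X_t(Λ) = Λ` for all `t ∈ ℝ`. -/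
def IsInvariantSet (X : ℝ → M → M) (Λ : Set M) : Prop :=
  ∀ t : ℝ, X t '' Λ = Λ

/-- An attracting set: a compact invariant set `Λ` with an open set `U ⊇ Λ` such that
`Λ = ⋂_{t ∈ ℝ} X_t(U)` and `X_t(U) ⊆ U` for `t > 0`. -/
def IsAttractingSet (X : ℝ → M → M) (Λ : Set M) : Prop :=
  IsCompact Λ ∧ IsInvariantSet X Λ ∧
    ∃ U : Set M, IsOpen U ∧ Λ ⊆ U ∧ Λ = (⋂ t : ℝ, X t '' U) ∧ ∀ t > 0, X t '' U ⊆ U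

/-- A transitive set: some point of `Λ` has `Λ` both as its `ω`-limit set and as its `α`-limit
set. -/
def IsTransitiveSet (X : ℝ → M → M) (Λ : Set M) : Prop :=
  ∃ x ∈ Λ, omegaLimit atTop X {x} = Λ ∧ omegaLimit atBot X {x} = Λ

/-- An attractor is a transitive attracting set. -/
def IsAttractor (X : ℝ → M → M) (Λ : Set M) : Prop :=
  IsAttractingSet X Λ ∧ IsTransitiveSet X Λ

/-- The derivative `DX_t(x) : T_x M → T_{X_t x} M` of the time-`t` map. -/
def DX (X : ℝ → M → M) (t : ℝ) (x : M) :
    TangentSpace (𝓡 d) x →L[ℝ] TangentSpace (𝓡 d) (X t x) :=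
  mfderiv (𝓡 d) (𝓡 d) (X t) x

/-- The family of subspaces `E x ⊆ T_x M`, `x ∈ S`, is a continuous vector bundle of rank `k`
over `S`: near every point of `S` it has a continuous frame. (The values of `E` outside `S` play
no role.) -/
def IsContinuousSubbundle [IsManifold (𝓡 d) 1 M] (S : Set M) (E : ∀ x : M, Submodule ℝ (TangentSpace (𝓡 d) x))
    (k : ℕ) : Prop :=
  ∀ x₀ ∈ S, ∃ u ∈ 𝓝[S] x₀, ∃ s : Fin k → ∀ x : M, TangentSpace (𝓡 d) x,
    (∀ i, ContinuousOn (fun x => (⟨x, s i x⟩ : TangentBundle (𝓡 d) M)) u) ∧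
    ∀ x ∈ u, LinearIndependent ℝ (fun i => s i x) ∧
      Submodule.span ℝ (Set.range fun i => s i x) = E x

/-- A continuous splitting `T_S M = E ⊕ F` with `E`, `F` of rank `k`, `l`. -/
structure IsContinuousSplitting [IsManifold (𝓡 d) 1 M] (S : Set M)
    (E F : ∀ x : M, Submodule ℝ (TangentSpace (𝓡 d) x)) (k l : ℕ) : Prop where
  left : IsContinuousSubbundle S E k
  right : IsContinuousSubbundle S F l
  isCompl : ∀ x ∈ S, IsCompl (E x) (F x)

section Metric

variable [RiemannianBundle (fun x : M => TangentSpace (𝓡 d) x)]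

/-- `‖DX_t | E_x‖`: the operator norm, with respect to the Riemannian metric, of the restriction
of `DX_t(x)` to `E x`. -/
def normDXOn (X : ℝ → M → M) (t : ℝ) (E : ∀ x : M, Submodule ℝ (TangentSpace (𝓡 d) x))
    (x : M) : ℝ :=
  ‖(DX X t x).comp (E x).subtypeL‖

/-- `Λ` is partially hyperbolic with splitting `T_Λ M = Es ⊕ Ecu` into bundles of rank `ds ≥ 1`
and `dcu ≥ 2`, and with constants `C > 0` and `lam ∈ (0, 1)`. -/
structure IsPartiallyHyperbolic [IsManifold (𝓡 d) 1 M] (X : ℝ → M → M) (Λ : Set M)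
    (Es Ecu : ∀ x : M, Submodule ℝ (TangentSpace (𝓡 d) x)) (ds dcu : ℕ) (C lam : ℝ) : Prop where
  isCompact : IsCompact Λ
  isInvariantSet : IsInvariantSet X Λ
  one_le_ds : 1 ≤ ds
  two_le_dcu : 2 ≤ dcu
  C_pos : 0 < C
  lam_pos : 0 < lam
  lam_lt_one : lam < 1
  splitting : IsContinuousSplitting Λ Es Ecu ds dcu
  invariant_s : ∀ t : ℝ, ∀ x ∈ Λ, (Es x).map (DX X t x).toLinearMap = Es (X t x)
  invariant_cu : ∀ t : ℝ, ∀ x ∈ Λ, (Ecu x).map (DX X t x).toLinearMap = Ecu (X t x)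
  contraction : ∀ t > 0, ∀ x ∈ Λ, normDXOn X t Es x ≤ C * lam ^ t
  domination : ∀ t > 0, ∀ x ∈ Λ,
    normDXOn X t Es x * normDXOn X (-t) Ecu (X t x) ≤ C * lam ^ t

/-- The cone of width `a` about `E x` in `T_x M = E x ⊕ F x`: the vectors `v = p + q` with
`p ∈ E x`, `q ∈ F x`, `‖q‖ ≤ a ‖p‖`. The stable cone `C^s_x(a)` is `cone Es Ecu a x` and the
center-unstable cone `C^cu_x(a)` is `cone Ecu Es a x`. -/
def cone (E F : ∀ x : M, Submodule ℝ (TangentSpace (𝓡 d) x)) (a : ℝ) (x : M) :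
    Set (TangentSpace (𝓡 d) x) :=
  {v | ∃ p ∈ E x, ∃ q ∈ F x, v = p + q ∧ ‖q‖ ≤ a * ‖p‖}

/-- The pulled-back stable cone `DX_{-t}(C^s_{X_t x}(a)) ⊆ T_x M`. Since `DX_{-t}(X_t x)` is the
inverse of `DX_t(x)`, this is the preimage of `C^s_{X_t x}(a)` under `DX_t(x)`. -/
def pulledBackCone (X : ℝ → M → M) (Es Ecu : ∀ x : M, Submodule ℝ (TangentSpace (𝓡 d) x))
    (a t : ℝ) (x : M) : Set (TangentSpace (𝓡 d) x) :=
  DX X t x ⁻¹' cone Es Ecu a (X t x)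

/-- The cone field estimates over `U₀` for the cones of a splitting `T_{U₀} M = Es ⊕ Ecu`:
invariance of the cones of width `b ∈ [a, 1]` for times `t ≥ T`, and, with constants `c` and `lam'`,
backward expansion of the stable cones and domination of the stable by the center-unstable
cones. -/
structure ConeEstimates (X : ℝ → M → M) (U₀ : Set M)
    (Es Ecu : ∀ x : M, Submodule ℝ (TangentSpace (𝓡 d) x)) (a T c lam' : ℝ) : Prop where
  stable_invariant : ∀ x ∈ U₀, ∀ b ∈ Icc a 1, ∀ t ≥ T,
    pulledBackCone X Es Ecu b t x ⊆ cone Es Ecu b x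
  cu_invariant : ∀ x ∈ U₀, ∀ b ∈ Icc a 1, ∀ t ≥ T,
    DX X t x '' cone Ecu Es b x ⊆ cone Ecu Es b (X t x)
  backward_expansion : ∀ x ∈ U₀, ∀ t > 0, ∀ v ∈ cone Es Ecu a (X t x),
    ‖DX X (-t) (X t x) v‖ ≥ c * lam' ^ (-t) * ‖v‖
  domination : ∀ x ∈ U₀, ∀ t > 0, ∀ v ∈ cone Ecu Es a x, ∀ u ∈ pulledBackCone X Es Ecu a t x,
    v ≠ 0 → u ≠ 0 →
      ‖DX X t x v‖ / ‖v‖ ≥ c * lam' ^ (-t) * (‖DX X t x u‖ / ‖u‖)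

end Metric

end PHAttractor

end

/-!
The proof works with the tangent flow `DX_t` as a map of the tangent bundle. It is jointly
continuous in time and vector (`IsFlowOf.continuous_tangentFlow`): in a chart this is the
differentiable dependence of solutions on initial values (`exists_local_flow_hasFDerivAt`), and
compactness of `M` together with the group law passes from small times to all times.

*Cone estimates.* Over `Λ` the splitting is invariant, so the off-diagonal blocks of `DX_t` vanish,
and for `t ≥ T` the stable block is a contraction by `1/150` and dominated by the center-unstable
block with the same factor. For `t` in the compact interval `[T, 2T]` and unit vectors these are
strict inequalities between continuous functions, once a small error is allowed. Hence they persist,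
with `1/100` in place of `1/150` and off-diagonal blocks small compared with `a`, for any continuous
extension of the splitting over a neighbourhood of `Λ`
(`IsPartiallyHyperbolic.eventually_dominatedStep`). Since `Λ` is attracting, that neighbourhood
contains an open forward invariant one, `U₀` (`IsAttractingSet.exists_forward_invariant`). The block
estimates give invariance of the cones, contraction by `1/2` and domination by `1/2` in one step of
length in `[T, 2T]`; every time `t ≥ T` is a sum of such steps, and the times `t ≤ T` cost only a
bounded factor. This yields all the cone estimates with the rate `(1/2)^(1/(2T))`
(`DominatedOn.coneEstimates`).

*The stable bundle.* Let `F_x` be the set of vectors which stay in the stable cones for all future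
times. A dimension count shows that for each `p` in `Es' x` and each `n` there is a vector with
stable component `p` whose image at time `n T` lies in the stable cone, and compactness gives a
vector of `F_x` with stable component `p` (`DominatedOn.exists_forall_inCone`). By domination, a
vector of `Ecu' x` cannot be a nonzero sum of vectors of `F_x` (`DominatedOn.add_add_eq_zero`). So
`F_x` is the graph of a map over `Es' x`, closed under addition
(`DominatedOn.mem_stableBundle_iff`), and complementary to `Ecu' x`. It is continuous because the
conditions that define it are closed and the vectors involved stay bounded
(`DominatedOn.continuousAt_projTM_stableBundle`).

*Extension of the splitting.* The projection onto `Es` along `Ecu` is a continuous section, over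
`Λ`, of the bundle of endomorphisms. Tietze's theorem and a partition of unity extend it to a
continuous section over `M` (`IsContinuousSplitting.exists_extension_projAlong`), whose values need
not be idempotent off `Λ`. The Newton iteration `a ↦ 3 a ^ 2 - 2 a ^ 3` makes them so near `Λ`
(`eventually_newtonEnd`), and the ranges of the resulting projections and of their complements are
the required extension (`IsContinuousSplitting.exists_extension`).
-/

noncomputable section

namespace PHAttractor

/-! ### Differentiable dependence on initial conditions in a vector space -/

section FlatODE

open Metric
open scoped NNReal

variable {E : Type*} [NormedAddCommGroup E] [NormedSpace ℝ E]

/-- Two-sided Grönwall inequality around time `0`. -/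
theorem norm_le_of_norm_deriv_le {f f' : ℝ → E} {ε K η δ : ℝ} (hK : 0 < K) (hη : 0 ≤ η)
    (hf : ∀ t ∈ Ioo (-ε) ε, HasDerivAt f (f' t) t) (h0 : ‖f 0‖ ≤ δ)
    (bound : ∀ t ∈ Ioo (-ε) ε, ‖f' t‖ ≤ K * ‖f t‖ + η) {t : ℝ} (ht : t ∈ Ioo (-ε) ε) :
    ‖f t‖ ≤ (δ + η / K) * Real.exp (K * ε) := by
  have hδ : 0 ≤ δ := (norm_nonneg _).trans h0
  have key : ∀ (h h' : ℝ → E), (∀ s ∈ Ioo (-ε) ε, HasDerivAt h (h' s) s) → ‖h 0‖ ≤ δ →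
      (∀ s ∈ Ioo (-ε) ε, ‖h' s‖ ≤ K * ‖h s‖ + η) → ∀ s ∈ Ico 0 ε,
      ‖h s‖ ≤ (δ + η / K) * Real.exp (K * ε) := by
    intro h h' hh hh0 hb s hs
    have hsub : ∀ x ∈ Icc 0 s, x ∈ Ioo (-ε) ε := fun x hx =>
      ⟨by linarith [hx.1, hs.1, hs.2], hx.2.trans_lt hs.2⟩
    have := norm_le_gronwallBound_of_norm_deriv_right_le (f := h) (f' := h') (δ := δ) (K := K)
      (ε := η) (a := 0) (b := s)
      (fun x hx => (hh x (hsub x hx)).continuousAt.continuousWithinAt)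
      (fun x hx => (hh x (hsub x (Ico_subset_Icc_self hx))).hasDerivWithinAt) hh0
      (fun x hx => hb x (hsub x (Ico_subset_Icc_self hx))) s ⟨hs.1, le_rfl⟩
    rw [gronwallBound_of_K_ne_0 hK.ne'] at this
    simp only [sub_zero] at this
    have h1 : Real.exp (K * s) ≤ Real.exp (K * ε) :=
      Real.exp_le_exp.2 (mul_le_mul_of_nonneg_left hs.2.le hK.le)
    have h2 : 0 ≤ η / K := by positivity
    nlinarith [mul_le_mul_of_nonneg_left h1 hδ, mul_le_mul_of_nonneg_left h1 h2]
  rcases le_total 0 t with h | h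
  · exact key f f' hf h0 bound t ⟨h, ht.2⟩
  · have hneg : ∀ s ∈ Ioo (-ε) ε, -s ∈ Ioo (-ε) ε := fun s hs =>
      ⟨by linarith [hs.2], by linarith [hs.1]⟩
    have := key (fun s => f (-s)) (fun s => -f' (-s)) (fun s hs => ?_) (by simpa using h0)
      (fun s hs => by simpa using bound _ (hneg s hs)) (-t) ⟨by linarith, by linarith [ht.1]⟩
    · simpa using this
    · have := (hf (-s) (hneg s hs)).scomp s (hasDerivAt_neg s)
      simpa [Function.comp_def] using this

/-- The local flow of a `C¹` vector field, with values in a prescribed neighbourhood. -/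
theorem exists_local_flow [CompleteSpace E] {g : E → E} {z₀ : E} (hg : ContDiffAt ℝ 1 g z₀)
    {N : Set E} (hN : N ∈ 𝓝 z₀) :
    ∃ r > 0, ∃ ε > 0, ∃ L : ℝ≥0, ∃ α : E → ℝ → E,
      (∀ z ∈ ball z₀ r, α z 0 = z ∧
        ∀ t ∈ Ioo (-ε) ε, HasDerivAt (α z) (g (α z t)) t ∧ α z t ∈ N) ∧
      ∀ t ∈ Ioo (-ε) ε, LipschitzOnWith L (α · t) (ball z₀ r) := by
  obtain ⟨ε, hε, a, r, L, K, hr, hpl⟩ := IsPicardLindelof.of_contDiffAt_one hg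
  obtain ⟨α, hα, L', hL'⟩ :=
    (hpl 0).exists_forall_mem_closedBall_eq_hasDerivWithinAt_lipschitzOnWith
  simp only [zero_sub, zero_add] at hα hL'
  have hcont : ContinuousOn (Function.uncurry α) (closedBall z₀ r ×ˢ Icc (-ε) ε) :=
    continuousOn_prod_of_continuousOn_lipschitzOnWith _ L'
      (fun z hz => HasDerivWithinAt.continuousOn (hα z hz).2) hL'
  have hz₀ : z₀ ∈ closedBall z₀ (r : ℝ) := mem_closedBall_self r.2
  have hmem : closedBall z₀ (r : ℝ) ×ˢ Icc (-ε) ε ∈ 𝓝 (z₀, (0 : ℝ)) :=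
    prod_mem_nhds (closedBall_mem_nhds _ hr) (Icc_mem_nhds (by linarith) hε)
  have hat : ContinuousAt (Function.uncurry α) (z₀, 0) := hcont.continuousAt hmem
  have hpre : Function.uncurry α ⁻¹' N ∈ 𝓝 (z₀, (0 : ℝ)) :=
    hat.preimage_mem_nhds (by simpa [Function.uncurry, (hα z₀ hz₀).1] using hN)
  obtain ⟨δ, hδ, hsub⟩ := Metric.mem_nhds_iff.1 (inter_mem hpre hmem)
  refine ⟨min δ r, lt_min hδ hr, min δ ε, lt_min hδ hε, L', α, fun z hz => ?_, fun t ht => ?_⟩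
  · have hz' : z ∈ closedBall z₀ (r : ℝ) :=
      ball_subset_closedBall (ball_subset_ball (min_le_right _ _) hz)
    refine ⟨(hα z hz').1, fun t ht => ⟨?_, ?_⟩⟩
    · have h1 : -ε < t := by linarith [ht.1, min_le_right δ ε]
      have h2 : t < ε := by linarith [ht.2, min_le_right δ ε]
      exact ((hα z hz').2 t ⟨h1.le, h2.le⟩).hasDerivAt (Icc_mem_nhds h1 h2)
    · have : (z, t) ∈ ball (z₀, (0 : ℝ)) δ := by
        rw [← ball_prod_same]
        refine ⟨ball_subset_ball (min_le_left _ _) hz, ?_⟩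
        rw [Real.ball_eq_Ioo]
        exact ⟨by linarith [ht.1, min_le_left δ ε], by linarith [ht.2, min_le_left δ ε]⟩
      exact (hsub this).1
  · exact (hL' t ⟨by linarith [ht.1, min_le_right δ ε], by linarith [ht.2, min_le_right δ ε]⟩).mono
      ((ball_subset_ball (min_le_right _ _)).trans ball_subset_closedBall)

/-- The fundamental solution of a linear equation `A' = a(t) A` for small times: for
`2 K ε ≤ 1` it stays within distance `1` of the identity. -/
theorem exists_fundamental_solution [CompleteSpace E] {a : ℝ → E →L[ℝ] E} {K ε : ℝ} (hK : 0 < K)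
    (hε : 0 < ε) (hKε : 2 * K * ε ≤ 1) (ha : ContinuousOn a (Icc (-ε) ε))
    (hb : ∀ t ∈ Icc (-ε) ε, ‖a t‖ ≤ K) :
    ∃ A : ℝ → E →L[ℝ] E, A 0 = ContinuousLinearMap.id ℝ E ∧
      ∀ t ∈ Ioo (-ε) ε, HasDerivAt A ((a t).comp (A t)) t := by
  have hpl : IsPicardLindelof (fun t (A : E →L[ℝ] E) => (a t).comp A) (tmin := -ε) (tmax := ε)
      ⟨0, by constructor <;> linarith⟩ (ContinuousLinearMap.id ℝ E) 1 0 (2 * K.toNNReal)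
      K.toNNReal := by
    constructor
    · intro t ht
      refine LipschitzOnWith.of_dist_le_mul fun A _ B _ => ?_
      rw [dist_eq_norm, dist_eq_norm, ← ContinuousLinearMap.comp_sub, Real.coe_toNNReal _ hK.le]
      exact (ContinuousLinearMap.opNorm_comp_le _ _).trans
        (mul_le_mul_of_nonneg_right (hb t ht) (norm_nonneg _))
    · intro A _
      exact ha.clm_comp continuousOn_const
    · intro t ht A hA
      have h1 : ‖A‖ ≤ 2 := by
        have h2 : ‖A - ContinuousLinearMap.id ℝ E‖ ≤ 1 := by
          simpa [dist_eq_norm] using mem_closedBall.1 hA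
        calc ‖A‖ = ‖(A - ContinuousLinearMap.id ℝ E) + ContinuousLinearMap.id ℝ E‖ := by simp
          _ ≤ 1 + 1 := (norm_add_le _ _).trans
            (add_le_add h2 ContinuousLinearMap.norm_id_le)
          _ = 2 := by norm_num
      have : ‖(a t).comp A‖ ≤ K * 2 := (ContinuousLinearMap.opNorm_comp_le _ _).trans
        (mul_le_mul (hb t ht) h1 (norm_nonneg _) hK.le)
      simpa [Real.coe_toNNReal _ hK.le, mul_comm] using this
    · simpa [Real.coe_toNNReal _ hK.le] using hKε
  obtain ⟨A, hA0, hA⟩ := hpl.exists_eq_forall_mem_Icc_hasDerivWithinAt₀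
  exact ⟨A, hA0, fun t ht => (hA t (Ioo_subset_Icc_self ht)).hasDerivAt (Icc_mem_nhds ht.1 ht.2)⟩

/-- A `C¹` vector field has a local flow which is differentiable in the initial point, with a
jointly continuous derivative. -/
theorem exists_local_flow_hasFDerivAt [FiniteDimensional ℝ E] {g : E → E} {z₀ : E}
    (hg : ContDiffAt ℝ 1 g z₀) {N : Set E} (hN : N ∈ 𝓝 z₀) :
    ∃ r > 0, ∃ ε > 0, ∃ α : E → ℝ → E, ∃ A : E → ℝ → E →L[ℝ] E,
      (∀ z ∈ ball z₀ r, α z 0 = z ∧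
        ∀ t ∈ Ioo (-ε) ε, HasDerivAt (α z) (g (α z t)) t ∧ α z t ∈ N) ∧
      (∀ z ∈ ball z₀ r, ∀ t ∈ Ioo (-ε) ε, HasFDerivAt (α · t) (A z t) z) ∧
      ContinuousOn (Function.uncurry α) (ball z₀ r ×ˢ Ioo (-ε) ε) ∧
      ContinuousOn (Function.uncurry A) (ball z₀ r ×ˢ Ioo (-ε) ε) := by
  have : CompleteSpace E := FiniteDimensional.complete ℝ E
  have : ProperSpace E := FiniteDimensional.proper ℝ E
  obtain ⟨ρ, hρ, hρg⟩ := Metric.nhds_basis_closedBall.mem_iff.1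
    (hg.eventually (by simp))
  replace hρg : ∀ y ∈ closedBall z₀ ρ, ContDiffAt ℝ 1 g y := fun y hy => hρg hy
  have hd : ∀ y ∈ closedBall z₀ ρ, HasFDerivAt g (fderiv ℝ g y) y := fun y hy =>
    ((hρg y hy).differentiableAt (by simp)).hasFDerivAt
  have hc : ContinuousOn (fderiv ℝ g) (closedBall z₀ ρ) := fun y hy =>
    ((hρg y hy).fderiv_right (m := 0) (by simp)).continuousAt.continuousWithinAt
  have hcpt : IsCompact (closedBall z₀ ρ) := isCompact_closedBall _ _
  obtain ⟨K₀, hK₀⟩ := hcpt.exists_bound_of_continuousOn hc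
  set K := max K₀ 1 with hKdef
  have hK : 0 < K := lt_max_of_lt_right one_pos
  have hKb : ∀ y ∈ closedBall z₀ ρ, ‖fderiv ℝ g y‖ ≤ K := fun y hy =>
    (hK₀ y hy).trans (le_max_left _ _)
  have huc := hcpt.uniformContinuousOn_of_continuous hc
  obtain ⟨r, hr, ε₀, hε₀, L, α, hα, hL⟩ := exists_local_flow hg
    (inter_mem hN (closedBall_mem_nhds z₀ hρ))
  -- the bound `1 / (2 * K)` is the one needed to solve the variational equation
  set ε := min (ε₀ / 2) (1 / (2 * K)) with hεdef
  have hε : 0 < ε := lt_min (by linarith) (by positivity)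
  have hεε : ε < ε₀ := (min_le_left _ _).trans_lt (by linarith)
  have hKε : 2 * K * ε ≤ 1 := by
    have : ε ≤ 1 / (2 * K) := min_le_right _ _
    rw [le_div_iff₀ (by positivity)] at this
    linarith
  have hsub : Icc (-ε) ε ⊆ Ioo (-ε₀) ε₀ := fun t ht => ⟨by linarith [ht.1], by linarith [ht.2]⟩
  have hsub' : Ioo (-ε) ε ⊆ Ioo (-ε₀) ε₀ := Ioo_subset_Icc_self.trans hsub
  have hαd : ∀ z ∈ ball z₀ r, ∀ t ∈ Ioo (-ε₀) ε₀, HasDerivAt (α z) (g (α z t)) t :=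
    fun z hz t ht => ((hα z hz).2 t ht).1
  have hαm : ∀ z ∈ ball z₀ r, ∀ t ∈ Ioo (-ε₀) ε₀, α z t ∈ closedBall z₀ ρ :=
    fun z hz t ht => ((hα z hz).2 t ht).2.2
  have hαc : ∀ z ∈ ball z₀ r, ContinuousOn (α z) (Ioo (-ε₀) ε₀) := fun z hz t ht =>
    (hαd z hz t ht).continuousAt.continuousWithinAt
  have hex : ∀ z ∈ ball z₀ r, ∃ A : ℝ → E →L[ℝ] E, A 0 = ContinuousLinearMap.id ℝ E ∧
      ∀ t ∈ Ioo (-ε) ε, HasDerivAt A ((fderiv ℝ g (α z t)).comp (A t)) t := fun z hz =>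
    exists_fundamental_solution hK hε hKε
      (hc.comp ((hαc z hz).mono hsub) fun t ht => hαm z hz t (hsub ht))
      fun t ht => hKb _ (hαm z hz t (hsub ht))
  choose! A hA0 hA using hex
  have hdist : ∀ z ∈ ball z₀ r, ∀ z' ∈ ball z₀ r, ∀ t ∈ Ioo (-ε₀) ε₀,
      ‖α z' t - α z t‖ ≤ L * ‖z' - z‖ := fun z hz z' hz' t ht => by
    simpa [dist_eq_norm] using (hL t ht).dist_le_mul z' hz' z hz
  set B := Real.exp (K * ε)
  have hB : 0 < B := Real.exp_pos _
  have hAb : ∀ z ∈ ball z₀ r, ∀ t ∈ Ioo (-ε) ε, ‖A z t‖ ≤ B := fun z hz t ht => by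
    have := norm_le_of_norm_deriv_le (δ := 1) hK le_rfl (hA z hz)
      (by rw [hA0 z hz]; exact ContinuousLinearMap.norm_id_le)
      (fun s hs => by
        rw [add_zero]
        exact (ContinuousLinearMap.opNorm_comp_le _ _).trans
          (mul_le_mul_of_nonneg_right (hKb _ (hαm z hz s (hsub' hs))) (norm_nonneg _))) ht
    simpa using this
  refine ⟨r, hr, ε, hε, α, A, fun z hz => ⟨(hα z hz).1, fun t ht =>
    ⟨hαd z hz t (hsub' ht), ((hα z hz).2 t (hsub' ht)).2.1⟩⟩, ?_, ?_, ?_⟩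
  · intro z hz t ht
    rw [hasFDerivAt_iff_isLittleO, Asymptotics.isLittleO_iff]
    intro c hc0
    -- `η` is the oscillation of `fderiv ℝ g` along the orbit for which the Grönwall bound is
    -- at most `c ‖z' - z‖`
    set η := c * K / (B * (L + 1)) with hηdef
    have hη : 0 < η := by positivity
    obtain ⟨δ, hδ, hδη⟩ := Metric.uniformContinuousOn_iff.1 huc η hη
    have hnear : ∀ᶠ z' in 𝓝 z, z' ∈ ball z₀ r ∧ L * ‖z' - z‖ < δ := by
      refine Filter.Eventually.and (isOpen_ball.mem_nhds hz) ?_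
      have : Tendsto (fun z' => L * ‖z' - z‖) (𝓝 z) (𝓝 (L * ‖z - z‖)) :=
        (Continuous.tendsto (by fun_prop) z)
      rw [sub_self, norm_zero, mul_zero] at this
      exact this.eventually_lt_const hδ
    filter_upwards [hnear] with z' ⟨hz', hzδ⟩
    have hw : ∀ s ∈ Ioo (-ε) ε, HasDerivAt (fun s => α z' s - α z s - A z s (z' - z))
        (g (α z' s) - g (α z s) - (fderiv ℝ g (α z s)) (A z s (z' - z))) s := fun s hs => by
      have := ((hαd z' hz' s (hsub' hs)).sub (hαd z hz s (hsub' hs))).sub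
        ((hA z hz s hs).clm_apply (hasDerivAt_const s (z' - z)))
      rw [map_zero, add_zero] at this
      exact this
    have hbound : ∀ s ∈ Ioo (-ε) ε,
        ‖g (α z' s) - g (α z s) - (fderiv ℝ g (α z s)) (A z s (z' - z))‖ ≤
        K * ‖α z' s - α z s - A z s (z' - z)‖ + η * (L * ‖z' - z‖) := fun s hs => by
      have hys := hαm z hz s (hsub' hs)
      have hys' := hαm z' hz' s (hsub' hs)
      have hds := hdist z hz z' hz' s (hsub' hs)
      have hmv : ‖g (α z' s) - g (α z s) - (fderiv ℝ g (α z s)) (α z' s - α z s)‖ ≤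
          η * ‖α z' s - α z s‖ := by
        have hcv : Convex ℝ (closedBall z₀ ρ ∩ ball (α z s) δ) :=
          (convex_closedBall _ _).inter (convex_ball _ _)
        refine hcv.norm_image_sub_le_of_norm_hasFDerivWithin_le'
          (f' := fderiv ℝ g) (fun y hy => (hd y hy.1).hasFDerivWithinAt) (fun y hy => ?_)
          ⟨hys, mem_ball_self hδ⟩ ⟨hys', ?_⟩
        · have := hδη y hy.1 _ hys hy.2
          rw [dist_eq_norm] at this
          exact this.le
        · rw [mem_ball, dist_eq_norm]
          exact hds.trans_lt hzδ
      have : g (α z' s) - g (α z s) - (fderiv ℝ g (α z s)) (A z s (z' - z)) =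
          (fderiv ℝ g (α z s)) (α z' s - α z s - A z s (z' - z)) +
          (g (α z' s) - g (α z s) - (fderiv ℝ g (α z s)) (α z' s - α z s)) := by
        simp only [map_sub]; abel
      rw [this]
      refine (norm_add_le _ _).trans (add_le_add ?_ (hmv.trans ?_))
      · exact (ContinuousLinearMap.le_opNorm _ _).trans
          (mul_le_mul_of_nonneg_right (hKb _ hys) (norm_nonneg _))
      · exact mul_le_mul_of_nonneg_left hds hη.le
    have hfin := norm_le_of_norm_deriv_le (δ := 0) hK (by positivity) hw
      (by simp [(hα z hz).1, (hα z' hz').1, hA0 z hz]) hbound ht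
    refine hfin.trans ?_
    have hL1 : (L : ℝ) / (L + 1) ≤ 1 := (div_le_one (by positivity)).2 (by simp)
    calc (0 + η * (L * ‖z' - z‖) / K) * B = c * ‖z' - z‖ * (L / (L + 1)) := by
          rw [hηdef]; field_simp; ring
      _ ≤ c * ‖z' - z‖ * 1 := mul_le_mul_of_nonneg_left hL1 (by positivity)
      _ = c * ‖z' - z‖ := mul_one _
  · refine continuousOn_prod_of_continuousOn_lipschitzOnWith _ L
      (fun z hz => (hαc z hz).mono hsub') (fun t ht => hL t (hsub' ht))
  · rintro ⟨z, t⟩ ⟨hz, ht⟩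
    rw [Metric.continuousWithinAt_iff]
    intro c hc0
    -- `η` is the oscillation of `fderiv ℝ g` along the orbit that moves `A` by at most `c / 2`;
    -- the other half of `c` is the continuity of `A z` in time
    set η := c / 2 * K / (B * B) with hηdef
    have hη : 0 < η := by positivity
    obtain ⟨δ, hδ, hδη⟩ := Metric.uniformContinuousOn_iff.1 huc η hη
    obtain ⟨δ₁, hδ₁, hA1⟩ := Metric.continuousAt_iff.1 (hA z hz t ht).continuousAt (c / 2)
      (by linarith)
    refine ⟨min δ₁ (δ / (L + 1)), lt_min hδ₁ (by positivity), ?_⟩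
    rintro ⟨z', t'⟩ ⟨hz', ht'⟩ hd'
    rw [Prod.dist_eq, max_lt_iff] at hd'
    have hzz : L * ‖z' - z‖ < δ := by
      have h1 : ‖z' - z‖ < δ / (L + 1) := by
        rw [← dist_eq_norm]; exact hd'.1.trans_le (min_le_right _ _)
      rw [lt_div_iff₀ (by positivity)] at h1
      nlinarith [norm_nonneg (z' - z)]
    have hdA : ∀ s ∈ Ioo (-ε) ε, HasDerivAt (fun s => A z' s - A z s)
        ((fderiv ℝ g (α z' s)).comp (A z' s) - (fderiv ℝ g (α z s)).comp (A z s)) s :=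
      fun s hs => (hA z' hz' s hs).sub (hA z hz s hs)
    have hbA : ∀ s ∈ Ioo (-ε) ε,
        ‖(fderiv ℝ g (α z' s)).comp (A z' s) - (fderiv ℝ g (α z s)).comp (A z s)‖ ≤
        K * ‖A z' s - A z s‖ + η * B := fun s hs => by
      have hys := hαm z hz s (hsub' hs)
      have hys' := hαm z' hz' s (hsub' hs)
      have : (fderiv ℝ g (α z' s)).comp (A z' s) - (fderiv ℝ g (α z s)).comp (A z s) =
          (fderiv ℝ g (α z' s)).comp (A z' s - A z s) +
          (fderiv ℝ g (α z' s) - fderiv ℝ g (α z s)).comp (A z s) := by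
        simp only [ContinuousLinearMap.comp_sub, ContinuousLinearMap.sub_comp]; abel
      rw [this]
      refine (norm_add_le _ _).trans (add_le_add ?_ ?_)
      · exact (ContinuousLinearMap.opNorm_comp_le _ _).trans
          (mul_le_mul_of_nonneg_right (hKb _ hys') (norm_nonneg _))
      · refine (ContinuousLinearMap.opNorm_comp_le _ _).trans
          (mul_le_mul ?_ (hAb z hz s hs) (norm_nonneg _) hη.le)
        have := hδη _ hys' _ hys (by
          rw [dist_eq_norm]; exact (hdist z hz z' hz' s (hsub' hs)).trans_lt hzz)
        rw [dist_eq_norm] at this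
        exact this.le
    have h1 := norm_le_of_norm_deriv_le (δ := 0) hK (by positivity) hdA
      (by simp [hA0 z hz, hA0 z' hz']) hbA ht'
    have h2 : (0 + η * B / K) * B = c / 2 := by rw [hηdef]; field_simp; ring
    rw [h2, ← dist_eq_norm] at h1
    have h3 := hA1 (hd'.2.trans_le (min_le_left _ _))
    calc dist (A z' t') (A z t) ≤ dist (A z' t') (A z t') + dist (A z t') (A z t) :=
          dist_triangle _ _ _
      _ < c := by linarith

end FlatODE

/-! ### The tangent flow -/

section TangentFlow

variable {d : ℕ} {M : Type*} [TopologicalSpace M] [ChartedSpace (EuclideanSpace ℝ (Fin d)) M]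

/-- The tangent flow `(x, v) ↦ (X_t x, DX_t(x) v)` on the tangent bundle. -/
def tangentFlow (X : ℝ → M → M) (t : ℝ) (y : TangentBundle (𝓡 d) M) : TangentBundle (𝓡 d) M :=
  ⟨X t y.1, DX X t y.1 y.2⟩

theorem IsFlowOf.map_zero {G : ∀ x : M, TangentSpace (𝓡 d) x} {X : ℝ → M → M}
    (hX : IsFlowOf G X) (x : M) : X 0 x = x :=
  (hX x).1

/-- Tangent vectors over equal base points; the fibres of the tangent bundle are all definitionally
the model space. -/
theorem totalSpace_mk_congr {x z : M} (h : x = z) (v : EuclideanSpace ℝ (Fin d)) :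
    (⟨x, v⟩ : TangentBundle (𝓡 d) M) = ⟨z, v⟩ := by
  subst h; rfl

theorem IsFlowOf.tangentFlow_zero {G : ∀ x : M, TangentSpace (𝓡 d) x} {X : ℝ → M → M}
    (hX : IsFlowOf G X) (y : TangentBundle (𝓡 d) M) :
    tangentFlow X 0 y = y := by
  have h : X 0 = id := funext fun x => (hX x).1
  have : tangentFlow X 0 y = tangentMap (𝓡 d) (𝓡 d) (X 0) y := rfl
  rw [this, h, tangentMap_id]
  rfl

variable [IsManifold (𝓡 d) 1 M]

theorem IsFlowOf.map_add [T2Space M] {G : ∀ x : M, TangentSpace (𝓡 d) x} {X : ℝ → M → M}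
    (hX : IsFlowOf G X)
    (hG : ContMDiff (𝓡 d) (𝓡 d).tangent 1 (fun x => (⟨x, G x⟩ : TangentBundle (𝓡 d) M)))
    (s t : ℝ) (x : M) : X (s + t) x = X s (X t x) := by
  have h1 : IsMIntegralCurve (I := 𝓡 d) ((fun r => X r x) ∘ (· + t)) G := (hX x).2.comp_add t
  have := isMIntegralCurve_Ioo_eq_of_contMDiff_boundaryless (t₀ := 0) hG h1 (hX (X t x)).2
    (by simp [(hX (X t x)).1])
  exact congrFun this s

/-- Integral curves of the coordinate expression of a vector field in a chart are integral curves
of the vector field. -/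
theorem isMIntegralCurveOn_extChartAt_symm {G : ∀ x : M, TangentSpace (𝓡 d) x} (x₀ : M)
    {f : ℝ → EuclideanSpace ℝ (Fin d)} {s : Set ℝ}
    (hf : ∀ t ∈ s, HasDerivAt f (tangentCoordChange (𝓡 d) ((extChartAt (𝓡 d) x₀).symm (f t)) x₀
      ((extChartAt (𝓡 d) x₀).symm (f t)) (G ((extChartAt (𝓡 d) x₀).symm (f t)))) t)
    (hm : ∀ t ∈ s, f t ∈ (extChartAt (𝓡 d) x₀).target) :
    IsMIntegralCurveOn (I := 𝓡 d) ((extChartAt (𝓡 d) x₀).symm ∘ f) G s := by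
  intro t ht
  let xₜ : M := (extChartAt (𝓡 d) x₀).symm (f t)
  have h := hf t ht
  have hf3 := hm t ht
  have hft1 : xₜ ∈ (extChartAt (𝓡 d) x₀).source := (extChartAt (𝓡 d) x₀).map_target hf3
  have hft2 := mem_extChartAt_source (I := 𝓡 d) xₜ
  apply HasMFDerivAt.hasMFDerivWithinAt
  refine ⟨(continuousAt_extChartAt_symm'' hf3).comp h.continuousAt, ?_⟩
  have key : ∀ v : EuclideanSpace ℝ (Fin d),
      HasDerivAt f (tangentCoordChange (𝓡 d) xₜ x₀ xₜ v) t →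
      HasFDerivAt ((extChartAt (𝓡 d) xₜ ∘ (extChartAt (𝓡 d) x₀).symm) ∘ f)
        ((1 : ℝ →L[ℝ] ℝ).smulRight v) t := by
    intro v hv
    rw [ContinuousLinearMap.smulRight_one_eq_toSpanSingleton]
    refine HasDerivAt.hasFDerivAt ?_
    rw [← tangentCoordChange_self (I := 𝓡 d) (x := xₜ) (z := xₜ) (v := v) hft2,
      ← tangentCoordChange_comp (x := x₀) ⟨⟨hft2, hft1⟩, hft2⟩]
    apply HasFDerivAt.comp_hasDerivAt _ _ hv
    apply HasFDerivWithinAt.hasFDerivAt (s := range (𝓡 d)) _ (by simp)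
    rw [← (extChartAt (𝓡 d) x₀).right_inv hf3]
    exact hasFDerivWithinAt_tangentCoordChange ⟨hft1, hft2⟩
  exact (key (G xₜ) h).hasFDerivWithinAt

variable [T2Space M] {G : ∀ x : M, TangentSpace (𝓡 d) x} {X : ℝ → M → M}

/-- For small times the flow is differentiable and the tangent flow is continuous. -/
theorem IsFlowOf.exists_local (hX : IsFlowOf G X)
    (hG : ContMDiff (𝓡 d) (𝓡 d).tangent 1 (fun x => (⟨x, G x⟩ : TangentBundle (𝓡 d) M)))
    (x₀ : M) :
    ∃ u ∈ 𝓝 x₀, ∃ ε > 0, ∀ t ∈ Ioo (-ε) ε, ∀ y : TangentBundle (𝓡 d) M, y.1 ∈ u →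
      MDifferentiableAt (𝓡 d) (𝓡 d) (X t) y.1 ∧
      ContinuousAt (fun p : ℝ × TangentBundle (𝓡 d) M => tangentFlow X p.1 p.2) (t, y) := by
  set φ := extChartAt (𝓡 d) x₀ with hφ
  let g : EuclideanSpace ℝ (Fin d) → EuclideanSpace ℝ (Fin d) := fun z =>
    tangentCoordChange (𝓡 d) (φ.symm z) x₀ (φ.symm z) (G (φ.symm z))
  have hg : ContDiffAt ℝ 1 g (φ x₀) := by
    have hv := (contMDiffAt_iff.1 (hG x₀)).2
    exact (hv.contDiffAt (by simp)).snd
  have htgt : IsOpen φ.target := isOpen_extChartAt_target x₀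
  have hsrc : IsOpen φ.source := isOpen_extChartAt_source x₀
  obtain ⟨r, hr, ε, hε, α, A, hα, hαA, hαc, hAc⟩ := exists_local_flow_hasFDerivAt hg
    (htgt.mem_nhds (mem_extChartAt_target x₀))
  set u : Set M := φ.source ∩ φ ⁻¹' Metric.ball (φ x₀) r with hu
  have huo : IsOpen u := (continuousOn_extChartAt x₀).isOpen_inter_preimage hsrc Metric.isOpen_ball
  have hux : x₀ ∈ u := ⟨mem_extChartAt_source x₀, Metric.mem_ball_self hr⟩
  have hε0 : (0 : ℝ) ∈ Ioo (-ε) ε := ⟨by linarith, hε⟩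
  have hXα : ∀ x ∈ u, ∀ t ∈ Ioo (-ε) ε, X t x = φ.symm (α (φ x) t) := fun x hx t ht => by
    have h1 := isMIntegralCurveOn_extChartAt_symm (G := G) x₀ (f := α (φ x)) (s := Ioo (-ε) ε)
      (fun t ht => ((hα _ hx.2).2 t ht).1) (fun t ht => ((hα _ hx.2).2 t ht).2)
    have h2 := isMIntegralCurveOn_Ioo_eqOn_of_contMDiff_boundaryless hε0 hG
      ((hX x).2.isMIntegralCurveOn _) h1 (by
        simp only [Function.comp]
        rw [(hα _ hx.2).1, (hX x).1]
        exact (φ.left_inv hx.1).symm)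
    exact h2 ht
  -- the chain rule in the chart
  have hder : ∀ x ∈ u, ∀ t ∈ Ioo (-ε) ε, HasMFDerivAt (𝓡 d) (𝓡 d) (X t) x
      ((mfderivWithin 𝓘(ℝ, EuclideanSpace ℝ (Fin d)) (𝓡 d) φ.symm φ.target (α (φ x) t)).comp
        ((A (φ x) t).comp (mfderivWithin (𝓡 d) 𝓘(ℝ, EuclideanSpace ℝ (Fin d)) φ φ.source x))) := by
    intro x hx t ht
    have h1 : HasMFDerivAt (𝓡 d) 𝓘(ℝ, EuclideanSpace ℝ (Fin d)) φ x
        (mfderivWithin (𝓡 d) 𝓘(ℝ, EuclideanSpace ℝ (Fin d)) φ φ.source x) := by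
      have : MDifferentiableAt (𝓡 d) 𝓘(ℝ, EuclideanSpace ℝ (Fin d)) φ x :=
        mdifferentiableAt_extChartAt (by simpa [hφ] using hx.1)
      rw [mfderivWithin_of_isOpen hsrc hx.1]
      exact this.hasMFDerivAt
    have h2 := (hαA _ hx.2 t ht).hasMFDerivAt
    have hmt := ((hα _ hx.2).2 t ht).2
    have h3 : HasMFDerivAt 𝓘(ℝ, EuclideanSpace ℝ (Fin d)) (𝓡 d) φ.symm (α (φ x) t)
        (mfderivWithin 𝓘(ℝ, EuclideanSpace ℝ (Fin d)) (𝓡 d) φ.symm φ.target (α (φ x) t)) := by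
      have : MDifferentiableWithinAt 𝓘(ℝ, EuclideanSpace ℝ (Fin d)) (𝓡 d) φ.symm φ.target
          (α (φ x) t) :=
        ((contMDiffOn_extChartAt_symm (n := 1) x₀) _ hmt).mdifferentiableWithinAt (by simp)
      exact this.hasMFDerivWithinAt.hasMFDerivAt (htgt.mem_nhds hmt)
    refine (HasMFDerivAt.comp x h3 (HasMFDerivAt.comp x h2 h1)).congr_of_eventuallyEq ?_
    filter_upwards [huo.mem_nhds hx] with x' hx'
    exact hXα x' hx' t ht
  refine ⟨u, huo.mem_nhds hux, ε, hε, fun t ht y hy => ⟨(hder y.1 hy t ht).mdifferentiableAt, ?_⟩⟩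
  let e := tangentBundleModelSpaceHomeomorph 𝓘(ℝ, EuclideanSpace ℝ (Fin d))
  let τ : TangentBundle (𝓡 d) M → TangentBundle 𝓘(ℝ, EuclideanSpace ℝ (Fin d))
    (EuclideanSpace ℝ (Fin d)) :=
    tangentMapWithin (𝓡 d) 𝓘(ℝ, EuclideanSpace ℝ (Fin d)) φ φ.source
  let σ : TangentBundle 𝓘(ℝ, EuclideanSpace ℝ (Fin d))
    (EuclideanSpace ℝ (Fin d)) → TangentBundle (𝓡 d) M :=
    tangentMapWithin 𝓘(ℝ, EuclideanSpace ℝ (Fin d)) (𝓡 d) φ.symm φ.target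
  have hτ : ContinuousOn τ (TotalSpace.proj ⁻¹' φ.source) := by
    have : ContMDiffOn (𝓡 d) 𝓘(ℝ, EuclideanSpace ℝ (Fin d)) 1 φ φ.source := by
      have := contMDiffOn_extChartAt (I := 𝓡 d) (n := 1) (x := x₀)
      rwa [← extChartAt_source (𝓡 d)] at this
    exact this.continuousOn_tangentMapWithin le_rfl hsrc.uniqueMDiffOn
  have hσ : ContinuousOn σ (TotalSpace.proj ⁻¹' φ.target) :=
    (contMDiffOn_extChartAt_symm (n := 1) x₀).continuousOn_tangentMapWithin le_rfl
      htgt.uniqueMDiffOn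
  let W : Set (ℝ × TangentBundle (𝓡 d) M) := Ioo (-ε) ε ×ˢ (TotalSpace.proj ⁻¹' u)
  have hproj : Continuous (TotalSpace.proj : TangentBundle (𝓡 d) M → M) :=
    FiberBundle.continuous_proj (EuclideanSpace ℝ (Fin d)) (TangentSpace (𝓡 d))
  have hWo : IsOpen W := isOpen_Ioo.prod (huo.preimage hproj)
  let q : ℝ × TangentBundle (𝓡 d) M → TangentBundle 𝓘(ℝ, EuclideanSpace ℝ (Fin d))
    (EuclideanSpace ℝ (Fin d)) := fun p =>
      e.symm (α (φ p.2.1) p.1, A (φ p.2.1) p.1 (e (τ p.2)).2)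
  have hq : ContinuousOn q W := by
    have hz : ContinuousOn (fun p : ℝ × TangentBundle (𝓡 d) M => (φ p.2.1, p.1)) W := by
      refine ContinuousOn.prodMk ?_ continuousOn_fst
      exact (continuousOn_extChartAt x₀).comp (hproj.comp continuous_snd).continuousOn
        fun p hp => hp.2.1
    have hzm : MapsTo (fun p : ℝ × TangentBundle (𝓡 d) M => (φ p.2.1, p.1)) W
        (Metric.ball (φ x₀) r ×ˢ Ioo (-ε) ε) := fun p hp => ⟨hp.2.2, hp.1⟩
    have hτ' : ContinuousOn (fun p : ℝ × TangentBundle (𝓡 d) M => (e (τ p.2)).2) W :=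
      (continuous_snd.comp e.continuous).comp_continuousOn
        (hτ.comp continuousOn_snd fun p hp => hp.2.1)
    have h1 := hαc.comp hz hzm
    have h2 := hAc.comp hz hzm
    exact e.symm.continuous.comp_continuousOn (h1.prodMk (h2.clm_apply hτ'))
  have hσq : ContinuousOn (fun p => σ (q p)) W :=
    hσ.comp hq fun p hp => ((hα _ hp.2.2).2 _ hp.1).2
  have hyW : (t, y) ∈ W := ⟨ht, hy⟩
  refine (hσq.continuousAt (hWo.mem_nhds hyW)).congr ?_
  filter_upwards [hWo.mem_nhds hyW] with p hp
  have h1 := (hder _ hp.2 _ hp.1).mfderiv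
  have h2 : tangentFlow X p.1 p.2 = ⟨X p.1 p.2.1, mfderiv (𝓡 d) (𝓡 d) (X p.1) p.2.1 p.2.2⟩ := rfl
  rw [h2, h1]
  exact (totalSpace_mk_congr (hXα _ hp.2 _ hp.1) _).symm

theorem tangentFlow_add_of_mdifferentiableAt (hX : IsFlowOf G X)
    (hG : ContMDiff (𝓡 d) (𝓡 d).tangent 1 (fun x => (⟨x, G x⟩ : TangentBundle (𝓡 d) M)))
    {s t : ℝ} {y : TangentBundle (𝓡 d) M} (ht : MDifferentiableAt (𝓡 d) (𝓡 d) (X t) y.1)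
    (hs : MDifferentiableAt (𝓡 d) (𝓡 d) (X s) (X t y.1)) :
    MDifferentiableAt (𝓡 d) (𝓡 d) (X (s + t)) y.1 ∧
      tangentFlow X (s + t) y = tangentFlow X s (tangentFlow X t y) := by
  have h : X (s + t) = X s ∘ X t := funext fun x => hX.map_add hG s t x
  have hc := mfderiv_comp y.1 hs ht
  refine ⟨h ▸ hs.comp y.1 ht, ?_⟩
  have h2 : tangentFlow X s (tangentFlow X t y) = tangentMap (𝓡 d) (𝓡 d) (X s ∘ X t) y := by
    simp only [tangentMap, hc]; rfl
  rw [h2, ← h]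
  rfl

variable [CompactSpace M]

/-- The flow of a `C¹` vector field on a compact manifold is differentiable, and the tangent flow
is continuous. -/
theorem IsFlowOf.mdifferentiableAt_and_continuousAt (hX : IsFlowOf G X)
    (hG : ContMDiff (𝓡 d) (𝓡 d).tangent 1 (fun x => (⟨x, G x⟩ : TangentBundle (𝓡 d) M)))
    (t : ℝ) (y : TangentBundle (𝓡 d) M) :
    MDifferentiableAt (𝓡 d) (𝓡 d) (X t) y.1 ∧
      ContinuousAt (fun p : ℝ × TangentBundle (𝓡 d) M => tangentFlow X p.1 p.2) (t, y) := by
  -- the statement for `|t| < ε` holds for small `ε`, and by the group law it passes to `2 * ε`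
  let P : ℝ → Prop := fun ε => ∀ t ∈ Ioo (-ε) ε, ∀ y : TangentBundle (𝓡 d) M,
    MDifferentiableAt (𝓡 d) (𝓡 d) (X t) y.1 ∧
      ContinuousAt (fun p : ℝ × TangentBundle (𝓡 d) M => tangentFlow X p.1 p.2) (t, y)
  have hdouble : ∀ ε, P ε → P (2 * ε) := by
    intro ε hP t ht y
    have ht2 : ∀ s ∈ Ioo (-(2 * ε)) (2 * ε), s / 2 ∈ Ioo (-ε) ε := fun s hs =>
      ⟨by linarith [hs.1], by linarith [hs.2]⟩
    have hadd : ∀ s ∈ Ioo (-(2 * ε)) (2 * ε), ∀ z : TangentBundle (𝓡 d) M,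
        MDifferentiableAt (𝓡 d) (𝓡 d) (X s) z.1 ∧
        tangentFlow X s z = tangentFlow X (s / 2) (tangentFlow X (s / 2) z) := fun s hs z => by
      have := tangentFlow_add_of_mdifferentiableAt hX hG (hP _ (ht2 s hs) z).1
        (hP _ (ht2 s hs) (tangentFlow X (s / 2) z)).1
      rwa [add_halves] at this
    refine ⟨(hadd t ht y).1, ?_⟩
    have h1 : ContinuousAt (fun p : ℝ × TangentBundle (𝓡 d) M => tangentFlow X (p.1 / 2) p.2)
        (t, y) :=
      ContinuousAt.comp' (x := (t, y)) (f := fun p : ℝ × TangentBundle (𝓡 d) M => (p.1 / 2, p.2))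
        (g := fun p => tangentFlow X p.1 p.2) (hP _ (ht2 t ht) y).2
          ((continuous_fst.div_const 2).prodMk continuous_snd).continuousAt
    have h2 : ContinuousAt (fun p : ℝ × TangentBundle (𝓡 d) M =>
        tangentFlow X (p.1 / 2) (tangentFlow X (p.1 / 2) p.2)) (t, y) :=
      ContinuousAt.comp' (x := (t, y)) (f := fun p : ℝ × TangentBundle (𝓡 d) M =>
        (p.1 / 2, tangentFlow X (p.1 / 2) p.2)) (g := fun p => tangentFlow X p.1 p.2)
        (hP _ (ht2 t ht) _).2
        ((continuous_fst.div_const 2).continuousAt.prodMk h1)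
    refine h2.congr ?_
    have : Ioo (-(2 * ε)) (2 * ε) ×ˢ univ ∈ 𝓝 (t, y) :=
      prod_mem_nhds (Ioo_mem_nhds ht.1 ht.2) univ_mem
    filter_upwards [this] with p hp
    exact (hadd _ hp.1 _).2.symm
  have hsmall : ∃ ε > 0, P ε := by
    choose u hu ε hε h using hX.exists_local hG
    obtain ⟨s, hs⟩ := isCompact_univ.elim_nhds_subcover u fun x _ => hu x
    have hfin : ∃ δ > 0, ∀ x ∈ s, δ ≤ ε x := by
      classical
      refine s.induction_on ⟨1, one_pos, by simp⟩ ?_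
      rintro a s _ ⟨δ, hδ, hs⟩
      refine ⟨min δ (ε a), lt_min hδ (hε a), fun x hx => ?_⟩
      rcases Finset.mem_insert.1 hx with rfl | hx
      · exact min_le_right _ _
      · exact (min_le_left _ _).trans (hs x hx)
    obtain ⟨δ, hδ, hδs⟩ := hfin
    refine ⟨δ, hδ, fun t ht y => ?_⟩
    obtain ⟨x, hx, hyx⟩ := mem_iUnion₂.1 (hs.2 (mem_univ y.1))
    exact h x t ⟨by linarith [ht.1, hδs x hx], by linarith [ht.2, hδs x hx]⟩ y hyx
  obtain ⟨ε, hε, hP⟩ := hsmall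
  have hpow : ∀ n : ℕ, P (2 ^ n * ε) := by
    intro n
    induction n with
    | zero => simpa using hP
    | succ n ih => rw [pow_succ', mul_assoc]; exact hdouble _ ih
  obtain ⟨n, hn⟩ := pow_unbounded_of_one_lt (|t| / ε) (one_lt_two)
  rw [div_lt_iff₀ hε] at hn
  exact hpow n t (abs_lt.1 hn) y

theorem IsFlowOf.continuous_tangentFlow (hX : IsFlowOf G X)
    (hG : ContMDiff (𝓡 d) (𝓡 d).tangent 1 (fun x => (⟨x, G x⟩ : TangentBundle (𝓡 d) M))) :
    Continuous (fun p : ℝ × TangentBundle (𝓡 d) M => tangentFlow X p.1 p.2) :=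
  continuous_iff_continuousAt.2 fun p => (hX.mdifferentiableAt_and_continuousAt hG p.1 p.2).2

theorem IsFlowOf.tangentFlow_add (hX : IsFlowOf G X)
    (hG : ContMDiff (𝓡 d) (𝓡 d).tangent 1 (fun x => (⟨x, G x⟩ : TangentBundle (𝓡 d) M)))
    (s t : ℝ) (y : TangentBundle (𝓡 d) M) :
    tangentFlow X (s + t) y = tangentFlow X s (tangentFlow X t y) :=
  (tangentFlow_add_of_mdifferentiableAt hX hG (hX.mdifferentiableAt_and_continuousAt hG t y).1
    (hX.mdifferentiableAt_and_continuousAt hG s (tangentFlow X t y)).1).2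

end TangentFlow

/-! ### Compactness and continuity in the tangent bundle -/

section BundleTopology

variable {d : ℕ} {M : Type*} [TopologicalSpace M] [ChartedSpace (EuclideanSpace ℝ (Fin d)) M]

instance instFiniteDimensionalTangentSpace (x : M) : FiniteDimensional ℝ (TangentSpace (𝓡 d) x) :=
  inferInstanceAs (FiniteDimensional ℝ (EuclideanSpace ℝ (Fin d)))

theorem finrank_tangentSpace (x : M) : Module.finrank ℝ (TangentSpace (𝓡 d) x) = d :=
  finrank_euclideanSpace_fin

/-- The projection of `T_x M` onto `E x` along `F x` (zero where these are not complementary). -/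
def projAlong (E F : ∀ x : M, Submodule ℝ (TangentSpace (𝓡 d) x)) (x : M) :
    TangentSpace (𝓡 d) x →ₗ[ℝ] TangentSpace (𝓡 d) x :=
  open Classical in if h : IsCompl (E x) (F x) then (E x).projection (F x) h else 0

/-- The projection `projAlong E F` as a map of the tangent bundle. -/
def projTM (E F : ∀ x : M, Submodule ℝ (TangentSpace (𝓡 d) x)) (y : TangentBundle (𝓡 d) M) :
    TangentBundle (𝓡 d) M :=
  ⟨y.1, projAlong E F y.1 y.2⟩

variable {E F : ∀ x : M, Submodule ℝ (TangentSpace (𝓡 d) x)} {x : M}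

theorem projAlong_mem (h : IsCompl (E x) (F x)) (v : TangentSpace (𝓡 d) x) :
    projAlong E F x v ∈ E x := by
  rw [projAlong, dif_pos h]; exact Submodule.projection_apply_mem h v

theorem projAlong_add_projAlong (h : IsCompl (E x) (F x)) (v : TangentSpace (𝓡 d) x) :
    projAlong E F x v + projAlong F E x v = v := by
  rw [projAlong, projAlong, dif_pos h, dif_pos h.symm]
  exact Submodule.projection_add_projection_eq_self h v

theorem projAlong_of_mem_left (h : IsCompl (E x) (F x)) {v : TangentSpace (𝓡 d) x}
    (hv : v ∈ E x) : projAlong E F x v = v := by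
  rw [projAlong, dif_pos h]; exact Submodule.projection_apply_of_mem_left h hv

theorem projAlong_of_mem_right (h : IsCompl (E x) (F x)) {v : TangentSpace (𝓡 d) x}
    (hv : v ∈ F x) : projAlong E F x v = 0 := by
  rw [projAlong, dif_pos h]; exact (Submodule.projection_apply_eq_zero_iff h).2 hv

theorem projAlong_eq_zero_iff (h : IsCompl (E x) (F x)) {v : TangentSpace (𝓡 d) x} :
    projAlong E F x v = 0 ↔ v ∈ F x := by
  rw [projAlong, dif_pos h]; exact Submodule.projection_apply_eq_zero_iff h

variable [IsManifold (𝓡 d) 1 M]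

theorem continuous_tangentBundle_proj :
    Continuous (TotalSpace.proj : TangentBundle (𝓡 d) M → M) :=
  FiberBundle.continuous_proj (EuclideanSpace ℝ (Fin d)) (TangentSpace (𝓡 d))

theorem continuousLinearMapAt_eq_snd {x₀ x : M}
    (hx : x ∈ (trivializationAt (EuclideanSpace ℝ (Fin d)) (TangentSpace (𝓡 d)) x₀).baseSet)
    (v : TangentSpace (𝓡 d) x) :
    (trivializationAt (EuclideanSpace ℝ (Fin d)) (TangentSpace (𝓡 d)) x₀).continuousLinearMapAt ℝ
      x v = (trivializationAt (EuclideanSpace ℝ (Fin d)) (TangentSpace (𝓡 d)) x₀ ⟨x, v⟩).2 := by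
  rw [Trivialization.continuousLinearMapAt_apply, Trivialization.coe_linearMapAt_of_mem _ hx]

theorem continuousAt_trivializationAt_snd {x₀ : M} {y : TangentBundle (𝓡 d) M}
    (hy : y.1 ∈ (trivializationAt (EuclideanSpace ℝ (Fin d)) (TangentSpace (𝓡 d)) x₀).baseSet) :
    ContinuousAt (fun y : TangentBundle (𝓡 d) M =>
      (trivializationAt (EuclideanSpace ℝ (Fin d)) (TangentSpace (𝓡 d)) x₀ y).2) y :=
  continuous_snd.continuousAt.comp
    ((trivializationAt (EuclideanSpace ℝ (Fin d)) (TangentSpace (𝓡 d)) x₀).continuousAt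
      ((Trivialization.mem_source _).2 hy))

/-- Constant sections in a trivialization are continuous. -/
theorem continuousOn_trivializationAt_symmL (x₀ : M) :
    ContinuousOn (fun z : M × EuclideanSpace ℝ (Fin d) =>
      (⟨z.1, (trivializationAt (EuclideanSpace ℝ (Fin d)) (TangentSpace (𝓡 d)) x₀).symmL ℝ z.1 z.2⟩
        : TangentBundle (𝓡 d) M))
      ((trivializationAt (EuclideanSpace ℝ (Fin d)) (TangentSpace (𝓡 d)) x₀).baseSet ×ˢ univ) := by
  have h := (trivializationAt (EuclideanSpace ℝ (Fin d)) (TangentSpace (𝓡 d)) x₀).continuousOn_symm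
  refine h.congr fun z hz => ?_
  rw [Trivialization.symmL_apply]
  exact hz.1

theorem t2Space_tangentBundle [T2Space M] : T2Space (TangentBundle (𝓡 d) M) := by
  refine t2_iff_ultrafilter.2 fun {y z} 𝒰 hy hz => ?_
  have h1 : y.proj = z.proj := tendsto_nhds_unique
    ((continuous_tangentBundle_proj.tendsto y).mono_left hy)
    ((continuous_tangentBundle_proj.tendsto z).mono_left hz)
  let e := trivializationAt (EuclideanSpace ℝ (Fin d)) (TangentSpace (𝓡 d) (M := M)) y.proj
  have hys : y ∈ e.source := FiberBundle.mem_trivializationAt_proj_source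
  have hzs : z ∈ e.source := by
    rw [e.mem_source, ← h1]; exact FiberBundle.mem_baseSet_trivializationAt' _
  refine e.injOn hys hzs (tendsto_nhds_unique (f := e) (l := 𝒰)
    ((e.continuousAt hys).mono_left hy) ((e.continuousAt hzs).mono_left hz))

section Norm

variable [RiemannianBundle (fun x : M => TangentSpace (𝓡 d) x)]
  [IsContinuousRiemannianBundle (EuclideanSpace ℝ (Fin d)) (fun x : M => TangentSpace (𝓡 d) x)]

theorem continuous_norm_snd : Continuous (fun y : TangentBundle (𝓡 d) M => ‖y.2‖) := by
  have h : Continuous (fun y : TangentBundle (𝓡 d) M => inner ℝ y.2 y.2) :=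
    Continuous.inner_bundle (F := EuclideanSpace ℝ (Fin d))
      (E := fun x : M => TangentSpace (𝓡 d) x) (b := fun y : TangentBundle (𝓡 d) M => y.1)
      (v := fun y => y.2) (w := fun y => y.2) continuous_id continuous_id
  refine (Real.continuous_sqrt.comp h).congr fun y => ?_
  simp only [Function.comp, real_inner_self_eq_norm_sq]
  exact Real.sqrt_sq (norm_nonneg _)

/-- Closed disc bundles over a compact manifold are compact: an ultrafilter on one converges in the
base, and then in the fibre of a trivialization, where the Riemannian norm is comparable to the
model norm. -/
theorem isCompact_setOf_norm_le [CompactSpace M] (R : ℝ) :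
    IsCompact {y : TangentBundle (𝓡 d) M | ‖y.2‖ ≤ R} := by
  rw [isCompact_iff_ultrafilter_le_nhds]
  intro 𝒰 h𝒰
  have hR : ∀ᶠ y in (𝒰 : Filter (TangentBundle (𝓡 d) M)), ‖y.2‖ ≤ R := le_principal_iff.1 h𝒰
  obtain ⟨x₀, -, hx₀⟩ := isCompact_iff_ultrafilter_le_nhds.1 (isCompact_univ (X := M))
    (𝒰.map TotalSpace.proj) (by simp)
  have hproj : Tendsto (TotalSpace.proj : TangentBundle (𝓡 d) M → M) 𝒰 (𝓝 x₀) := hx₀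
  let e := trivializationAt (EuclideanSpace ℝ (Fin d)) (TangentSpace (𝓡 d) (M := M)) x₀
  have hmem : x₀ ∈ e.baseSet := FiberBundle.mem_baseSet_trivializationAt' x₀
  obtain ⟨C, hC, hCe⟩ := eventually_norm_trivializationAt_lt (EuclideanSpace ℝ (Fin d))
    (fun x : M => TangentSpace (𝓡 d) x) x₀
  have hbase := hproj.eventually (e.open_baseSet.mem_nhds hmem)
  have hbd : ∀ᶠ y in (𝒰 : Filter (TangentBundle (𝓡 d) M)),
      (e y).2 ∈ Metric.closedBall (0 : EuclideanSpace ℝ (Fin d)) (C * R) := by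
    filter_upwards [hR, hproj.eventually hCe, hbase] with y hy1 hy2 hy3
    rw [mem_closedBall_zero_iff]
    have : (e y).2 = e.continuousLinearMapAt ℝ y.1 y.2 := (continuousLinearMapAt_eq_snd hy3 _).symm
    rw [this]
    exact (ContinuousLinearMap.le_opNorm _ _).trans (mul_le_mul hy2.le hy1 (norm_nonneg _) hC.le)
  obtain ⟨w, -, hw⟩ := isCompact_iff_ultrafilter_le_nhds.1 (isCompact_closedBall _ _)
    (𝒰.map fun y => (e y).2) (le_principal_iff.2 hbd)
  have hlim : (𝒰 : Filter (TangentBundle (𝓡 d) M)) ≤ 𝓝 ⟨x₀, e.symm x₀ w⟩ := by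
    have : Tendsto id (𝒰 : Filter (TangentBundle (𝓡 d) M)) (𝓝 ⟨x₀, e.symm x₀ w⟩) := by
      rw [e.tendsto_nhds_iff (by rw [e.mem_source]; exact hmem)]
      refine ⟨hproj, ?_⟩
      rw [e.apply_mk_symm hmem]
      exact hw
    exact this
  exact ⟨_, le_of_tendsto ((continuous_norm_snd.tendsto _).mono_left hlim) hR, hlim⟩

/-- A property of a time and two tangent vectors over the same point that holds locally at all
vectors of norm at most `1` over a set `Λ` and at all times of a compact set, holds for all such
times and vectors over a neighbourhood of `Λ`. -/
theorem eventually_nhdsSet_of_forall_eventually [CompactSpace M] [T2Space M] {I : Set ℝ}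
    (hI : IsCompact I) {Λ : Set M}
    {P : ℝ × TangentBundle (𝓡 d) M × TangentBundle (𝓡 d) M → Prop}
    (hP : ∀ t ∈ I, ∀ x ∈ Λ, ∀ v w : TangentSpace (𝓡 d) x, ‖v‖ ≤ 1 → ‖w‖ ≤ 1 →
      ∀ᶠ z in 𝓝 ((t, ⟨x, v⟩, ⟨x, w⟩) : ℝ × TangentBundle (𝓡 d) M × TangentBundle (𝓡 d) M), P z) :
    ∀ᶠ x in 𝓝ˢ Λ, ∀ t ∈ I, ∀ v w : TangentSpace (𝓡 d) x, ‖v‖ ≤ 1 → ‖w‖ ≤ 1 →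
      P (t, ⟨x, v⟩, ⟨x, w⟩) := by
  rw [eventually_nhdsSet_iff_forall]
  intro x₀ hx₀
  -- pairs of vectors over different base points form an open set, on which there is nothing to show
  let B := {y : TangentBundle (𝓡 d) M | ‖y.2‖ ≤ 1}
  have hB : IsCompact B := isCompact_setOf_norm_le 1
  have hK : IsCompact (I ×ˢ B ×ˢ B) := hI.prod (hB.prod hB)
  have key : ∀ᶠ x in 𝓝 x₀, ∀ k ∈ I ×ˢ B ×ˢ B, k.2.1.proj = x → k.2.2.proj = x → P k := by
    refine hK.eventually_forall_of_forall_eventually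
      (P := fun x k => k.2.1.proj = x → k.2.2.proj = x → P k) ?_
    rintro ⟨t, y, z⟩ ⟨ht, hy, hz⟩
    have hc1 : Continuous fun q : M × ℝ × TangentBundle (𝓡 d) M × TangentBundle (𝓡 d) M =>
      (q.2.2.1.proj, q.1) :=
      (continuous_tangentBundle_proj.comp (by fun_prop)).prodMk continuous_fst
    have hc2 : Continuous fun q : M × ℝ × TangentBundle (𝓡 d) M × TangentBundle (𝓡 d) M =>
      (q.2.2.2.proj, q.1) :=
      (continuous_tangentBundle_proj.comp (by fun_prop)).prodMk continuous_fst
    by_cases h1 : y.proj = x₀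
    · by_cases h2 : z.proj = x₀
      · obtain ⟨y, v⟩ := y
        obtain ⟨z, w⟩ := z
        simp only at h1 h2
        subst h1
        subst h2
        have := hP t ht z hx₀ v w hy hz
        have hsnd := (continuous_snd (X := M)
          (Y := ℝ × TangentBundle (𝓡 d) M × TangentBundle (𝓡 d) M)).tendsto
          (z, (t, ⟨z, v⟩, ⟨z, w⟩))
        filter_upwards [hsnd.eventually this] with q hq _ _
        exact hq
      · have : ∀ᶠ p in 𝓝 (z.proj, x₀), p.1 ≠ p.2 := by
          have : IsOpen {p : M × M | p.1 ≠ p.2} := isOpen_ne_fun continuous_fst continuous_snd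
          exact this.mem_nhds h2
        filter_upwards [(hc2.tendsto (x₀, t, y, z)).eventually this] with q hq _ hq2
        exact absurd hq2 hq
    · have : ∀ᶠ p in 𝓝 (y.proj, x₀), p.1 ≠ p.2 := by
        have : IsOpen {p : M × M | p.1 ≠ p.2} := isOpen_ne_fun continuous_fst continuous_snd
        exact this.mem_nhds h1
      filter_upwards [(hc1.tendsto (x₀, t, y, z)).eventually this] with q hq hq2
      exact absurd hq2 hq
  filter_upwards [key] with x hx t ht v w hv hw
  exact hx (t, ⟨x, v⟩, ⟨x, w⟩) ⟨ht, hv, hw⟩ rfl rfl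

end Norm

/-! ### Splittings, projections and frames -/

theorem IsContinuousSubbundle.finrank_eq {S : Set M} {k : ℕ} (h : IsContinuousSubbundle S E k)
    {x : M} (hx : x ∈ S) : Module.finrank ℝ (E x) = k := by
  obtain ⟨u, hu, s, -, hs⟩ := h x hx
  obtain ⟨h1, h2⟩ := hs x (mem_of_mem_nhdsWithin hx hu)
  rw [← h2, finrank_span_eq_card h1, Fintype.card_fin]

theorem IsContinuousSubbundle.mono {S S' : Set M} {k : ℕ} (h : IsContinuousSubbundle S E k)
    (hS : S' ⊆ S) : IsContinuousSubbundle S' E k := fun x hx => by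
  obtain ⟨u, hu, s, hs⟩ := h x (hS hx)
  exact ⟨u, nhdsWithin_mono x hS hu, s, hs⟩

/-- Continuous local frames of a splitting yield a continuous projection: if `B x` is the frame as a
map to the model space, the projection is `B x ∘ D ∘ (B x)⁻¹` with a constant matrix `D`. -/
theorem IsContinuousSplitting.continuousWithinAt_projTM {S : Set M} {k l : ℕ}
    (h : IsContinuousSplitting S E F k l) {y₀ : TangentBundle (𝓡 d) M} (hy₀ : y₀.1 ∈ S) :
    ContinuousWithinAt (projTM E F) (TotalSpace.proj ⁻¹' S) y₀ := by
  obtain ⟨x₀, v₀⟩ := y₀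
  obtain ⟨u, hu, s, hs, hsu⟩ := h.left x₀ hy₀
  obtain ⟨u', hu', c, hc, hcu⟩ := h.right x₀ hy₀
  let e := trivializationAt (EuclideanSpace ℝ (Fin d)) (TangentSpace (𝓡 d) (M := M)) x₀
  have hmem : x₀ ∈ e.baseSet := FiberBundle.mem_baseSet_trivializationAt' x₀
  have hx₀u : x₀ ∈ u := mem_of_mem_nhdsWithin hy₀ hu
  have hx₀u' : x₀ ∈ u' := mem_of_mem_nhdsWithin hy₀ hu'
  let b : ∀ x : M, Fin k ⊕ Fin l → TangentSpace (𝓡 d) x := fun x =>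
    Sum.elim (fun i => s i x) (fun j => c j x)
  let B : M → ((Fin k ⊕ Fin l) → ℝ) →L[ℝ] EuclideanSpace ℝ (Fin d) := fun x =>
    ∑ i, (ContinuousLinearMap.proj (R := ℝ) (φ := fun _ : Fin k ⊕ Fin l => ℝ) i).smulRight
      (e.continuousLinearMapAt ℝ x (b x i))
  let D : ((Fin k ⊕ Fin l) → ℝ) →L[ℝ] ((Fin k ⊕ Fin l) → ℝ) := ContinuousLinearMap.pi
    (Sum.elim (fun i => ContinuousLinearMap.proj (Sum.inl i)) (fun _ => 0))
  have hB : ∀ x ξ, B x ξ = e.continuousLinearMapAt ℝ x (∑ i, ξ i • b x i) := fun x ξ => by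
    simp [B, map_sum]
  -- the coordinate expression of the projection in the frame
  have hcoord : ∀ x ∈ S, x ∈ u → x ∈ u' → ∀ v : TangentSpace (𝓡 d) x, ∃ ξ,
      e.continuousLinearMapAt ℝ x v = B x ξ ∧
      e.continuousLinearMapAt ℝ x (projAlong E F x v) = B x (D ξ) := by
    intro x hxS hxu hxu' v
    have hcompl := h.isCompl x hxS
    have h1 := projAlong_mem hcompl v
    have h2 := projAlong_mem hcompl.symm v
    rw [← (hsu x hxu).2, Submodule.mem_span_range_iff_exists_fun] at h1
    rw [← (hcu x hxu').2, Submodule.mem_span_range_iff_exists_fun] at h2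
    obtain ⟨a, ha⟩ := h1
    obtain ⟨a', ha'⟩ := h2
    refine ⟨Sum.elim a a', ?_, ?_⟩
    · rw [hB]
      congr 1
      rw [Fintype.sum_sum_type]
      simp only [b, Sum.elim_inl, Sum.elim_inr]
      rw [ha, ha', projAlong_add_projAlong hcompl]
    · rw [hB]
      congr 1
      rw [Fintype.sum_sum_type]
      simp [b, D, ha]
  have hsurj : Function.Surjective (B x₀) := fun w => by
    obtain ⟨ξ, h1, -⟩ := hcoord x₀ hy₀ hx₀u hx₀u' (e.symmL ℝ x₀ w)
    exact ⟨ξ, by rw [← h1, e.continuousLinearMapAt_symmL hmem]⟩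
  have hinj : Function.Injective (B x₀) := by
    rw [injective_iff_map_eq_zero]
    intro ξ hξ
    have hli : LinearIndependent ℝ (b x₀) := by
      refine (hsu x₀ hx₀u).1.sum_type (hcu x₀ hx₀u').1 ?_
      rw [(hsu x₀ hx₀u).2, (hcu x₀ hx₀u').2]
      exact (h.isCompl x₀ hy₀).disjoint
    rw [hB] at hξ
    have h0 : ∑ i, ξ i • b x₀ i = 0 := by
      rw [← e.symmL_continuousLinearMapAt (R := ℝ) hmem (∑ i, ξ i • b x₀ i), hξ, map_zero]
    exact funext (Fintype.linearIndependent_iff.1 hli ξ h0)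
  let Be : ((Fin k ⊕ Fin l) → ℝ) ≃L[ℝ] EuclideanSpace ℝ (Fin d) :=
    ContinuousLinearEquiv.ofBijective (B x₀) (LinearMap.ker_eq_bot.2 hinj)
      (LinearMap.range_eq_top.2 hsurj)
  have hBe : (Be : ((Fin k ⊕ Fin l) → ℝ) →L[ℝ] EuclideanSpace ℝ (Fin d)) = B x₀ := by
    ext1 ξ; rfl
  have hsec : ∀ σ : ∀ x : M, TangentSpace (𝓡 d) x, ∀ u₁ ∈ 𝓝[S] x₀,
      ContinuousOn (fun x => (⟨x, σ x⟩ : TangentBundle (𝓡 d) M)) u₁ →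
      ContinuousWithinAt (fun x => e.continuousLinearMapAt ℝ x (σ x)) S x₀ := by
    intro σ u₁ hu₁ hσ
    have h1 : ContinuousWithinAt (fun x => (⟨x, σ x⟩ : TangentBundle (𝓡 d) M)) S x₀ :=
      (hσ x₀ (mem_of_mem_nhdsWithin hy₀ hu₁)).mono_of_mem_nhdsWithin hu₁
    have h2 := ((FiberBundle.continuousWithinAt_totalSpace _ _).1 h1).2
    refine h2.congr_of_eventuallyEq ?_ (continuousLinearMapAt_eq_snd hmem _)
    filter_upwards [nhdsWithin_le_nhds (e.open_baseSet.mem_nhds hmem)] with x hx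
    exact continuousLinearMapAt_eq_snd hx _
  have hBc : ContinuousWithinAt B S x₀ := by
    refine tendsto_finsetSum _ fun i _ => ?_
    have : ContinuousWithinAt (fun x => e.continuousLinearMapAt ℝ x (b x i)) S x₀ := by
      rcases i with i | j
      · exact hsec (s i) u hu (hs i)
      · exact hsec (c j) u' hu' (hc j)
    exact ((ContinuousLinearMap.smulRightL ℝ ((Fin k ⊕ Fin l) → ℝ) (EuclideanSpace ℝ (Fin d))
      (ContinuousLinearMap.proj i)).continuous.continuousAt.comp_continuousWithinAt this)
  have hinv : ContinuousWithinAt (fun x => (B x).inverse) S x₀ := by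
    have := (contDiffAt_map_inverse (n := 0) (𝕜 := ℝ) Be).continuousAt
    rw [hBe] at this
    exact this.comp_continuousWithinAt hBc
  have hev : ∀ᶠ x in 𝓝[S] x₀, B x ∈ range ((↑) : (((Fin k ⊕ Fin l) → ℝ) ≃L[ℝ]
      EuclideanSpace ℝ (Fin d)) → ((Fin k ⊕ Fin l) → ℝ) →L[ℝ] EuclideanSpace ℝ (Fin d)) := by
    have := Be.nhds
    rw [hBe] at this
    exact hBc.eventually this
  have hpt : Tendsto (TotalSpace.proj : TangentBundle (𝓡 d) M → M)
      (𝓝[TotalSpace.proj ⁻¹' S] (⟨x₀, v₀⟩ : TangentBundle (𝓡 d) M)) (𝓝[S] x₀) :=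
    tendsto_nhdsWithin_iff.2 ⟨continuous_tangentBundle_proj.continuousAt.mono_left
      nhdsWithin_le_nhds, eventually_mem_nhdsWithin⟩
  rw [FiberBundle.continuousWithinAt_totalSpace]
  refine ⟨continuous_tangentBundle_proj.continuousWithinAt, ?_⟩
  have hmain : ContinuousWithinAt (fun y : TangentBundle (𝓡 d) M =>
      B y.1 (D ((B y.1).inverse (e y).2))) (TotalSpace.proj ⁻¹' S) ⟨x₀, v₀⟩ := by
    have h1 : ContinuousWithinAt (fun y : TangentBundle (𝓡 d) M => (e y).2)
        (TotalSpace.proj ⁻¹' S) ⟨x₀, v₀⟩ :=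
      (continuousAt_trivializationAt_snd hmem).continuousWithinAt
    have h2 : ContinuousWithinAt (fun y : TangentBundle (𝓡 d) M => B y.1)
      (TotalSpace.proj ⁻¹' S) ⟨x₀, v₀⟩ := ContinuousWithinAt.tendsto hBc |>.comp hpt
    have h3 : ContinuousWithinAt (fun y : TangentBundle (𝓡 d) M => (B y.1).inverse)
      (TotalSpace.proj ⁻¹' S) ⟨x₀, v₀⟩ := ContinuousWithinAt.tendsto hinv |>.comp hpt
    exact h2.clm_apply (D.continuous.continuousAt.comp_continuousWithinAt (h3.clm_apply h1))
  refine hmain.congr_of_eventuallyEq_of_mem ?_ hy₀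
  filter_upwards [hpt.eventually hev, hpt.eventually hu, hpt.eventually hu',
    hpt.eventually eventually_mem_nhdsWithin,
    hpt.eventually (nhdsWithin_le_nhds (e.open_baseSet.mem_nhds hmem))] with y hy hyu hyu' hyS hye
  obtain ⟨ξ, h1, h2⟩ := hcoord y.1 hyS hyu hyu' y.2
  obtain ⟨T, hT⟩ := hy
  have h3 : (e y).2 = B y.1 ξ := by rw [← h1]; exact (continuousLinearMapAt_eq_snd hye _).symm
  have h4 : (e (projTM E F y)).2 = B y.1 (D ξ) := by
    rw [← h2]; exact (continuousLinearMapAt_eq_snd hye _).symm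
  have h5 : (B y.1).inverse (B y.1 ξ) = ξ := by
    rw [← hT, ContinuousLinearMap.inverse_equiv]; simp
  change (e (projTM E F y)).2 = _
  rw [h4, h3, h5]

/-- The range of a continuous field of linear maps contains, near `x₀`, a continuous frame of as
many vectors as the rank at `x₀`, provided the map at `x₀` is idempotent: the images of a basis of
that range, extended as constant sections in a trivialization. -/
theorem exists_frame_of_continuousAt
    {p : ∀ x : M, TangentSpace (𝓡 d) x →ₗ[ℝ] TangentSpace (𝓡 d) x} {x₀ : M} {W : Set M}
    (hW : W ∈ 𝓝 x₀)
    (hp : ∀ y : TangentBundle (𝓡 d) M, y.1 ∈ W →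
      ContinuousAt (fun y : TangentBundle (𝓡 d) M => (⟨y.1, p y.1 y.2⟩ : TangentBundle (𝓡 d) M)) y)
    (hid : ∀ v, p x₀ (p x₀ v) = p x₀ v) {k : ℕ}
    (hk : Module.finrank ℝ (LinearMap.range (p x₀)) = k) :
    ∃ u ∈ 𝓝 x₀, ∃ s : Fin k → ∀ x : M, TangentSpace (𝓡 d) x,
      (∀ i, ContinuousOn (fun x => (⟨x, s i x⟩ : TangentBundle (𝓡 d) M)) u) ∧
      ∀ x ∈ u, LinearIndependent ℝ (fun i => s i x) ∧ ∀ i, s i x ∈ LinearMap.range (p x) := by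
  let e := trivializationAt (EuclideanSpace ℝ (Fin d)) (TangentSpace (𝓡 d) (M := M)) x₀
  have hmem : x₀ ∈ e.baseSet := FiberBundle.mem_baseSet_trivializationAt' x₀
  let b := Module.finBasisOfFinrankEq ℝ (LinearMap.range (p x₀)) hk
  let w : Fin k → EuclideanSpace ℝ (Fin d) := fun i =>
    e.continuousLinearMapAt ℝ x₀ (b i : TangentSpace (𝓡 d) x₀)
  let s : Fin k → ∀ x : M, TangentSpace (𝓡 d) x := fun i x => p x (e.symmL ℝ x (w i))
  have hs0 : ∀ i, s i x₀ = b i := fun i => by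
    simp only [s, w]
    rw [e.symmL_continuousLinearMapAt hmem]
    obtain ⟨v, hv⟩ := (b i).2
    rw [← hv, hid]
  have hcont : ∀ i, ∀ x ∈ e.baseSet ∩ W,
      ContinuousAt (fun x => (⟨x, s i x⟩ : TangentBundle (𝓡 d) M)) x := by
    intro i x hx
    have h1 : ContinuousAt (fun x => (⟨x, e.symmL ℝ x (w i)⟩ : TangentBundle (𝓡 d) M)) x := by
      have h := (continuousOn_trivializationAt_symmL x₀).continuousAt
        (x := (x, w i)) (prod_mem_nhds (e.open_baseSet.mem_nhds hx.1) univ_mem)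
      exact ContinuousAt.comp (x := x) (f := fun x : M => (x, w i)) h
        (continuousAt_id.prodMk continuousAt_const)
    exact ContinuousAt.comp (x := x)
      (f := fun x => (⟨x, e.symmL ℝ x (w i)⟩ : TangentBundle (𝓡 d) M)) (hp _ hx.2) h1
  have hW' : e.baseSet ∩ W ∈ 𝓝 x₀ := inter_mem (e.open_baseSet.mem_nhds hmem) hW
  have hli0 : LinearIndependent ℝ (fun i => e.continuousLinearMapAt ℝ x₀ (s i x₀)) := by
    have h1 : LinearIndependent ℝ (fun i => (b i : TangentSpace (𝓡 d) x₀)) :=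
      b.linearIndependent.map' (Submodule.subtype _) (Submodule.ker_subtype _)
    have h2 := h1.map' (e.continuousLinearMapAt ℝ x₀).toLinearMap (by
      rw [LinearMap.ker_eq_bot]
      intro v v' hvv
      have := congrArg (e.symmL ℝ x₀) hvv
      simpa only [ContinuousLinearMap.coe_coe, e.symmL_continuousLinearMapAt hmem] using this)
    simp only [hs0]
    exact h2
  have hli : ∀ᶠ x in 𝓝 x₀, LinearIndependent ℝ (fun i => e.continuousLinearMapAt ℝ x (s i x)) := by
    have hc : ContinuousAt (fun x i => e.continuousLinearMapAt ℝ x (s i x)) x₀ := by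
      refine continuousAt_pi.2 fun i => ?_
      have h2 := ((FiberBundle.continuousAt_totalSpace _ _).1
        (hcont i x₀ (mem_of_mem_nhds hW'))).2
      refine h2.congr ?_
      filter_upwards [e.open_baseSet.mem_nhds hmem] with x hx
      exact (continuousLinearMapAt_eq_snd hx _).symm
    exact hc.eventually hli0.eventually
  refine ⟨{x | LinearIndependent ℝ (fun i => e.continuousLinearMapAt ℝ x (s i x))} ∩
    (e.baseSet ∩ W), inter_mem hli hW', s, fun i x hx => (hcont i x hx.2).continuousWithinAt,
    fun x hx => ⟨?_, fun i => ⟨_, rfl⟩⟩⟩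
  exact LinearIndependent.of_comp (e.continuousLinearMapAt ℝ x).toLinearMap hx.1

theorem isContinuousSubbundle_range
    {p : ∀ x : M, TangentSpace (𝓡 d) x →ₗ[ℝ] TangentSpace (𝓡 d) x} {V : Set M} (hV : IsOpen V)
    (hp : ∀ y : TangentBundle (𝓡 d) M, y.1 ∈ V →
      ContinuousAt (fun y : TangentBundle (𝓡 d) M => (⟨y.1, p y.1 y.2⟩ : TangentBundle (𝓡 d) M)) y)
    (hid : ∀ x ∈ V, ∀ v, p x (p x v) = p x v) {k : ℕ}
    (hk : ∀ x ∈ V, Module.finrank ℝ (LinearMap.range (p x)) = k) :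
    IsContinuousSubbundle V (fun x => LinearMap.range (p x)) k := by
  intro x₀ hx₀
  obtain ⟨u, hu, s, hs, hsu⟩ := exists_frame_of_continuousAt (hV.mem_nhds hx₀) hp (hid x₀ hx₀)
    (hk x₀ hx₀)
  refine ⟨u ∩ V, mem_nhdsWithin_of_mem_nhds (inter_mem hu (hV.mem_nhds hx₀)), s,
    fun i => (hs i).mono inter_subset_left, fun x hx => ⟨(hsu x hx.1).1, ?_⟩⟩
  refine Submodule.eq_of_le_of_finrank_eq ?_ ?_
  · rw [Submodule.span_le]
    rintro _ ⟨i, rfl⟩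
    exact (hsu x hx.1).2 i
  · rw [finrank_span_eq_card (hsu x hx.1).1, Fintype.card_fin, hk x hx.2]

end BundleTopology

/-! ### Forward invariant neighbourhoods of an attracting set -/

section Trapping

variable {M : Type*} [TopologicalSpace M]

/-- If `N` is a compact neighbourhood of `Λ` such that only the points of `Λ` have their whole
backward orbit in `N`, then points near `Λ` never leave `N` in the future. By compactness a point
whose backward orbit stays in `N` up to some time `T` is interior to `N`, so that an orbit which has
spent the time `T` in `N` cannot reach the frontier of `N`. -/
theorem exists_isOpen_forall_mem_of_backward {X : ℝ → M → M}
    (hc : Continuous (fun p : ℝ × M => X p.1 p.2)) (h0 : ∀ x, X 0 x = x)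
    (hadd : ∀ s t x, X (s + t) x = X s (X t x)) {Λ N : Set M}
    (hinv : IsInvariantSet X Λ) (hN : IsCompact N) (hNc : IsClosed N) (hΛN : Λ ⊆ interior N)
    (hback : ∀ y, (∀ t ≥ 0, X (-t) y ∈ N) → y ∈ Λ) :
    ∃ O : Set M, IsOpen O ∧ Λ ⊆ O ∧ ∀ x ∈ O, ∀ t ≥ 0, X t x ∈ N := by
  have hct : ∀ t, Continuous (X t) := fun t => hc.comp (by fun_prop : Continuous fun x => (t, x))
  have hcx : ∀ x, Continuous fun t => X t x := fun x =>
    hc.comp (by fun_prop : Continuous fun t : ℝ => (t, x))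
  -- the points whose backward orbit stays in `N` up to the time `n`
  let A : ℕ → Set M := fun n => ⋂ t ∈ Icc (0 : ℝ) n, (X (-t)) ⁻¹' N
  have hAc : ∀ n, IsClosed (A n) := fun n =>
    isClosed_biInter fun t _ => hNc.preimage (hct _)
  have hAN : ∀ n, A n ⊆ N := fun n y hy => by
    have := mem_iInter₂.1 hy 0 ⟨le_rfl, Nat.cast_nonneg n⟩
    simpa [h0] using this
  obtain ⟨n, hn⟩ : ∃ n, A n ⊆ interior N := by
    have hanti : Antitone A := fun m n hmn =>
      biInter_subset_biInter_left (Icc_subset_Icc_right (by exact_mod_cast hmn))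
    refine exists_subset_nhds_of_isCompact' (V := A) hanti.directed_ge
      (fun n => hN.of_isClosed_subset (hAc n) (hAN n)) hAc fun y hy => ?_
    refine isOpen_interior.mem_nhds (hΛN (hback y fun t ht => ?_))
    obtain ⟨m, hm⟩ := exists_nat_ge t
    exact mem_iInter₂.1 (mem_iInter.1 hy m) t ⟨ht, hm⟩
  have hO : ∀ᶠ x in 𝓝ˢ Λ, ∀ t ∈ Icc (0 : ℝ) n, X t x ∈ interior N := by
    rw [eventually_nhdsSet_iff_forall]
    intro x hx
    refine isCompact_Icc.eventually_forall_of_forall_eventually fun t _ => ?_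
    have : X t x ∈ Λ := by rw [← hinv t]; exact mem_image_of_mem _ hx
    exact ((hc.comp continuous_swap).tendsto (x, t)).eventually
      (isOpen_interior.mem_nhds (hΛN this))
  obtain ⟨O, ⟨hOo, hΛO⟩, hO⟩ := (hasBasis_nhdsSet Λ).mem_iff.1 hO
  refine ⟨O, hOo, hΛO, fun x hx t ht => ?_⟩
  -- continuous induction on the times up to which the orbit has stayed in `N`
  let s : Set ℝ := {t | ∀ r ∈ Icc 0 t, X r x ∈ N}
  have hsn : (n : ℝ) ∈ s := fun r hr => interior_subset (hO hx r hr)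
  have hs : ∀ b, IsClosed (s ∩ Icc (n : ℝ) b) := by
    intro b
    have : s ∩ Icc (n : ℝ) b = (⋂ r ∈ {r : ℝ | 0 ≤ r ∧ X r x ∉ N}, Iic r) ∩ Icc (n : ℝ) b := by
      ext t
      simp only [mem_inter_iff, mem_iInter, mem_Iic, and_congr_left_iff]
      intro _
      constructor
      · rintro h r ⟨hr0, hr⟩
        by_contra! hlt
        exact hr (h r ⟨hr0, hlt.le⟩)
      · intro h r hr
        have hsub : ∀ q ∈ Ico 0 t, X q x ∈ N := fun q hq => by
          by_contra hq'
          exact absurd (h q ⟨hq.1, hq'⟩) (not_le.2 hq.2)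
        rcases hr.2.lt_or_eq with hlt | rfl
        · exact hsub r ⟨hr.1, hlt⟩
        · rcases hr.1.eq_or_lt with h00 | hpos
          · rw [← h00]; exact interior_subset (hO hx 0 ⟨le_rfl, Nat.cast_nonneg n⟩)
          · have hcl : r ∈ closure (Ico 0 r) := by rw [closure_Ico hpos.ne]; exact hr
            exact hNc.closure_subset (map_mem_closure (f := fun t => X t x) (hcx x) hcl hsub)
    rw [this]
    exact (isClosed_biInter fun r _ => isClosed_Iic).inter isClosed_Icc
  have hall : ∀ b, Icc (n : ℝ) b ⊆ s := by
    intro b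
    refine IsClosed.Icc_subset_of_forall_mem_nhdsWithin (hs b) hsn ?_
    rintro t ⟨hts, htn, -⟩
    have hAt : X t x ∈ A n := by
      refine mem_iInter₂.2 fun r hr => ?_
      have : X (-r) (X t x) = X (t - r) x := by rw [← hadd]; congr 1; ring
      rw [mem_preimage, this]
      exact hts _ ⟨by linarith [hr.2], by linarith [hr.1]⟩
    have hev : ∀ᶠ r in 𝓝 t, X r x ∈ interior N :=
      ((hcx x).tendsto t).eventually (isOpen_interior.mem_nhds (hn hAt))
    obtain ⟨ε, hε, hball⟩ := Metric.eventually_nhds_iff.1 hev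
    have : Ioo t (t + ε) ∈ 𝓝[>] t := Ioo_mem_nhdsGT (by linarith)
    filter_upwards [this] with q hq r hr
    rcases le_total r t with h | h
    · exact hts r ⟨hr.1, h⟩
    · refine interior_subset (hball ?_)
      rw [Real.dist_eq, abs_of_nonneg (by linarith)]
      linarith [hr.2, hq.2]
  exact hall (max n t) ⟨le_max_left _ _, le_rfl⟩ t ⟨ht, le_max_right _ _⟩

/-- An attracting set has arbitrarily small open forward invariant neighbourhoods, and the images
of such a neighbourhood shrink to the set. -/
theorem IsAttractingSet.exists_forward_invariant [T2Space M] [LocallyCompactSpace M]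
    {X : ℝ → M → M} (hc : Continuous (fun p : ℝ × M => X p.1 p.2)) (h0 : ∀ x, X 0 x = x)
    (hadd : ∀ s t x, X (s + t) x = X s (X t x)) {Λ : Set M} (hΛ : IsAttractingSet X Λ)
    {V : Set M} (hV : V ∈ 𝓝ˢ Λ) :
    ∃ U₀ : Set M, IsOpen U₀ ∧ Λ ⊆ U₀ ∧ U₀ ⊆ V ∧ (∀ t ≥ 0, X t '' U₀ ⊆ U₀) ∧
      (⋂ t ∈ Ici (0 : ℝ), X t '' U₀) = Λ := by
  obtain ⟨hcpt, hinv, U, hUo, hΛU, hUΛ, hUf⟩ := hΛ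
  have hct : ∀ t, Continuous (X t) := fun t => hc.comp (by fun_prop : Continuous fun x => (t, x))
  have hleft : ∀ t x, X (-t) (X t x) = x := fun t x => by rw [← hadd, neg_add_cancel, h0]
  have hright : ∀ t x, X t (X (-t) x) = x := fun t x => by rw [← hadd, add_neg_cancel, h0]
  have hUf' : ∀ t ≥ 0, ∀ x ∈ U, X t x ∈ U := fun t ht x hx => by
    rcases ht.eq_or_lt with h | h
    · rw [← h, h0]; exact hx
    · exact hUf t h (mem_image_of_mem _ hx)
  have hUback : ∀ y, (∀ t ≥ 0, X (-t) y ∈ U) → y ∈ Λ := fun y hy => by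
    rw [hUΛ]
    refine mem_iInter.2 fun t => ⟨X (-t) y, ?_, hright t y⟩
    rcases le_total 0 t with h | h
    · exact hy t h
    · exact hUf' (-t) (by linarith) y (by simpa [h0] using hy 0 le_rfl)
  obtain ⟨V', hV'o, hΛV', hV'V⟩ := mem_nhdsSet_iff_exists.1 hV
  obtain ⟨N, hN, hΛN, hNsub⟩ := exists_compact_between hcpt (hV'o.inter hUo)
    (subset_inter hΛV' hΛU)
  obtain ⟨O, hOo, hΛO, hO⟩ := exists_isOpen_forall_mem_of_backward hc h0 hadd hinv hN
    hN.isClosed hΛN (fun y hy => hUback y fun t ht => (hNsub (hy t ht)).2)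
  -- the forward saturation of `O`
  let U₀ : Set M := ⋃ t ∈ Ici (0 : ℝ), (X (-t)) ⁻¹' O
  have hmem : ∀ x, x ∈ U₀ ↔ ∃ t ≥ 0, X (-t) x ∈ O := fun x => by simp [U₀]
  have hU₀N : U₀ ⊆ N := fun x hx => by
    obtain ⟨t, ht, hxt⟩ := (hmem x).1 hx
    have := hO _ hxt t ht
    rwa [hright] at this
  have hΛU₀ : Λ ⊆ U₀ := fun x hx => (hmem x).2 ⟨0, le_rfl, by rw [neg_zero, h0]; exact hΛO hx⟩
  refine ⟨U₀, isOpen_biUnion fun t _ => hOo.preimage (hct _), hΛU₀,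
    fun x hx => hV'V (hNsub (hU₀N hx)).1, ?_, ?_⟩
  · rintro t ht _ ⟨x, hx, rfl⟩
    obtain ⟨s, hs, hxs⟩ := (hmem x).1 hx
    refine (hmem _).2 ⟨s + t, by positivity, ?_⟩
    rw [← hadd]
    simpa using hxs
  · refine Subset.antisymm (fun x hx => hUback x fun t ht => ?_)
      (subset_iInter₂ fun t _ => ?_)
    · obtain ⟨z, hz, rfl⟩ := mem_iInter₂.1 hx t ht
      rw [hleft]
      exact (hNsub (hU₀N hz)).2
    · conv_lhs => rw [← hinv t]
      exact image_mono hΛU₀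

end Trapping

/-! ### Dominated linear maps -/

section DominatedStep

variable {V W : Type*} [NormedAddCommGroup V] [NormedSpace ℝ V] [NormedAddCommGroup W]
  [NormedSpace ℝ W]

/-- Block estimates for a linear map `D : V → W` between spaces with splittings, given by their
projections `Ps`, `Pc` and `Qs`, `Qc`: the `s`-block of `D` is contracting and dominated by the
`c`-block, and the off-diagonal blocks are small compared with the cone width `a`. -/
structure DominatedStep (D : V →ₗ[ℝ] W) (Ps Pc : V →ₗ[ℝ] V) (Qs Qc : W →ₗ[ℝ] W) (a : ℝ) :
    Prop where
  dom : ∀ v w, ‖Qs (D (Ps v))‖ * ‖Pc w‖ ≤ 1 / 100 * ‖Qc (D (Pc w))‖ * ‖Ps v‖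
  cs : ∀ w, ‖Qs (D (Pc w))‖ ≤ a / 100 * ‖Qc (D (Pc w))‖
  sc : ∀ v w, ‖Qc (D (Ps v))‖ * ‖Pc w‖ ≤ a / 100 * ‖Qc (D (Pc w))‖ * ‖Ps v‖
  contr : ∀ v, ‖Qs (D (Ps v))‖ ≤ 1 / 100 * ‖Ps v‖
  cs' : ∀ w, ‖Qs (D (Pc w))‖ ≤ 1 / 100 * ‖Pc w‖
  pos : ∀ w, Pc w ≠ 0 → 0 < ‖Qc (D (Pc w))‖

variable {D : V →ₗ[ℝ] W} {Ps Pc : V →ₗ[ℝ] V} {Qs Qc : W →ₗ[ℝ] W} {a b : ℝ}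

theorem norm_proj_bounds (hP : ∀ v, Ps v + Pc v = v) (Q : W →ₗ[ℝ] W) (v : V) :
    ‖Q (D v)‖ ≤ ‖Q (D (Ps v))‖ + ‖Q (D (Pc v))‖ ∧
      ‖Q (D (Pc v))‖ - ‖Q (D (Ps v))‖ ≤ ‖Q (D v)‖ := by
  have h : Q (D v) = Q (D (Ps v)) + Q (D (Pc v)) := by rw [← map_add, ← map_add, hP]
  refine ⟨h ▸ norm_add_le _ _, ?_⟩
  have h2 : Q (D (Pc v)) = Q (D v) - Q (D (Ps v)) := by rw [h]; abel
  have := norm_sub_le (Q (D v)) (Q (D (Ps v)))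
  rw [← h2] at this
  linarith

/-- Backward invariance of the stable cones of width `b ∈ [a, 1]`. -/
theorem DominatedStep.stable_invariant (h : DominatedStep D Ps Pc Qs Qc a)
    (hP : ∀ v, Ps v + Pc v = v) (ha : 0 < a) (hab : a ≤ b) (hb : b ≤ 1) {u : V}
    (hu : ‖Qc (D u)‖ ≤ b * ‖Qs (D u)‖) : ‖Pc u‖ ≤ b * ‖Ps u‖ := by
  by_contra! hlt
  have hp := norm_nonneg (Ps u)
  have hb0 : 0 < b := ha.trans_le hab
  have hq : 0 < ‖Pc u‖ := (mul_nonneg hb0.le hp).trans_lt hlt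
  have hD := h.pos u (norm_pos_iff.1 hq)
  have h1 := (norm_proj_bounds (D := D) hP Qs u).1
  have h2 := (norm_proj_bounds (D := D) hP Qc u).2
  have h3 := h.dom u u
  have h4 := h.cs u
  have h5 := h.sc u u
  set p := ‖Ps u‖
  set q := ‖Pc u‖
  set X := ‖Qc (D (Pc u))‖
  have h6 : X - ‖Qc (D (Ps u))‖ ≤ b * (‖Qs (D (Ps u))‖ + ‖Qs (D (Pc u))‖) :=
    h2.trans (hu.trans (mul_le_mul_of_nonneg_left h1 hb0.le))
  have h7 : X * q ≤ a / 100 * X * p + b * (1 / 100 * X * p) + b * (a / 100 * X) * q := by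
    have e1 := mul_le_mul_of_nonneg_right h6 hq.le
    have e2 := mul_le_mul_of_nonneg_left h3 hb0.le
    have e3 := mul_le_mul_of_nonneg_right (mul_le_mul_of_nonneg_left h4 hb0.le) hq.le
    linarith
  have h8 : q ≤ a / 100 * p + b / 100 * p + b * a / 100 * q := by
    refine le_of_mul_le_mul_left ?_ hD
    linarith
  have h9 : b * a ≤ 1 := by nlinarith
  have h10 : a * p ≤ b * p := mul_le_mul_of_nonneg_right hab hp
  have h11 : b * a * q ≤ 1 * q := mul_le_mul_of_nonneg_right h9 hq.le
  nlinarith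

/-- Forward invariance of the center-unstable cones of width `b ∈ [a, 1]`; on such a cone the
`c`-component of the image is almost that of the `c`-block. -/
theorem DominatedStep.cu_bounds (h : DominatedStep D Ps Pc Qs Qc a)
    (hP : ∀ v, Ps v + Pc v = v) (ha : 0 < a) (hab : a ≤ b) (hb : b ≤ 1) {u : V}
    (hu : ‖Ps u‖ ≤ b * ‖Pc u‖) :
    ‖Qs (D u)‖ ≤ b * ‖Qc (D u)‖ ∧ 99 / 100 * ‖Qc (D (Pc u))‖ ≤ ‖Qc (D u)‖ := by
  have hb0 : 0 < b := ha.trans_le hab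
  rcases eq_or_ne (Pc u) 0 with h0 | h0
  · have h1 : Ps u = 0 := by
      rw [h0, norm_zero, mul_zero] at hu
      exact norm_le_zero_iff.1 hu
    have : u = 0 := by rw [← hP u, h0, h1, add_zero]
    subst this
    simp
  have hq : 0 < ‖Pc u‖ := norm_pos_iff.2 h0
  have hD := h.pos u h0
  have h1 := (norm_proj_bounds (D := D) hP Qs u).1
  have h2 := (norm_proj_bounds (D := D) hP Qc u).2
  have h3 := h.dom u u
  have h4 := h.cs u
  have h5 := h.sc u u
  set q := ‖Pc u‖
  set X := ‖Qc (D (Pc u))‖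
  have h6 : ‖Qs (D (Ps u))‖ ≤ b * X / 100 := by
    refine le_of_mul_le_mul_right (h3.trans ?_) hq
    have := mul_le_mul_of_nonneg_left hu (by positivity : 0 ≤ 1 / 100 * X)
    linarith
  have h7 : ‖Qc (D (Ps u))‖ ≤ X / 100 := by
    refine le_of_mul_le_mul_right (h5.trans ?_) hq
    have e1 := mul_le_mul_of_nonneg_left hu (by positivity : 0 ≤ a / 100 * X)
    have e2 : a * b ≤ 1 := by nlinarith
    have e3 := mul_le_mul_of_nonneg_right e2 (by positivity : 0 ≤ X * q / 100)
    linarith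
  have h8 : a * X ≤ b * X := mul_le_mul_of_nonneg_right hab hD.le
  refine ⟨?_, by linarith⟩
  have h9 : 99 / 100 * X ≤ ‖Qc (D u)‖ := by linarith
  have h10 := mul_le_mul_of_nonneg_left h9 hb0.le
  have h11 : 0 ≤ b * X := by positivity
  linarith

/-- A vector whose image lies in the stable cone is contracted. -/
theorem DominatedStep.contraction (h : DominatedStep D Ps Pc Qs Qc a)
    (hP : ∀ v, Ps v + Pc v = v) (hQ : ∀ v, Qs v + Qc v = v) (ha : 0 < a) (ha4 : a ≤ 1 / 4)
    {u : V} (hu : ‖Qc (D u)‖ ≤ a * ‖Qs (D u)‖) : ‖D u‖ ≤ 1 / 2 * ‖u‖ := by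
  have hc := h.stable_invariant hP ha le_rfl (by linarith) hu
  have h1 : ‖D u‖ ≤ ‖Qs (D u)‖ + ‖Qc (D u)‖ := by
    conv_lhs => rw [← hQ (D u)]
    exact norm_add_le _ _
  have h2 := (norm_proj_bounds (D := D) hP Qs u).1
  have h3 := h.contr u
  have h4 := h.cs' u
  have h5 : ‖Ps u‖ - ‖Pc u‖ ≤ ‖u‖ := by
    conv_rhs => rw [← hP u]
    have := norm_sub_le (Ps u + Pc u) (Pc u)
    rw [add_sub_cancel_right] at this
    linarith
  have h6 := mul_le_mul_of_nonneg_right ha4 (norm_nonneg (Ps u))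
  have h7 := mul_le_mul_of_nonneg_right ha4 (norm_nonneg (Qs (D u)))
  have h8 := norm_nonneg (Ps u)
  linarith

/-- A vector whose image lies in the stable cone is dominated by the vectors of the center-unstable
cone. -/
theorem DominatedStep.domination (h : DominatedStep D Ps Pc Qs Qc a)
    (hP : ∀ v, Ps v + Pc v = v) (hQ : ∀ v, Qs v + Qc v = v) (ha : 0 < a) (ha4 : a ≤ 1 / 4)
    {u v : V} (hu : ‖Qc (D u)‖ ≤ a * ‖Qs (D u)‖) (hv : ‖Ps v‖ ≤ a * ‖Pc v‖) :
    ‖D u‖ * ‖v‖ ≤ 1 / 2 * (‖D v‖ * ‖u‖) := by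
  have hc := h.stable_invariant hP ha le_rfl (by linarith) hu
  obtain ⟨hv1, hv2⟩ := h.cu_bounds hP ha le_rfl (by linarith) hv
  have hDu : ‖D u‖ ≤ ‖Qs (D u)‖ + ‖Qc (D u)‖ := by
    conv_lhs => rw [← hQ (D u)]
    exact norm_add_le _ _
  have hvn : ‖v‖ ≤ ‖Ps v‖ + ‖Pc v‖ := by
    conv_lhs => rw [← hP v]
    exact norm_add_le _ _
  have hun : ‖Ps u‖ - ‖Pc u‖ ≤ ‖u‖ := by
    conv_rhs => rw [← hP u]
    have := norm_sub_le (Ps u + Pc u) (Pc u)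
    rw [add_sub_cancel_right] at this
    linarith
  have hDv : ‖Qc (D v)‖ - ‖Qs (D v)‖ ≤ ‖D v‖ := by
    conv_rhs => rw [← hQ (D v)]
    have := norm_sub_le (Qs (D v) + Qc (D v)) (Qs (D v))
    rw [add_sub_cancel_left] at this
    linarith
  have h1 := (norm_proj_bounds (D := D) hP Qs u).1
  have h2 := (norm_proj_bounds (D := D) hP Qc u).2
  have h3 := h.dom u v
  have h4 := h.cs u
  have h5 := h.sc u v
  set pu := ‖Ps u‖
  set qv := ‖Pc v‖
  set A := ‖Qs (D (Ps u))‖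
  set B := ‖Qs (D (Pc u))‖
  set C := ‖Qc (D (Ps u))‖
  set X := ‖Qc (D (Pc v))‖
  have hpu : 0 ≤ pu := norm_nonneg _
  have hqv : 0 ≤ qv := norm_nonneg _
  have hA : 0 ≤ A := norm_nonneg _
  have hB : 0 ≤ B := norm_nonneg _
  have hC : 0 ≤ C := norm_nonneg _
  have hX : 0 ≤ X := norm_nonneg _
  -- the block `B` is controlled since `D u` lies in the stable cone
  have hBb : B ≤ A + C := by
    have e1 : ‖Qc (D (Pc u))‖ ≤ C + (A + B) := by
      have := mul_le_mul_of_nonneg_right (ha4.trans (by norm_num : (1 : ℝ) / 4 ≤ 1))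
        (norm_nonneg (Qs (D u)))
      linarith
    have e2 : B ≤ 1 / 2 * (C + (A + B)) :=
      h4.trans (mul_le_mul (by linarith) e1 (norm_nonneg _) (by norm_num))
    linarith
  have h6 : ‖D u‖ ≤ 5 / 4 * (2 * A + C) := by
    have := mul_le_mul_of_nonneg_right ha4 (norm_nonneg (Qs (D u)))
    linarith
  have h7 : ‖v‖ ≤ 5 / 4 * qv := by
    have := mul_le_mul_of_nonneg_right ha4 hqv
    linarith
  have h8 : 3 / 4 * pu ≤ ‖u‖ := by
    have := mul_le_mul_of_nonneg_right ha4 hpu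
    linarith
  have h9 : 1 / 2 * X ≤ ‖D v‖ := by
    have := mul_le_mul_of_nonneg_right ha4 (norm_nonneg (Qc (D v)))
    linarith
  have h10 : C * qv ≤ 1 / 100 * X * pu := h5.trans (by
    have := mul_le_mul_of_nonneg_right (by linarith : a ≤ 1) (mul_nonneg hX hpu)
    linarith)
  calc ‖D u‖ * ‖v‖ ≤ 5 / 4 * (2 * A + C) * (5 / 4 * qv) :=
        mul_le_mul h6 h7 (norm_nonneg _) (by positivity)
    _ = 25 / 16 * (2 * (A * qv) + C * qv) := by ring
    _ ≤ 1 / 2 * (1 / 2 * X * (3 / 4 * pu)) := by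
        have := mul_nonneg hX hpu
        linarith
    _ ≤ 1 / 2 * (‖D v‖ * ‖u‖) := by
        have := mul_le_mul h9 h8 (by positivity) (norm_nonneg (D v))
        linarith

/-- Approximate block estimates on unit vectors imply `DominatedStep`. Here `m` is a lower bound of
the `c`-block and the error `m * a / 1000` is absorbed by it. -/
theorem DominatedStep.of_unit {m : ℝ} (hm : 0 < m) (hm1 : m ≤ 1) (ha : 0 < a) (ha4 : a ≤ 1 / 4)
    (hPs : ∀ v, Ps (Ps v) = Ps v) (hPc : ∀ v, Pc (Pc v) = Pc v)
    (h : ∀ v w : V, ‖v‖ ≤ 1 → ‖w‖ ≤ 1 →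
      ‖Qs (D (Ps v))‖ * ‖Pc w‖ < 1 / 150 * ‖Qc (D (Pc w))‖ * ‖Ps v‖ + m * a / 1000 ∧
      ‖Qs (D (Pc w))‖ < m * a / 1000 ∧ ‖Qc (D (Ps v))‖ < m * a / 1000 ∧
      ‖Qs (D (Ps v))‖ < 1 / 150 * ‖Ps v‖ + m * a / 1000 ∧
      m * ‖Pc w‖ < ‖Qc (D (Pc w))‖ + m * a / 1000) :
    DominatedStep D Ps Pc Qs Qc a := by
  set ε := m * a / 1000 with hε
  have hε0 : 0 < ε := by positivity
  -- homogeneous forms of the hypotheses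
  have key : ∀ v w : V,
      ‖Qs (D (Ps v))‖ * ‖Pc w‖ ≤
        1 / 150 * ‖Qc (D (Pc w))‖ * ‖Ps v‖ + ε * (‖Ps v‖ * ‖Pc w‖) ∧
      ‖Qs (D (Pc w))‖ ≤ ε * ‖Pc w‖ ∧ ‖Qc (D (Ps v))‖ ≤ ε * ‖Ps v‖ ∧
      ‖Qs (D (Ps v))‖ ≤ 1 / 150 * ‖Ps v‖ + ε * ‖Ps v‖ ∧
      m * ‖Pc w‖ ≤ ‖Qc (D (Pc w))‖ + ε * ‖Pc w‖ := by
    have hunit : ∀ z : V, ‖(‖z‖⁻¹ : ℝ) • z‖ ≤ 1 := fun z => by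
      rw [norm_smul, norm_inv, norm_norm]
      exact inv_mul_le_one
    have e1 : ∀ v, Ps ((‖Ps v‖⁻¹ : ℝ) • Ps v) = (‖Ps v‖⁻¹ : ℝ) • Ps v := fun v => by
      rw [map_smul, hPs]
    have e2 : ∀ v, Pc ((‖Pc v‖⁻¹ : ℝ) • Pc v) = (‖Pc v‖⁻¹ : ℝ) • Pc v := fun v => by
      rw [map_smul, hPc]
    intro v w
    have H := h ((‖Ps v‖⁻¹ : ℝ) • Ps v) ((‖Pc w‖⁻¹ : ℝ) • Pc w) (hunit _) (hunit _)
    simp only [e1, e2, map_smul, norm_smul, norm_inv, norm_norm] at H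
    obtain ⟨H1, H2, H3, H4, H5⟩ := H
    have hz1 : ‖Ps v‖ = 0 → Ps v = 0 := norm_eq_zero.1
    have hz2 : ‖Pc w‖ = 0 → Pc w = 0 := norm_eq_zero.1
    rcases (norm_nonneg (Ps v)).eq_or_lt with hp | hp <;>
    rcases (norm_nonneg (Pc w)).eq_or_lt with hq | hq
    · simp [hz1 hp.symm, hz2 hq.symm]
    · rw [hz1 hp.symm]
      refine ⟨by simp, ?_, by simp, by simp, ?_⟩
      · rw [inv_mul_lt_iff₀ hq] at H2; linarith
      · rw [inv_mul_cancel₀ hq.ne', mul_one, ← sub_lt_iff_lt_add, lt_inv_mul_iff₀ hq] at H5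
        linarith
    · rw [hz2 hq.symm]
      refine ⟨by simp, by simp, ?_, ?_, by simp⟩
      · rw [inv_mul_lt_iff₀ hp] at H3; linarith
      · rw [inv_mul_cancel₀ hp.ne', inv_mul_lt_iff₀ hp] at H4; linarith
    · rw [inv_mul_cancel₀ hp.ne', inv_mul_cancel₀ hq.ne'] at *
      rw [inv_mul_lt_iff₀ hq] at H2
      rw [inv_mul_lt_iff₀ hp] at H3 H4
      rw [mul_one, ← sub_lt_iff_lt_add, lt_inv_mul_iff₀ hq] at H5
      refine ⟨?_, by linarith, by linarith, by linarith, by linarith⟩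
      rw [mul_one, mul_one, inv_mul_lt_iff₀ hp] at H1
      have := mul_lt_mul_of_pos_right H1 hq
      have e3 : ‖Ps v‖ * (1 / 150 * (‖Pc w‖⁻¹ * ‖Qc (D (Pc w))‖) + ε) * ‖Pc w‖ =
          1 / 150 * ‖Qc (D (Pc w))‖ * ‖Ps v‖ + ε * (‖Ps v‖ * ‖Pc w‖) := by
        field_simp
      linarith
  have hma : ε ≤ m / 4000 := by
    rw [hε]
    have := mul_le_mul_of_nonneg_left ha4 hm.le
    linarith
  have hlow : ∀ w, ε * ‖Pc w‖ ≤ a / 500 * ‖Qc (D (Pc w))‖ := fun w => by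
    have h5 := (key 0 w).2.2.2.2
    have e1 := mul_le_mul_of_nonneg_right hma (norm_nonneg (Pc w))
    have e2 : m / 2 * ‖Pc w‖ ≤ ‖Qc (D (Pc w))‖ := by
      have := mul_nonneg hm.le (norm_nonneg (Pc w))
      linarith
    have e3 := mul_le_mul_of_nonneg_left e2 (by positivity : 0 ≤ a / 500)
    have e4 : ε * ‖Pc w‖ = a / 500 * (m / 2 * ‖Pc w‖) := by rw [hε]; ring
    linarith
  constructor
  · intro v w
    have h1 := (key v w).1
    have h2 := mul_le_mul_of_nonneg_right (hlow w) (norm_nonneg (Ps v))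
    have h3 := mul_le_mul_of_nonneg_right ha4
      (mul_nonneg (norm_nonneg (Qc (D (Pc w)))) (norm_nonneg (Ps v)))
    have h4 := mul_nonneg (norm_nonneg (Qc (D (Pc w)))) (norm_nonneg (Ps v))
    linarith
  · intro w
    have h1 := (key 0 w).2.1
    have h2 := mul_nonneg ha.le (norm_nonneg (Qc (D (Pc w))))
    linarith [hlow w]
  · intro v w
    have h1 := mul_le_mul_of_nonneg_right (key v w).2.2.1 (norm_nonneg (Pc w))
    have h2 := mul_le_mul_of_nonneg_right (hlow w) (norm_nonneg (Ps v))
    have h4 := mul_nonneg ha.le (mul_nonneg (norm_nonneg (Qc (D (Pc w)))) (norm_nonneg (Ps v)))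
    linarith
  · intro v
    have h1 := (key v 0).2.2.2.1
    have := mul_le_mul_of_nonneg_right (hma.trans (by linarith : m / 4000 ≤ 1 / 4000))
      (norm_nonneg (Ps v))
    have := norm_nonneg (Ps v)
    linarith
  · intro w
    have h1 := (key 0 w).2.1
    have := mul_le_mul_of_nonneg_right (hma.trans (by linarith : m / 4000 ≤ 1 / 100))
      (norm_nonneg (Pc w))
    linarith
  · intro w hw
    have h1 := hlow w
    have h2 : 0 < ε * ‖Pc w‖ := mul_pos hε0 (norm_pos_iff.2 hw)
    exact pos_of_mul_pos_right (h2.trans_le h1) (by positivity)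

end DominatedStep

/-! ### Block estimates near the attractor -/

section NearAttractor

variable {d : ℕ} {M : Type*} [TopologicalSpace M] [ChartedSpace (EuclideanSpace ℝ (Fin d)) M]

theorem norm_DX_le_normDXOn [RiemannianBundle (fun x : M => TangentSpace (𝓡 d) x)]
    {X : ℝ → M → M} {E : ∀ x : M, Submodule ℝ (TangentSpace (𝓡 d) x)} {t : ℝ} {x : M}
    {v : TangentSpace (𝓡 d) x} (hv : v ∈ E x) : ‖DX X t x v‖ ≤ normDXOn X t E x * ‖v‖ :=
  ((DX X t x).comp (E x).subtypeL).le_opNorm ⟨v, hv⟩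

theorem IsFlowOf.tangentFlow_neg_tangentFlow [IsManifold (𝓡 d) 1 M]
    [T2Space M] [CompactSpace M] {G : ∀ x : M, TangentSpace (𝓡 d) x} {X : ℝ → M → M}
    (hX : IsFlowOf G X)
    (hG : ContMDiff (𝓡 d) (𝓡 d).tangent 1 (fun x => (⟨x, G x⟩ : TangentBundle (𝓡 d) M)))
    (t : ℝ) (y : TangentBundle (𝓡 d) M) : tangentFlow X (-t) (tangentFlow X t y) = y := by
  rw [← hX.tangentFlow_add hG, neg_add_cancel, hX.tangentFlow_zero]

variable [IsManifold (𝓡 d) 1 M] [CompactSpace M]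
  [RiemannianBundle (fun x : M => TangentSpace (𝓡 d) x)] {X : ℝ → M → M}

/-- On a compact time interval the tangent flow distorts norms by a bounded factor. -/
theorem exists_norm_tangentFlow_le
    [IsContinuousRiemannianBundle (EuclideanSpace ℝ (Fin d)) (fun x : M => TangentSpace (𝓡 d) x)]
    (hc : Continuous (fun p : ℝ × TangentBundle (𝓡 d) M => tangentFlow X p.1 p.2)) (τ : ℝ) :
    ∃ R : ℝ, 1 ≤ R ∧ ∀ t ∈ Icc (-τ) τ, ∀ y : TangentBundle (𝓡 d) M,
      ‖(tangentFlow X t y).2‖ ≤ R * ‖y.2‖ := by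
  have hK : IsCompact (Icc (-τ) τ ×ˢ {y : TangentBundle (𝓡 d) M | ‖y.2‖ ≤ 1}) :=
    isCompact_Icc.prod (isCompact_setOf_norm_le 1)
  obtain ⟨R, hR⟩ := hK.bddAbove_image (continuous_norm_snd.comp hc).continuousOn
  refine ⟨max R 1, le_max_right _ _, ?_⟩
  rintro t ht ⟨x, v⟩
  rcases eq_or_ne v 0 with rfl | hv
  · have : (tangentFlow X t (⟨x, 0⟩ : TangentBundle (𝓡 d) M)).2 = 0 := (DX X t x).map_zero
    rw [this]
    simp
  have hv' : 0 < ‖v‖ := norm_pos_iff.2 hv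
  have h1 : ‖(‖v‖⁻¹ : ℝ) • v‖ ≤ 1 := by
    rw [norm_smul, norm_inv, norm_norm]
    exact inv_mul_le_one
  have hmem : (t, (⟨x, (‖v‖⁻¹ : ℝ) • v⟩ : TangentBundle (𝓡 d) M)) ∈
      Icc (-τ) τ ×ˢ {y : TangentBundle (𝓡 d) M | ‖y.2‖ ≤ 1} := ⟨ht, h1⟩
  have h2 : ‖DX X t x ((‖v‖⁻¹ : ℝ) • v)‖ ≤ R :=
    hR (mem_image_of_mem _ hmem)
  rw [map_smul, norm_smul, norm_inv, norm_norm, inv_mul_le_iff₀ hv'] at h2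
  calc ‖DX X t x v‖ ≤ ‖v‖ * R := h2
    _ ≤ max R 1 * ‖v‖ := by
      rw [mul_comm]; exact mul_le_mul_of_nonneg_right (le_max_left _ _) hv'.le

variable [T2Space M] {G : ∀ x : M, TangentSpace (𝓡 d) x}

theorem IsFlowOf.norm_DX_neg_DX (hX : IsFlowOf G X)
    (hG : ContMDiff (𝓡 d) (𝓡 d).tangent 1 (fun x => (⟨x, G x⟩ : TangentBundle (𝓡 d) M)))
    (t : ℝ) (x : M) (v : TangentSpace (𝓡 d) x) :
    ‖DX X (-t) (X t x) (DX X t x v)‖ = ‖v‖ :=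
  congrArg (fun y : TangentBundle (𝓡 d) M => ‖y.2‖) (hX.tangentFlow_neg_tangentFlow hG t ⟨x, v⟩)

variable
  [IsContinuousRiemannianBundle (EuclideanSpace ℝ (Fin d)) (fun x : M => TangentSpace (𝓡 d) x)]

/-- Letting `t → 0` in the contraction estimate gives `C ≥ 1`, so that `C lam ^ T < 1` forces
`T > 0`. -/
theorem IsPartiallyHyperbolic.pos_of_mul_rpow_eq {Λ : Set M}
    {Es Ecu : ∀ x : M, Submodule ℝ (TangentSpace (𝓡 d) x)} {ds dcu : ℕ} {C lam T : ℝ}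
    (hPH : IsPartiallyHyperbolic X Λ Es Ecu ds dcu C lam) (hne : Λ.Nonempty)
    (hX : IsFlowOf G X)
    (hG : ContMDiff (𝓡 d) (𝓡 d).tangent 1 (fun x => (⟨x, G x⟩ : TangentBundle (𝓡 d) M)))
    (hT : C * lam ^ T = 1 / 150) : 0 < T := by
  obtain ⟨x, hx⟩ := hne
  obtain ⟨u, hu, s, -, hs⟩ := hPH.splitting.left x hx
  obtain ⟨hli, hspan⟩ := hs x (mem_of_mem_nhdsWithin hx hu)
  let i : Fin ds := ⟨0, hPH.one_le_ds⟩
  have hv0 : s i x ≠ 0 := hli.ne_zero i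
  have hv : s i x ∈ Es x := hspan ▸ Submodule.subset_span (mem_range_self i)
  have hc : Continuous fun t : ℝ => ‖DX X t x (s i x)‖ :=
    continuous_norm_snd.comp ((hX.continuous_tangentFlow hG).comp
      (Continuous.prodMk continuous_id
        (continuous_const (y := (⟨x, s i x⟩ : TangentBundle (𝓡 d) M)))))
  have hr : Continuous fun t : ℝ => C * lam ^ t * ‖s i x‖ :=
    (continuous_const.mul (Real.continuous_const_rpow hPH.lam_pos.ne')).mul continuous_const
  have hle : ‖DX X 0 x (s i x)‖ ≤ C * lam ^ (0 : ℝ) * ‖s i x‖ := by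
    refine le_of_tendsto_of_tendsto (b := 𝓝[>] (0 : ℝ))
      ((hc.tendsto 0).mono_left nhdsWithin_le_nhds)
      ((hr.tendsto 0).mono_left nhdsWithin_le_nhds) ?_
    filter_upwards [self_mem_nhdsWithin] with t ht
    exact (norm_DX_le_normDXOn hv).trans
      (mul_le_mul_of_nonneg_right (hPH.contraction t ht x hx) (norm_nonneg _))
  have h0 : ‖DX X 0 x (s i x)‖ = ‖s i x‖ :=
    congrArg (fun y : TangentBundle (𝓡 d) M => ‖y.2‖) (hX.tangentFlow_zero ⟨x, s i x⟩)
  rw [h0, Real.rpow_zero, mul_one] at hle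
  have hC : 1 ≤ C := le_of_mul_le_mul_right (by simpa using hle) (norm_pos_iff.2 hv0)
  by_contra! hT0
  have h1 := Real.one_le_rpow_of_pos_of_le_one_of_nonpos hPH.lam_pos hPH.lam_lt_one.le hT0
  nlinarith

/-- Near a partially hyperbolic set, the blocks of `DX_t`, `t ∈ [T, 2T]`, with respect to an
extension of the splitting satisfy the estimates of `DominatedStep`: up to an error `ε` these are
open conditions, and they hold over the set itself by its contraction and domination. -/
theorem IsPartiallyHyperbolic.eventually_dominatedStep {Λ V : Set M}
    {Es Ecu Es' Ecu' : ∀ x : M, Submodule ℝ (TangentSpace (𝓡 d) x)} {ds dcu : ℕ} {C lam T a : ℝ}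
    (hPH : IsPartiallyHyperbolic X Λ Es Ecu ds dcu C lam) (hX : IsFlowOf G X)
    (hG : ContMDiff (𝓡 d) (𝓡 d).tangent 1 (fun x => (⟨x, G x⟩ : TangentBundle (𝓡 d) M)))
    (hV : V ∈ 𝓝ˢ Λ) (hS : IsContinuousSplitting V Es' Ecu' ds dcu)
    (hext : ∀ x ∈ Λ, Es' x = Es x ∧ Ecu' x = Ecu x) (hT0 : 0 < T)
    (hT : C * lam ^ T = 1 / 150) (ha : 0 < a) (ha4 : a ≤ 1 / 4) :
    ∀ᶠ x in 𝓝ˢ Λ, ∀ t ∈ Icc T (2 * T),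
      DominatedStep (DX X t x).toLinearMap (projAlong Es' Ecu' x) (projAlong Ecu' Es' x)
        (projAlong Es' Ecu' (X t x)) (projAlong Ecu' Es' (X t x)) a := by
  have hc := hX.continuous_tangentFlow hG
  obtain ⟨R, hR1, hR⟩ := exists_norm_tangentFlow_le hc (2 * T)
  have hR0 : 0 < R := by linarith
  have hΛV : ∀ x ∈ Λ, x ∈ V := fun x hx => subset_of_mem_nhdsSet hV hx
  have hXΛ : ∀ t, ∀ x ∈ Λ, X t x ∈ Λ := fun t x hx => by
    rw [← hPH.isInvariantSet t]; exact mem_image_of_mem _ hx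
  have hS' : IsContinuousSplitting V Ecu' Es' dcu ds :=
    ⟨hS.right, hS.left, fun x hx => (hS.isCompl x hx).symm⟩
  have hπ : ∀ {E F : ∀ x : M, Submodule ℝ (TangentSpace (𝓡 d) x)} {k l : ℕ},
      IsContinuousSplitting V E F k l → ∀ y : TangentBundle (𝓡 d) M, y.1 ∈ Λ →
      ContinuousAt (projTM E F) y := fun h y hy =>
    (h.continuousWithinAt_projTM (hΛV _ hy)).continuousAt
      (continuous_tangentBundle_proj.continuousAt.preimage_mem_nhds
        (mem_nhdsSet_iff_forall.1 hV _ hy))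
  have hnc : ∀ {E F E' F' : ∀ x : M, Submodule ℝ (TangentSpace (𝓡 d) x)} {k l k' l' : ℕ},
      IsContinuousSplitting V E F k l → IsContinuousSplitting V E' F' k' l' →
      ∀ t, ∀ y : TangentBundle (𝓡 d) M, y.1 ∈ Λ →
      ContinuousAt (fun z : ℝ × TangentBundle (𝓡 d) M =>
        ‖(projTM E' F' (tangentFlow X z.1 (projTM E F z.2))).2‖) (t, y) := fun h h' t y hy => by
    refine continuous_norm_snd.continuousAt.comp ((hπ h' _ (hXΛ _ _ hy)).comp
      (f := fun z : ℝ × TangentBundle (𝓡 d) M => tangentFlow X z.1 (projTM _ _ z.2))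
      (ContinuousAt.comp (f := fun z : ℝ × TangentBundle (𝓡 d) M => (z.1, projTM _ _ z.2))
        hc.continuousAt (continuousAt_fst.prodMk
        (ContinuousAt.comp_of_eq (f := fun z : ℝ × TangentBundle (𝓡 d) M => z.2) (hπ h y hy)
        continuousAt_snd rfl))))
  have hn : ∀ {E F : ∀ x : M, Submodule ℝ (TangentSpace (𝓡 d) x)} {k l : ℕ},
      IsContinuousSplitting V E F k l → ∀ y : TangentBundle (𝓡 d) M, y.1 ∈ Λ →
      ContinuousAt (fun y : TangentBundle (𝓡 d) M => ‖(projTM E F y).2‖) y := fun h y hy =>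
    continuous_norm_snd.continuousAt.comp (hπ h y hy)
  -- over `Λ`, `R⁻¹` is a lower bound of the center-unstable block
  set ε := R⁻¹ * a / 1000 with hε
  have hε0 : 0 < ε := by positivity
  have key := eventually_nhdsSet_of_forall_eventually (isCompact_Icc (a := T) (b := 2 * T))
    (Λ := Λ) (P := fun z : ℝ × TangentBundle (𝓡 d) M × TangentBundle (𝓡 d) M =>
      ‖(projTM Es' Ecu' (tangentFlow X z.1 (projTM Es' Ecu' z.2.1))).2‖ *
          ‖(projTM Ecu' Es' z.2.2).2‖ <
        1 / 150 * ‖(projTM Ecu' Es' (tangentFlow X z.1 (projTM Ecu' Es' z.2.2))).2‖ *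
          ‖(projTM Es' Ecu' z.2.1).2‖ + ε ∧
      ‖(projTM Es' Ecu' (tangentFlow X z.1 (projTM Ecu' Es' z.2.2))).2‖ < ε ∧
      ‖(projTM Ecu' Es' (tangentFlow X z.1 (projTM Es' Ecu' z.2.1))).2‖ < ε ∧
      ‖(projTM Es' Ecu' (tangentFlow X z.1 (projTM Es' Ecu' z.2.1))).2‖ <
        1 / 150 * ‖(projTM Es' Ecu' z.2.1).2‖ + ε ∧
      R⁻¹ * ‖(projTM Ecu' Es' z.2.2).2‖ <
        ‖(projTM Ecu' Es' (tangentFlow X z.1 (projTM Ecu' Es' z.2.2))).2‖ + ε) ?_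
  · filter_upwards [key, hV] with x hx hxV t ht
    have hcompl := hS.isCompl x hxV
    exact DominatedStep.of_unit (inv_pos.2 hR0) (inv_le_one_of_one_le₀ hR1) ha ha4
      (fun v => projAlong_of_mem_left hcompl (projAlong_mem hcompl v))
      (fun v => projAlong_of_mem_left hcompl.symm (projAlong_mem hcompl.symm v))
      fun v w hv hw => hx t ht v w hv hw
  intro t ht x hx v w _ _
  have ht0 : 0 < t := hT0.trans_le ht.1
  have h1 : ContinuousAt (fun z : ℝ × TangentBundle (𝓡 d) M × TangentBundle (𝓡 d) M =>
      (z.1, z.2.1)) (t, ⟨x, v⟩, ⟨x, w⟩) := by fun_prop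
  have h2 : ContinuousAt (fun z : ℝ × TangentBundle (𝓡 d) M × TangentBundle (𝓡 d) M =>
      (z.1, z.2.2)) (t, ⟨x, v⟩, ⟨x, w⟩) := by fun_prop
  have h3 : ContinuousAt (fun z : ℝ × TangentBundle (𝓡 d) M × TangentBundle (𝓡 d) M =>
      z.2.1) (t, ⟨x, v⟩, ⟨x, w⟩) := by fun_prop
  have h4 : ContinuousAt (fun z : ℝ × TangentBundle (𝓡 d) M × TangentBundle (𝓡 d) M =>
      z.2.2) (t, ⟨x, v⟩, ⟨x, w⟩) := by fun_prop
  have css := ContinuousAt.comp_of_eq (hnc hS hS t ⟨x, v⟩ hx) h1 rfl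
  have csc := ContinuousAt.comp_of_eq (hnc hS hS' t ⟨x, v⟩ hx) h1 rfl
  have ccs := ContinuousAt.comp_of_eq (hnc hS' hS t ⟨x, w⟩ hx) h2 rfl
  have ccc := ContinuousAt.comp_of_eq (hnc hS' hS' t ⟨x, w⟩ hx) h2 rfl
  have cs := ContinuousAt.comp_of_eq (hn hS ⟨x, v⟩ hx) h3 rfl
  have cc := ContinuousAt.comp_of_eq (hn hS' ⟨x, w⟩ hx) h4 rfl
  -- over `Λ` the off-diagonal blocks vanish
  have hcx := hS.isCompl x (hΛV x hx)
  have hcX := hS.isCompl (X t x) (hΛV _ (hXΛ t x hx))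
  set p := projAlong Es' Ecu' x v with hp_def
  set q := projAlong Ecu' Es' x w with hq_def
  have hp : p ∈ Es x := by rw [← (hext x hx).1]; exact projAlong_mem hcx v
  have hq : q ∈ Ecu x := by rw [← (hext x hx).2]; exact projAlong_mem hcx.symm w
  have hDp : DX X t x p ∈ Es' (X t x) := by
    rw [(hext _ (hXΛ t x hx)).1, ← hPH.invariant_s t x hx]
    exact Submodule.mem_map_of_mem hp
  have hDq : DX X t x q ∈ Ecu (X t x) := by
    rw [← hPH.invariant_cu t x hx]
    exact Submodule.mem_map_of_mem hq
  have hDq' : DX X t x q ∈ Ecu' (X t x) := by rwa [(hext _ (hXΛ t x hx)).2]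
  have ess : projAlong Es' Ecu' (X t x) (DX X t x p) = DX X t x p := projAlong_of_mem_left hcX hDp
  have esc : projAlong Ecu' Es' (X t x) (DX X t x p) = 0 := projAlong_of_mem_right hcX.symm hDp
  have ecs : projAlong Es' Ecu' (X t x) (DX X t x q) = 0 := projAlong_of_mem_right hcX hDq'
  have ecc : projAlong Ecu' Es' (X t x) (DX X t x q) = DX X t x q :=
    projAlong_of_mem_left hcX.symm hDq'
  have hlam : C * lam ^ t ≤ 1 / 150 := by
    rw [← hT]
    exact mul_le_mul_of_nonneg_left
      (Real.rpow_le_rpow_of_exponent_ge hPH.lam_pos hPH.lam_lt_one.le ht.1) hPH.C_pos.le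
  have hNp := norm_DX_le_normDXOn (X := X) (t := t) hp
  have hNq : ‖q‖ ≤ normDXOn X (-t) Ecu (X t x) * ‖DX X t x q‖ := by
    rw [← hX.norm_DX_neg_DX hG t x q]
    exact norm_DX_le_normDXOn hDq
  have hqR : ‖q‖ ≤ R * ‖DX X t x q‖ := by
    rw [← hX.norm_DX_neg_DX hG t x q]
    exact hR (-t) ⟨by linarith [ht.2], by linarith⟩ ⟨X t x, DX X t x q⟩
  refine ((css.mul cc).eventually_lt (((continuousAt_const.mul ccc).mul cs).add
    continuousAt_const) ?_).and ((ccs.eventually_lt continuousAt_const ?_).and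
    ((csc.eventually_lt continuousAt_const ?_).and
    ((css.eventually_lt ((continuousAt_const.mul cs).add continuousAt_const) ?_).and
    ((continuousAt_const.mul cc).eventually_lt (ccc.add continuousAt_const) ?_))))
  · change ‖projAlong Es' Ecu' (X t x) (DX X t x p)‖ * ‖q‖ <
      1 / 150 * ‖projAlong Ecu' Es' (X t x) (DX X t x q)‖ * ‖p‖ + ε
    rw [ess, ecc]
    have := hPH.domination t ht0 x hx
    calc ‖DX X t x p‖ * ‖q‖ ≤ (normDXOn X t Es x * ‖p‖) *
          (normDXOn X (-t) Ecu (X t x) * ‖DX X t x q‖) :=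
          mul_le_mul hNp hNq (norm_nonneg _) ((norm_nonneg _).trans hNp)
      _ = (normDXOn X t Es x * normDXOn X (-t) Ecu (X t x)) * (‖DX X t x q‖ * ‖p‖) := by ring
      _ ≤ 1 / 150 * (‖DX X t x q‖ * ‖p‖) :=
          mul_le_mul_of_nonneg_right (this.trans hlam) (by positivity)
      _ < _ := by linarith
  · change ‖projAlong Es' Ecu' (X t x) (DX X t x q)‖ < ε
    rw [ecs, norm_zero]
    exact hε0
  · change ‖projAlong Ecu' Es' (X t x) (DX X t x p)‖ < ε
    rw [esc, norm_zero]
    exact hε0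
  · change ‖projAlong Es' Ecu' (X t x) (DX X t x p)‖ < 1 / 150 * ‖p‖ + ε
    rw [ess]
    have := mul_le_mul_of_nonneg_right ((hPH.contraction t ht0 x hx).trans hlam) (norm_nonneg p)
    linarith
  · change R⁻¹ * ‖q‖ < ‖projAlong Ecu' Es' (X t x) (DX X t x q)‖ + ε
    rw [ecc]
    have : R⁻¹ * ‖q‖ ≤ ‖DX X t x q‖ := by rwa [inv_mul_le_iff₀ hR0]
    linarith

end NearAttractor

/-! ### Cone estimates for all times -/

section Cones

variable {d : ℕ} {M : Type*} [TopologicalSpace M] [ChartedSpace (EuclideanSpace ℝ (Fin d)) M]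

theorem IsFlowOf.tangentFlow_zero_mul {G : ∀ x : M, TangentSpace (𝓡 d) x} {X : ℝ → M → M}
    (hX : IsFlowOf G X) (s : ℝ) (y : TangentBundle (𝓡 d) M) :
    tangentFlow X ((0 : ℕ) * s) y = y := by
  rw [Nat.cast_zero, zero_mul, hX.tangentFlow_zero]

theorem IsFlowOf.tangentFlow_succ_mul [IsManifold (𝓡 d) 1 M] [T2Space M] [CompactSpace M]
    {G : ∀ x : M, TangentSpace (𝓡 d) x} {X : ℝ → M → M} (hX : IsFlowOf G X)
    (hG : ContMDiff (𝓡 d) (𝓡 d).tangent 1 (fun x => (⟨x, G x⟩ : TangentBundle (𝓡 d) M)))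
    (n : ℕ) (s : ℝ) (y : TangentBundle (𝓡 d) M) :
    tangentFlow X ((n + 1 : ℕ) * s) y = tangentFlow X s (tangentFlow X (n * s) y) := by
  rw [← hX.tangentFlow_add hG]
  congr 1
  push_cast
  ring

variable [RiemannianBundle (fun x : M => TangentSpace (𝓡 d) x)]

/-- The tangent vector `y` lies in the cone of width `b` about `E`, expressed by the projections of
the splitting `E ⊕ F`. -/
def InCone (E F : ∀ x : M, Submodule ℝ (TangentSpace (𝓡 d) x)) (b : ℝ)
    (y : TangentBundle (𝓡 d) M) : Prop :=
  ‖projAlong F E y.1 y.2‖ ≤ b * ‖projAlong E F y.1 y.2‖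

theorem mem_cone_iff {E F : ∀ x : M, Submodule ℝ (TangentSpace (𝓡 d) x)} {b : ℝ} {x : M}
    (h : IsCompl (E x) (F x)) {v : TangentSpace (𝓡 d) x} :
    v ∈ cone E F b x ↔ InCone E F b ⟨x, v⟩ := by
  constructor
  · rintro ⟨p, hp, q, hq, rfl, hpq⟩
    have h1 : projAlong E F x (p + q) = p := by
      rw [map_add, projAlong_of_mem_left h hp, projAlong_of_mem_right h hq, add_zero]
    have h2 : projAlong F E x (p + q) = q := by
      rw [map_add, projAlong_of_mem_right h.symm hp, projAlong_of_mem_left h.symm hq, zero_add]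
    change ‖projAlong F E x (p + q)‖ ≤ b * ‖projAlong E F x (p + q)‖
    rwa [h1, h2]
  · intro hv
    exact ⟨_, projAlong_mem h v, _, projAlong_mem h.symm v, (projAlong_add_projAlong h v).symm, hv⟩

/-- A forward invariant set `U` over which the splitting `E ⊕ F` satisfies the block estimates of
`DominatedStep` for the times `t ∈ [T, 2T]`, together with a bound `R` for short times. -/
structure DominatedOn (X : ℝ → M → M) (U : Set M)
    (E F : ∀ x : M, Submodule ℝ (TangentSpace (𝓡 d) x)) (T a R : ℝ) : Prop where
  T_pos : 0 < T
  a_pos : 0 < a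
  a_le : a ≤ 1 / 4
  one_le : 1 ≤ R
  mapsTo : ∀ t ≥ 0, ∀ x ∈ U, X t x ∈ U
  isCompl : ∀ x ∈ U, IsCompl (E x) (F x)
  finrank_eq : ∀ x ∈ U, ∀ x' ∈ U, Module.finrank ℝ (F x) = Module.finrank ℝ (F x')
  step : ∀ x ∈ U, ∀ t ∈ Icc T (2 * T),
    DominatedStep (DX X t x).toLinearMap (projAlong E F x) (projAlong F E x)
      (projAlong E F (X t x)) (projAlong F E (X t x)) a
  norm_le : ∀ t ∈ Icc (-T) T, ∀ y : TangentBundle (𝓡 d) M, ‖(tangentFlow X t y).2‖ ≤ R * ‖y.2‖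

/-- The exponential rate corresponding to a factor `1/2` in time `2T`. -/
def rate (T : ℝ) : ℝ := (1 / 2) ^ (1 / (2 * T))

theorem rate_pos (T : ℝ) : 0 < rate T := Real.rpow_pos_of_pos (by norm_num) _

theorem rate_lt_one {T : ℝ} (hT : 0 < T) : rate T < 1 :=
  Real.rpow_lt_one (by norm_num) (by norm_num) (by positivity)

theorem half_pow_le_rate_rpow {T t : ℝ} (hT : 0 < T) {n : ℕ} (h : t ≤ 2 * T * n) :
    (1 / 2 : ℝ) ^ n ≤ rate T ^ t := by
  rw [rate, ← Real.rpow_mul (by norm_num), ← Real.rpow_natCast]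
  refine Real.rpow_le_rpow_of_exponent_ge (by norm_num) (by norm_num) ?_
  rw [one_div, inv_mul_le_iff₀ (by positivity)]
  exact h

theorem half_le_rate_rpow {T t : ℝ} (hT : 0 < T) (h : t ≤ T) : 1 / 2 ≤ rate T ^ t := by
  have := half_pow_le_rate_rpow hT (n := 1) (t := t) (by simp; linarith)
  simpa using this

/-- Every time `t ≥ T` is a sum of equal steps with length in `[T, 2T]`. -/
theorem exists_nat_mul_eq {T t : ℝ} (hT : 0 < T) (ht : T ≤ t) :
    ∃ n : ℕ, ∃ s ∈ Icc T (2 * T), t = n * s ∧ t ≤ 2 * T * n := by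
  have h1 : 1 ≤ t / T := (one_le_div hT).2 ht
  have hn1 : 1 ≤ ⌊t / T⌋₊ := Nat.one_le_floor_iff _ |>.2 h1
  have hn : (1 : ℝ) ≤ ⌊t / T⌋₊ := by exact_mod_cast hn1
  have h2 : (⌊t / T⌋₊ : ℝ) * T ≤ t := (le_div_iff₀ hT).1 (Nat.floor_le (by positivity))
  have h3 : t < (⌊t / T⌋₊ + 1) * T := (div_lt_iff₀ hT).1 (Nat.lt_floor_add_one _)
  have h4 : t ≤ 2 * T * ⌊t / T⌋₊ := by nlinarith
  refine ⟨⌊t / T⌋₊, t / ⌊t / T⌋₊, ⟨?_, ?_⟩, by field_simp, h4⟩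
  · rw [le_div_iff₀ (by linarith)]; linarith
  · rw [div_le_iff₀ (by linarith)]; exact h4

variable {X : ℝ → M → M} {U : Set M}
  {E F : ∀ x : M, Submodule ℝ (TangentSpace (𝓡 d) x)} {T a R : ℝ}

theorem DominatedOn.a_le_one (h : DominatedOn X U E F T a R) : a ≤ 1 := h.a_le.trans (by norm_num)

variable [IsManifold (𝓡 d) 1 M] [T2Space M] [CompactSpace M]
  {G : ∀ x : M, TangentSpace (𝓡 d) x}

namespace DominatedOn

theorem inCone_of_inCone_tangentFlow (h : DominatedOn X U E F T a R) (hX : IsFlowOf G X)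
    (hG : ContMDiff (𝓡 d) (𝓡 d).tangent 1 (fun x => (⟨x, G x⟩ : TangentBundle (𝓡 d) M)))
    {b : ℝ} (hab : a ≤ b) (hb : b ≤ 1) {t : ℝ} (ht : T ≤ t)
    {y : TangentBundle (𝓡 d) M} (hy : y.1 ∈ U) (hc : InCone E F b (tangentFlow X t y)) :
    InCone E F b y := by
  obtain ⟨n, s, hs, rfl, -⟩ := exists_nat_mul_eq h.T_pos ht
  clear ht
  induction n with
  | zero => simpa [hX.tangentFlow_zero] using hc
  | succ n ih =>
    rw [hX.tangentFlow_succ_mul hG] at hc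
    have hU : X (n * s) y.1 ∈ U :=
      h.mapsTo _ (mul_nonneg n.cast_nonneg (h.T_pos.le.trans hs.1)) _ hy
    exact ih ((h.step _ hU s hs).stable_invariant (projAlong_add_projAlong (h.isCompl _ hU))
      h.a_pos hab hb hc)

theorem inCone_tangentFlow (h : DominatedOn X U E F T a R) (hX : IsFlowOf G X)
    (hG : ContMDiff (𝓡 d) (𝓡 d).tangent 1 (fun x => (⟨x, G x⟩ : TangentBundle (𝓡 d) M)))
    {b : ℝ} (hab : a ≤ b) (hb : b ≤ 1) {t : ℝ} (ht : T ≤ t)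
    {y : TangentBundle (𝓡 d) M} (hy : y.1 ∈ U) (hc : InCone F E b y) :
    InCone F E b (tangentFlow X t y) := by
  obtain ⟨n, s, hs, rfl, -⟩ := exists_nat_mul_eq h.T_pos ht
  clear ht
  induction n with
  | zero => simpa [hX.tangentFlow_zero] using hc
  | succ n ih =>
    rw [hX.tangentFlow_succ_mul hG]
    have hU : X (n * s) y.1 ∈ U :=
      h.mapsTo _ (mul_nonneg n.cast_nonneg (h.T_pos.le.trans hs.1)) _ hy
    exact ((h.step _ hU s hs).cu_bounds (projAlong_add_projAlong (h.isCompl _ hU))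
      h.a_pos hab hb ih).1

/-- Vectors in the pulled-back stable cones are contracted. The constant `2 * R ^ 2` covers the
times `t ≤ T`, where `rate T ^ t ≥ 1 / 2`; `R` instead of `R ^ 2` would do here, but not in
`norm_tangentFlow_mul_le`. -/
theorem norm_tangentFlow_le (h : DominatedOn X U E F T a R) (hX : IsFlowOf G X)
    (hG : ContMDiff (𝓡 d) (𝓡 d).tangent 1 (fun x => (⟨x, G x⟩ : TangentBundle (𝓡 d) M)))
    {t : ℝ} (ht : 0 ≤ t) {y : TangentBundle (𝓡 d) M} (hy : y.1 ∈ U)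
    (hc : InCone E F a (tangentFlow X t y)) :
    ‖(tangentFlow X t y).2‖ ≤ 2 * R ^ 2 * rate T ^ t * ‖y.2‖ := by
  have hR := h.one_le
  have hR2 : 1 ≤ R ^ 2 := one_le_pow₀ hR
  have hRR : R ≤ R ^ 2 := le_self_pow₀ hR two_ne_zero
  rcases le_total t T with htT | htT
  · refine (h.norm_le t ⟨by linarith [h.T_pos], htT⟩ y).trans ?_
    have h1 := half_le_rate_rpow h.T_pos htT
    refine mul_le_mul_of_nonneg_right ?_ (norm_nonneg _)
    have := mul_le_mul_of_nonneg_left h1 (by positivity : 0 ≤ 2 * R ^ 2)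
    linarith
  obtain ⟨n, s, hs, rfl, hn⟩ := exists_nat_mul_eq h.T_pos htT
  have hs0 : 0 ≤ s := h.T_pos.le.trans hs.1
  have key : ‖(tangentFlow X (n * s) y).2‖ ≤ (1 / 2) ^ n * ‖y.2‖ := by
    clear hn htT ht
    induction n with
    | zero => rw [hX.tangentFlow_zero_mul, pow_zero, one_mul]
    | succ n ih =>
      rw [hX.tangentFlow_succ_mul hG] at hc ⊢
      have hU : X (n * s) y.1 ∈ U := h.mapsTo _ (mul_nonneg n.cast_nonneg hs0) _ hy
      have hU' : X s (X (n * s) y.1) ∈ U := h.mapsTo _ hs0 _ hU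
      have h1 := (h.step _ hU s hs).contraction (projAlong_add_projAlong (h.isCompl _ hU))
        (projAlong_add_projAlong (h.isCompl _ hU')) h.a_pos h.a_le hc
      have h2 := (h.step _ hU s hs).stable_invariant (projAlong_add_projAlong (h.isCompl _ hU))
        h.a_pos le_rfl h.a_le_one hc
      calc _ ≤ 1 / 2 * ‖(tangentFlow X (n * s) y).2‖ := h1
        _ ≤ 1 / 2 * ((1 / 2) ^ n * ‖y.2‖) := by linarith [ih h2]
        _ = _ := by ring
  refine key.trans (mul_le_mul_of_nonneg_right ?_ (norm_nonneg _))
  have h1 := half_pow_le_rate_rpow h.T_pos hn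
  have h2 := Real.rpow_nonneg (rate_pos T).le (n * s)
  nlinarith

/-- Domination of the stable by the center-unstable cones, in a form without quotients. -/
theorem norm_tangentFlow_mul_le (h : DominatedOn X U E F T a R) (hX : IsFlowOf G X)
    (hG : ContMDiff (𝓡 d) (𝓡 d).tangent 1 (fun x => (⟨x, G x⟩ : TangentBundle (𝓡 d) M)))
    {t : ℝ} (ht : 0 ≤ t) {x : M} (hx : x ∈ U)
    {u v : TangentSpace (𝓡 d) x} (hu : InCone E F a (tangentFlow X t ⟨x, u⟩))
    (hv : InCone F E a ⟨x, v⟩) :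
    ‖DX X t x u‖ * ‖v‖ ≤ 2 * R ^ 2 * rate T ^ t * (‖DX X t x v‖ * ‖u‖) := by
  have hR := h.one_le
  have hR2 : 1 ≤ R ^ 2 := one_le_pow₀ hR
  rcases le_total t T with htT | htT
  · have h1 := half_le_rate_rpow h.T_pos htT
    have h2 : ‖DX X t x u‖ ≤ R * ‖u‖ := h.norm_le t ⟨by linarith [h.T_pos], htT⟩ ⟨x, u⟩
    have h3 : ‖v‖ ≤ R * ‖DX X t x v‖ := by
      rw [← hX.norm_DX_neg_DX hG t x v]
      exact h.norm_le (-t) ⟨by linarith, by linarith [h.T_pos]⟩ ⟨X t x, DX X t x v⟩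
    calc ‖DX X t x u‖ * ‖v‖ ≤ R * ‖u‖ * (R * ‖DX X t x v‖) :=
          mul_le_mul h2 h3 (norm_nonneg _) (by positivity)
      _ = R ^ 2 * (‖DX X t x v‖ * ‖u‖) := by ring
      _ ≤ _ := by
        refine mul_le_mul_of_nonneg_right ?_ (by positivity)
        have := mul_le_mul_of_nonneg_left h1 (by positivity : 0 ≤ 2 * R ^ 2)
        linarith
  obtain ⟨n, s, hs, rfl, hn⟩ := exists_nat_mul_eq h.T_pos htT
  have hs0 : 0 ≤ s := h.T_pos.le.trans hs.1
  have key : ‖(tangentFlow X (n * s) ⟨x, u⟩).2‖ * ‖v‖ ≤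
      (1 / 2) ^ n * (‖(tangentFlow X (n * s) ⟨x, v⟩).2‖ * ‖u‖) := by
    have hcu : InCone F E a (tangentFlow X (n * s) ⟨x, v⟩) :=
      h.inCone_tangentFlow hX hG le_rfl h.a_le_one htT hx hv
    have hcu' : ∀ m : ℕ, InCone F E a (tangentFlow X (m * s) ⟨x, v⟩) := fun m => by
      rcases Nat.eq_zero_or_pos m with rfl | hm
      · simpa [hX.tangentFlow_zero] using hv
      · refine h.inCone_tangentFlow hX hG le_rfl h.a_le_one ?_ hx hv
        have : (1 : ℝ) ≤ m := by exact_mod_cast hm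
        nlinarith [hs.1]
    clear hn htT ht hcu
    induction n with
    | zero => rw [hX.tangentFlow_zero_mul, hX.tangentFlow_zero_mul, pow_zero, one_mul, mul_comm]
    | succ n ih =>
      have hU : X (n * s) x ∈ U := h.mapsTo _ (mul_nonneg n.cast_nonneg hs0) _ hx
      have hU' : X s (X (n * s) x) ∈ U := h.mapsTo _ hs0 _ hU
      rw [hX.tangentFlow_succ_mul hG] at hu ⊢
      rw [hX.tangentFlow_succ_mul hG]
      have h1 := (h.step _ hU s hs).domination (projAlong_add_projAlong (h.isCompl _ hU))
        (projAlong_add_projAlong (h.isCompl _ hU')) h.a_pos h.a_le hu (hcu' n)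
      have h2 := (h.step _ hU s hs).stable_invariant (projAlong_add_projAlong (h.isCompl _ hU))
        h.a_pos le_rfl h.a_le_one hu
      have h3 := ih h2
      set A := ‖(tangentFlow X (n * s) ⟨x, u⟩).2‖
      set B := ‖(tangentFlow X (n * s) ⟨x, v⟩).2‖ with hB
      set A' := ‖(tangentFlow X s (tangentFlow X (n * s) ⟨x, u⟩)).2‖
      set B' := ‖(tangentFlow X s (tangentFlow X (n * s) ⟨x, v⟩)).2‖
      have h4 : A' * B ≤ 1 / 2 * (B' * A) := h1
      rcases (norm_nonneg _ : 0 ≤ B).eq_or_lt with h0 | h0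
      · have hv0 : ‖v‖ = 0 := by
          rw [← hX.norm_DX_neg_DX hG (n * s) x v]
          have : (tangentFlow X (n * s) ⟨x, v⟩).2 = 0 := norm_eq_zero.1 (hB ▸ h0.symm)
          change DX X (n * s) x v = 0 at this
          rw [this, map_zero, norm_zero]
        rw [hv0, mul_zero]
        positivity
      · refine le_of_mul_le_mul_right ?_ h0
        calc A' * ‖v‖ * B = A' * B * ‖v‖ := by ring
          _ ≤ 1 / 2 * (B' * A) * ‖v‖ := mul_le_mul_of_nonneg_right h4 (norm_nonneg _)
          _ = 1 / 2 * B' * (A * ‖v‖) := by ring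
          _ ≤ 1 / 2 * B' * ((1 / 2) ^ n * (B * ‖u‖)) :=
            mul_le_mul_of_nonneg_left h3 (by positivity)
          _ = _ := by ring
  refine LE.le.trans key (mul_le_mul_of_nonneg_right ?_ (by positivity))
  have h1 := half_pow_le_rate_rpow h.T_pos hn
  have h2 := Real.rpow_nonneg (rate_pos T).le (n * s)
  nlinarith

theorem coneEstimates (h : DominatedOn X U E F T a R) (hX : IsFlowOf G X)
    (hG : ContMDiff (𝓡 d) (𝓡 d).tangent 1 (fun x => (⟨x, G x⟩ : TangentBundle (𝓡 d) M))) :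
    ConeEstimates X U E F a T (2 * R ^ 2)⁻¹ (rate T) where
  stable_invariant x hx b hb t ht v hv := by
    have ht0 := h.T_pos.le.trans ht
    rw [mem_cone_iff (h.isCompl x hx)]
    exact h.inCone_of_inCone_tangentFlow hX hG hb.1 hb.2 ht (y := ⟨x, v⟩) hx
      ((mem_cone_iff (h.isCompl _ (h.mapsTo t ht0 x hx))).1 hv)
  cu_invariant x hx b hb t ht := by
    rintro _ ⟨v, hv, rfl⟩
    have ht0 := h.T_pos.le.trans ht
    rw [mem_cone_iff (h.isCompl _ (h.mapsTo t ht0 x hx)).symm]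
    exact h.inCone_tangentFlow hX hG hb.1 hb.2 ht (y := ⟨x, v⟩) hx
      ((mem_cone_iff (h.isCompl x hx).symm).1 hv)
  backward_expansion x hx t ht v hv := by
    have hR := h.one_le
    have hr := Real.rpow_pos_of_pos (rate_pos T) t
    have h1 : tangentFlow X t (tangentFlow X (-t) ⟨X t x, v⟩) = ⟨X t x, v⟩ := by
      rw [← hX.tangentFlow_add hG, add_neg_cancel, hX.tangentFlow_zero]
    have h2 : X (-t) (X t x) = x := by
      rw [← hX.map_add hG, neg_add_cancel, hX.map_zero]
    have h3 := h.norm_tangentFlow_le hX hG ht.le (y := tangentFlow X (-t) ⟨X t x, v⟩)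
      (show X (-t) (X t x) ∈ U by rwa [h2])
      (by rw [h1]; exact (mem_cone_iff (h.isCompl _ (h.mapsTo t ht.le x hx))).1 hv)
    rw [h1] at h3
    change ‖v‖ ≤ 2 * R ^ 2 * rate T ^ t * ‖DX X (-t) (X t x) v‖ at h3
    rw [ge_iff_le, Real.rpow_neg (rate_pos T).le, ← mul_inv, inv_mul_le_iff₀ (by positivity)]
    exact h3
  domination x hx t ht v hv u hu hv0 hu0 := by
    have hR := h.one_le
    have hr := Real.rpow_pos_of_pos (rate_pos T) t
    have h3 := h.norm_tangentFlow_mul_le hX hG ht.le hx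
      ((mem_cone_iff (h.isCompl _ (h.mapsTo t ht.le x hx))).1 hu)
      ((mem_cone_iff (h.isCompl x hx).symm).1 hv)
    have hv1 := norm_pos_iff.2 hv0
    have hu1 := norm_pos_iff.2 hu0
    rw [ge_iff_le, Real.rpow_neg (rate_pos T).le, ← mul_inv, inv_mul_le_iff₀ (by positivity),
      ← mul_div_assoc, div_le_div_iff₀ hu1 hv1, mul_assoc]
    exact h3

end DominatedOn

end Cones

/-! ### The invariant stable bundle -/

section StableBundle

variable {d : ℕ} {M : Type*} [TopologicalSpace M] [ChartedSpace (EuclideanSpace ℝ (Fin d)) M]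
  [RiemannianBundle (fun x : M => TangentSpace (𝓡 d) x)]

/-- The stable bundle `x ↦ ⋂_{t ≥ 0} DX_{-t}(C^s_{X_t x}(a))`. That this intersection is a linear
subspace is a consequence of domination (`DominatedOn.mem_stableBundle_iff`), so it is
defined as a linear span. -/
def stableBundle (X : ℝ → M → M) (E F : ∀ x : M, Submodule ℝ (TangentSpace (𝓡 d) x)) (a : ℝ)
    (x : M) : Submodule ℝ (TangentSpace (𝓡 d) x) :=
  Submodule.span ℝ {v | ∀ t ≥ 0, InCone E F a (tangentFlow X t ⟨x, v⟩)}

variable {X : ℝ → M → M} {E F : ∀ x : M, Submodule ℝ (TangentSpace (𝓡 d) x)}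

theorem InCone.smul {b : ℝ} {x : M} {v : TangentSpace (𝓡 d) x} {t : ℝ} (c : ℝ)
    (h : InCone E F b (tangentFlow X t ⟨x, v⟩)) : InCone E F b (tangentFlow X t ⟨x, c • v⟩) := by
  change ‖projAlong F E (X t x) (DX X t x (c • v))‖ ≤ b * ‖projAlong E F (X t x) (DX X t x (c • v))‖
  rw [map_smul, map_smul, map_smul, norm_smul, norm_smul, mul_left_comm]
  exact mul_le_mul_of_nonneg_left h (norm_nonneg c)

variable [IsManifold (𝓡 d) 1 M] [T2Space M] [CompactSpace M]
  {G : ∀ x : M, TangentSpace (𝓡 d) x} {U : Set M} {T a R : ℝ}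

theorem IsFlowOf.DX_injective (hX : IsFlowOf G X)
    (hG : ContMDiff (𝓡 d) (𝓡 d).tangent 1 (fun x => (⟨x, G x⟩ : TangentBundle (𝓡 d) M)))
    (t : ℝ) (x : M) : Function.Injective (DX (d := d) X t x) := by
  rw [injective_iff_map_eq_zero]
  intro v hv
  have := hX.norm_DX_neg_DX hG t x v
  rw [hv, _root_.map_zero, norm_zero] at this
  exact norm_eq_zero.1 this.symm

theorem IsFlowOf.DX_surjective (hX : IsFlowOf G X)
    (hG : ContMDiff (𝓡 d) (𝓡 d).tangent 1 (fun x => (⟨x, G x⟩ : TangentBundle (𝓡 d) M)))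
    (t : ℝ) (x : M) : Function.Surjective (DX (d := d) X t x) :=
  (LinearMap.injective_iff_surjective_of_finrank_eq_finrank (f := (DX X t x).toLinearMap)
    ((finrank_tangentSpace x).trans (finrank_tangentSpace (X t x)).symm)).1
    (hX.DX_injective hG t x)

namespace DominatedOn

/-- By backward invariance of the cones it is enough to test the stable cone at the late multiples
of `T`. -/
theorem forall_inCone_of_eventually (h : DominatedOn X U E F T a R) (hX : IsFlowOf G X)
    (hG : ContMDiff (𝓡 d) (𝓡 d).tangent 1 (fun x => (⟨x, G x⟩ : TangentBundle (𝓡 d) M)))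
    {y : TangentBundle (𝓡 d) M} (hy : y.1 ∈ U)
    (hc : ∀ᶠ n : ℕ in atTop, InCone E F a (tangentFlow X (n * T) y)) {t : ℝ} (ht : 0 ≤ t) :
    InCone E F a (tangentFlow X t y) := by
  obtain ⟨n, hn, hnt⟩ := (hc.and ((tendsto_natCast_atTop_atTop.atTop_mul_const
    h.T_pos).eventually_ge_atTop (t + T))).exists
  refine h.inCone_of_inCone_tangentFlow hX hG le_rfl h.a_le_one (t := n * T - t) (by linarith)
    (h.mapsTo t ht _ hy) ?_
  rwa [← hX.tangentFlow_add hG, sub_add_cancel]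

/-- By domination, nonzero vectors of the center-unstable direction cannot be sums of vectors that
stay in the stable cone. Sums of three vectors are what linearity of the stable bundle requires. -/
theorem add_add_eq_zero (h : DominatedOn X U E F T a R) (hX : IsFlowOf G X)
    (hG : ContMDiff (𝓡 d) (𝓡 d).tangent 1 (fun x => (⟨x, G x⟩ : TangentBundle (𝓡 d) M)))
    {x : M} (hx : x ∈ U) {u v w : TangentSpace (𝓡 d) x}
    (hu : ∀ t ≥ 0, InCone E F a (tangentFlow X t ⟨x, u⟩))
    (hv : ∀ t ≥ 0, InCone E F a (tangentFlow X t ⟨x, v⟩))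
    (hw : ∀ t ≥ 0, InCone E F a (tangentFlow X t ⟨x, w⟩)) (hmem : u + v + w ∈ F x) :
    u + v + w = 0 := by
  set q := u + v + w with hq
  have hR := h.one_le
  have hcq : InCone F E a ⟨x, q⟩ := by
    change ‖projAlong E F x q‖ ≤ a * ‖projAlong F E x q‖
    rw [projAlong_of_mem_right (h.isCompl x hx) hmem, norm_zero]
    exact mul_nonneg h.a_pos.le (norm_nonneg _)
  have key : ∀ t : ℝ, 0 ≤ t → ‖q‖ ≤ 2 * R ^ 2 * rate T ^ t * (‖u‖ + ‖v‖ + ‖w‖) := by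
    intro t ht
    rcases (norm_nonneg q).eq_or_lt with h0 | h0
    · rw [← h0]
      have := Real.rpow_nonneg (rate_pos T).le t
      positivity
    have hDq : 0 < ‖DX X t x q‖ := norm_pos_iff.2
      ((map_ne_zero_iff _ (hX.DX_injective hG t x)).2 (norm_pos_iff.1 h0))
    have h1 := h.norm_tangentFlow_mul_le hX hG ht hx (hu t ht) hcq
    have h2 := h.norm_tangentFlow_mul_le hX hG ht hx (hv t ht) hcq
    have h3 := h.norm_tangentFlow_mul_le hX hG ht hx (hw t ht) hcq
    have h4 : ‖DX X t x q‖ ≤ ‖DX X t x u‖ + ‖DX X t x v‖ + ‖DX X t x w‖ := by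
      rw [hq, map_add, map_add]
      exact norm_add₃_le
    refine le_of_mul_le_mul_left ?_ hDq
    have h5 := mul_le_mul_of_nonneg_right h4 h0.le
    linarith
  have hlim : Tendsto (fun n : ℕ => 2 * R ^ 2 * rate T ^ (n : ℝ) * (‖u‖ + ‖v‖ + ‖w‖)) atTop
      (𝓝 (2 * R ^ 2 * 0 * (‖u‖ + ‖v‖ + ‖w‖))) := by
    refine (Tendsto.const_mul _ ?_).mul_const _
    simp_rw [Real.rpow_natCast]
    exact tendsto_pow_atTop_nhds_zero_of_lt_one (rate_pos T).le (rate_lt_one h.T_pos)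
  have h0 := ge_of_tendsto' hlim fun n => key n n.cast_nonneg
  rw [mul_zero, zero_mul] at h0
  exact norm_le_zero_iff.1 h0

/-- Every vector of `E x` is the `E`-component of a vector that stays in the stable cone: a limit of
vectors whose image at time `n T` has no `F`-component. -/
theorem exists_forall_inCone (h : DominatedOn X U E F T a R) (hX : IsFlowOf G X)
    (hG : ContMDiff (𝓡 d) (𝓡 d).tangent 1 (fun x => (⟨x, G x⟩ : TangentBundle (𝓡 d) M)))
    {x : M} (hx : x ∈ U) {p : TangentSpace (𝓡 d) x} (hp : p ∈ E x) :
    ∃ w : TangentSpace (𝓡 d) x, projAlong E F x w = p ∧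
      ∀ t ≥ 0, InCone E F a (tangentFlow X t ⟨x, w⟩) := by
  have hcx := h.isCompl x hx
  have hnT : ∀ n : ℕ, T ≤ (n + 1 : ℕ) * T := fun n => by
    push_cast
    nlinarith [h.T_pos, (n.cast_nonneg : (0 : ℝ) ≤ n)]
  let Z : ℕ → Set (TangentSpace (𝓡 d) x) := fun n =>
    {w | projAlong E F x w = p ∧ InCone E F a (tangentFlow X ((n + 1 : ℕ) * T) ⟨x, w⟩)}
  have hcl : ∀ n, IsClosed (Z n) := fun n => by
    refine (isClosed_eq (LinearMap.continuous_of_finiteDimensional _) continuous_const).inter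
      (isClosed_le
        (f := fun w => ‖projAlong F E (X ((n + 1 : ℕ) * T) x) (DX X ((n + 1 : ℕ) * T) x w)‖)
        (g := fun w => a * ‖projAlong E F (X ((n + 1 : ℕ) * T) x) (DX X ((n + 1 : ℕ) * T) x w)‖)
        ?_ ?_)
    · exact ((LinearMap.continuous_of_finiteDimensional _).comp
        (ContinuousLinearMap.continuous _)).norm
    · exact continuous_const.mul ((LinearMap.continuous_of_finiteDimensional _).comp
        (ContinuousLinearMap.continuous _)).norm
  have hcpt : IsCompact (Z 0) := by
    refine (isCompact_closedBall (0 : TangentSpace (𝓡 d) x) (‖p‖ + a * ‖p‖)).of_isClosed_subset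
      (hcl 0) ?_
    rintro w ⟨hw1, hw2⟩
    have hc : ‖projAlong F E x w‖ ≤ a * ‖projAlong E F x w‖ :=
      h.inCone_of_inCone_tangentFlow hX hG le_rfl h.a_le_one (hnT 0) (y := ⟨x, w⟩) hx hw2
    rw [mem_closedBall_zero_iff]
    calc ‖w‖ = ‖projAlong E F x w + projAlong F E x w‖ := by rw [projAlong_add_projAlong hcx]
      _ ≤ ‖projAlong E F x w‖ + ‖projAlong F E x w‖ := norm_add_le _ _
      _ ≤ ‖p‖ + a * ‖p‖ := by rw [hw1] at hc ⊢; linarith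
  have hmono : ∀ n, Z (n + 1) ⊆ Z n := fun n w hw => by
    refine ⟨hw.1, ?_⟩
    have h2 := hw.2
    rw [hX.tangentFlow_succ_mul hG] at h2
    exact h.inCone_of_inCone_tangentFlow hX hG le_rfl h.a_le_one le_rfl
      (h.mapsTo _ (h.T_pos.le.trans (hnT n)) x hx) h2
  have hne : ∀ n, (Z n).Nonempty := fun n => by
    -- `w ↦ (F-component of the image, E-component of w)` is injective by invariance of the
    -- center-unstable cone, hence bijective
    set t : ℝ := (n + 1 : ℕ) * T with ht
    have hxt : X t x ∈ U := h.mapsTo _ (h.T_pos.le.trans (hnT n)) x hx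
    have hcxt := h.isCompl _ hxt
    let A : TangentSpace (𝓡 d) x →ₗ[ℝ] (F (X t x)) × (E x) :=
      (((projAlong F E (X t x)).codRestrict _ (projAlong_mem hcxt.symm)).comp
        (DX X t x).toLinearMap).prod ((projAlong E F x).codRestrict _ (projAlong_mem hcx))
    have hA : ∀ w, A w = 0 → w = 0 := fun w hw => by
      have e1 : projAlong F E (X t x) (DX X t x w) = 0 :=
        congrArg Subtype.val (congrArg Prod.fst hw)
      have e2 : projAlong E F x w = 0 := congrArg Subtype.val (congrArg Prod.snd hw)
      have e3 : ‖projAlong E F (X t x) (DX X t x w)‖ ≤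
          a * ‖projAlong F E (X t x) (DX X t x w)‖ := by
        refine h.inCone_tangentFlow hX hG le_rfl h.a_le_one (hnT n) (y := ⟨x, w⟩) hx ?_
        change ‖projAlong E F x w‖ ≤ a * ‖projAlong F E x w‖
        rw [e2, norm_zero]
        exact mul_nonneg h.a_pos.le (norm_nonneg _)
      rw [e1, norm_zero, mul_zero, norm_le_zero_iff] at e3
      have e4 : DX X t x w = 0 := by
        rw [← projAlong_add_projAlong hcxt (DX X t x w), e1, e3, add_zero]
      exact hX.DX_injective hG t x (e4.trans (map_zero _).symm)
    have hrank : Module.finrank ℝ (TangentSpace (𝓡 d) x) =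
        Module.finrank ℝ ((F (X t x)) × (E x)) := by
      rw [Module.finrank_prod, h.finrank_eq _ hxt x hx, add_comm,
        Submodule.finrank_add_eq_of_isCompl hcx]
    obtain ⟨w, hw⟩ := (LinearMap.injective_iff_surjective_of_finrank_eq_finrank hrank).1
      ((injective_iff_map_eq_zero A).2 hA) (0, ⟨p, hp⟩)
    refine ⟨w, congrArg Subtype.val (congrArg Prod.snd hw), ?_⟩
    have e1 : projAlong F E (X t x) (DX X t x w) = 0 :=
        congrArg Subtype.val (congrArg Prod.fst hw)
    change ‖projAlong F E (X t x) (DX X t x w)‖ ≤ a * ‖projAlong E F (X t x) (DX X t x w)‖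
    rw [e1, norm_zero]
    exact mul_nonneg h.a_pos.le (norm_nonneg _)
  obtain ⟨w, hw⟩ := IsCompact.nonempty_iInter_of_sequence_nonempty_isCompact_isClosed Z hmono hne
    hcpt hcl
  rw [mem_iInter] at hw
  refine ⟨w, (hw 0).1, fun t ht => h.forall_inCone_of_eventually hX hG (y := ⟨x, w⟩) hx ?_ ht⟩
  filter_upwards [eventually_ge_atTop 1] with n hn
  obtain ⟨m, rfl⟩ := Nat.exists_eq_add_of_le' hn
  exact (hw m).2

/-- The vectors that stay in the stable cone are closed under addition: `v + w` has the same
`E`-component as some vector `z` that stays in the cone, and `v + w - z = 0` by domination. -/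
theorem mem_stableBundle_iff (h : DominatedOn X U E F T a R) (hX : IsFlowOf G X)
    (hG : ContMDiff (𝓡 d) (𝓡 d).tangent 1 (fun x => (⟨x, G x⟩ : TangentBundle (𝓡 d) M)))
    {x : M} (hx : x ∈ U) {v : TangentSpace (𝓡 d) x} :
    v ∈ stableBundle X E F a x ↔ ∀ t ≥ 0, InCone E F a (tangentFlow X t ⟨x, v⟩) := by
  refine ⟨fun hv => ?_, fun hv => Submodule.subset_span hv⟩
  induction hv using Submodule.span_induction with
  | mem v hv => exact hv
  | zero =>
    intro t _
    change ‖projAlong F E (X t x) (DX X t x 0)‖ ≤ a * ‖projAlong E F (X t x) (DX X t x 0)‖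
    rw [map_zero, map_zero, map_zero, norm_zero, mul_zero]
  | add v w _ _ hv hw =>
    have hcx := h.isCompl x hx
    obtain ⟨z, hz, hzc⟩ := h.exists_forall_inCone hX hG hx (projAlong_mem hcx (v + w))
    have h0 := h.add_add_eq_zero hX hG hx hv hw (w := (-1 : ℝ) • z)
      (fun t ht => (hzc t ht).smul _) (by
        rw [← projAlong_eq_zero_iff hcx, map_add, map_smul, hz, neg_one_smul, add_neg_cancel])
    rw [neg_one_smul, add_neg_eq_zero] at h0
    rw [h0]
    exact hzc
  | smul c v _ hv => exact fun t ht => (hv t ht).smul c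

theorem isCompl_stableBundle (h : DominatedOn X U E F T a R) (hX : IsFlowOf G X)
    (hG : ContMDiff (𝓡 d) (𝓡 d).tangent 1 (fun x => (⟨x, G x⟩ : TangentBundle (𝓡 d) M)))
    {x : M} (hx : x ∈ U) : IsCompl (stableBundle X E F a x) (F x) := by
  have hcx := h.isCompl x hx
  constructor
  · rw [Submodule.disjoint_def]
    intro v hv hvF
    have hv' := (h.mem_stableBundle_iff hX hG hx).1 hv
    have h0 := (h.mem_stableBundle_iff hX hG hx).1 (zero_mem _)
    simpa using h.add_add_eq_zero hX hG hx hv' h0 h0 (by simpa using hvF)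
  · rw [Submodule.codisjoint_iff_exists_add_eq]
    intro v
    obtain ⟨z, hz, hzc⟩ := h.exists_forall_inCone hX hG hx (projAlong_mem hcx v)
    refine ⟨z, v - z, (h.mem_stableBundle_iff hX hG hx).2 hzc, ?_, add_sub_cancel _ _⟩
    rw [← projAlong_eq_zero_iff hcx, map_sub, hz, sub_self]

theorem coe_stableBundle (h : DominatedOn X U E F T a R) (hX : IsFlowOf G X)
    (hG : ContMDiff (𝓡 d) (𝓡 d).tangent 1 (fun x => (⟨x, G x⟩ : TangentBundle (𝓡 d) M)))
    {x : M} (hx : x ∈ U) :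
    (stableBundle X E F a x : Set (TangentSpace (𝓡 d) x)) =
      ⋂ t ∈ Ici (0 : ℝ), pulledBackCone X E F a t x := by
  ext v
  rw [SetLike.mem_coe, h.mem_stableBundle_iff hX hG hx, mem_iInter₂]
  exact forall₂_congr fun t ht => (mem_cone_iff (h.isCompl _ (h.mapsTo t ht x hx))).symm

/-- Over a forward orbit along which `E` is invariant, the stable bundle is `E`. -/
theorem stableBundle_eq (h : DominatedOn X U E F T a R) (hX : IsFlowOf G X)
    (hG : ContMDiff (𝓡 d) (𝓡 d).tangent 1 (fun x => (⟨x, G x⟩ : TangentBundle (𝓡 d) M)))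
    {x : M} (hx : x ∈ U)
    (hE : ∀ t ≥ 0, ∀ v ∈ E x, DX X t x v ∈ E (X t x)) : stableBundle X E F a x = E x := by
  have hcx := h.isCompl x hx
  have hcF := h.isCompl_stableBundle hX hG hx
  have hle : E x ≤ stableBundle X E F a x := fun v hv => by
    refine (h.mem_stableBundle_iff hX hG hx).2 fun t ht => ?_
    change ‖projAlong F E (X t x) (DX X t x v)‖ ≤ a * ‖projAlong E F (X t x) (DX X t x v)‖
    rw [projAlong_of_mem_right (h.isCompl _ (h.mapsTo t ht x hx)).symm (hE t ht v hv), norm_zero]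
    exact mul_nonneg h.a_pos.le (norm_nonneg _)
  refine le_antisymm (fun v hv => ?_) hle
  have h1 : projAlong F E x v ∈ stableBundle X E F a x := by
    have : projAlong F E x v = v - projAlong E F x v :=
      eq_sub_of_add_eq' (projAlong_add_projAlong hcx v)
    rw [this]
    exact sub_mem hv (hle (projAlong_mem hcx v))
  have h2 := (Submodule.disjoint_def.1 hcF.disjoint) _ h1 (projAlong_mem hcx.symm v)
  exact (projAlong_eq_zero_iff hcx.symm).1 h2

theorem map_stableBundle (h : DominatedOn X U E F T a R) (hX : IsFlowOf G X)
    (hG : ContMDiff (𝓡 d) (𝓡 d).tangent 1 (fun x => (⟨x, G x⟩ : TangentBundle (𝓡 d) M)))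
    {x : M} (hx : x ∈ U) {t : ℝ} (ht : 0 ≤ t) :
    (stableBundle X E F a x).map (DX X t x).toLinearMap = stableBundle X E F a (X t x) := by
  have hxt := h.mapsTo t ht x hx
  refine le_antisymm ?_ fun w hw => ?_
  · rintro _ ⟨v, hv, rfl⟩
    refine (h.mem_stableBundle_iff hX hG hxt).2 fun s hs => ?_
    have := (h.mem_stableBundle_iff hX hG hx).1 hv (s + t) (add_nonneg hs ht)
    rwa [hX.tangentFlow_add hG] at this
  · obtain ⟨v, rfl⟩ := hX.DX_surjective hG t x w
    refine ⟨v, (h.mem_stableBundle_iff hX hG hx).2 fun s hs => ?_, rfl⟩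
    refine h.forall_inCone_of_eventually hX hG (y := ⟨x, v⟩) hx ?_ hs
    filter_upwards [(tendsto_natCast_atTop_atTop.atTop_mul_const
      h.T_pos).eventually_ge_atTop t] with n hn
    have := (h.mem_stableBundle_iff hX hG hxt).1 hw (n * T - t) (sub_nonneg.2 hn)
    rw [← sub_add_cancel (n * T) t, hX.tangentFlow_add hG]
    exact this

theorem normDXOn_stableBundle_le (h : DominatedOn X U E F T a R) (hX : IsFlowOf G X)
    (hG : ContMDiff (𝓡 d) (𝓡 d).tangent 1 (fun x => (⟨x, G x⟩ : TangentBundle (𝓡 d) M)))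
    {x : M} (hx : x ∈ U) {t : ℝ} (ht : 0 ≤ t) :
    normDXOn X t (stableBundle X E F a) x ≤ (2 * R ^ 2)⁻¹⁻¹ * rate T ^ t := by
  rw [inv_inv]
  have hr := Real.rpow_nonneg (rate_pos T).le t
  refine ContinuousLinearMap.opNorm_le_bound _ (by positivity) fun v => ?_
  exact h.norm_tangentFlow_le hX hG ht (y := ⟨x, v.1⟩) hx
    ((h.mem_stableBundle_iff hX hG hx).1 v.2 t ht)

variable
  [IsContinuousRiemannianBundle (EuclideanSpace ℝ (Fin d)) (fun x : M => TangentSpace (𝓡 d) x)]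

/-- The projection onto the stable bundle is continuous: a limit of vectors of the bundle
lies in the bundle, because the cone conditions are closed. -/
theorem continuousAt_projTM_stableBundle (h : DominatedOn X U E F T a R) (hX : IsFlowOf G X)
    (hG : ContMDiff (𝓡 d) (𝓡 d).tangent 1 (fun x => (⟨x, G x⟩ : TangentBundle (𝓡 d) M)))
    (hU : IsOpen U)
    (hcE : ∀ y : TangentBundle (𝓡 d) M, y.1 ∈ U → ContinuousAt (projTM E F) y)
    (hcF : ∀ y : TangentBundle (𝓡 d) M, y.1 ∈ U → ContinuousAt (projTM F E) y)
    {y : TangentBundle (𝓡 d) M} (hy : y.1 ∈ U) :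
    ContinuousAt (projTM (stableBundle X E F a) F) y := by
  have := t2Space_tangentBundle (d := d) (M := M)
  have hflow := hX.continuous_tangentFlow hG
  have hproj := continuous_tangentBundle_proj (d := d) (M := M)
  rw [continuousAt_iff_ultrafilter]
  intro 𝒰 h𝒰
  have hb : Tendsto (TotalSpace.proj : TangentBundle (𝓡 d) M → M) 𝒰 (𝓝 y.1) :=
    (hproj.tendsto y).mono_left h𝒰
  have hUe : ∀ᶠ z in (𝒰 : Filter (TangentBundle (𝓡 d) M)), z.1 ∈ U := hb.eventually (hU.mem_nhds hy)
  set z := projTM (stableBundle X E F a) F with hz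
  have hzmem : ∀ w : TangentBundle (𝓡 d) M, w.1 ∈ U → (z w).2 ∈ stableBundle X E F a w.1 :=
    fun w hw => projAlong_mem (h.isCompl_stableBundle hX hG hw) w.2
  have hzcone : ∀ w : TangentBundle (𝓡 d) M, w.1 ∈ U → ∀ t ≥ 0,
      InCone E F a (tangentFlow X t (z w)) := fun w hw =>
    (h.mem_stableBundle_iff hX hG hw).1 (hzmem w hw)
  have hzs : ∀ w : TangentBundle (𝓡 d) M, w.1 ∈ U → projTM E F (z w) = projTM E F w :=
      fun w hw => by
    obtain ⟨x, v⟩ := w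
    have hcw := h.isCompl_stableBundle hX hG hw
    have e1 : projAlong F (stableBundle X E F a) x v ∈ F x := projAlong_mem hcw.symm v
    have e2 := projAlong_of_mem_right (h.isCompl x hw) e1
    rw [eq_sub_of_add_eq' (projAlong_add_projAlong hcw v), map_sub, sub_eq_zero] at e2
    exact congrArg (TotalSpace.mk (F := EuclideanSpace ℝ (Fin d)) x) e2.symm
  have hns : Tendsto (fun w => ‖(projTM E F w).2‖) 𝒰 (𝓝 ‖(projTM E F y).2‖) :=
    ((continuous_norm_snd.tendsto _).comp (hcE y hy)).mono_left h𝒰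
  have hbound : ∀ᶠ w in (𝒰 : Filter (TangentBundle (𝓡 d) M)),
      ‖(z w).2‖ ≤ 2 * (‖(projTM E F y).2‖ + 1) := by
    filter_upwards [hUe, hns.eventually (gt_mem_nhds (lt_add_one _))] with w hw hw2
    have e1 : ‖projAlong F E w.1 (z w).2‖ ≤ a * ‖projAlong E F w.1 (z w).2‖ := by
      have := hzcone w hw 0 le_rfl
      rwa [hX.tangentFlow_zero] at this
    have e2 : ‖projAlong E F w.1 (z w).2‖ = ‖(projTM E F w).2‖ :=
      congrArg (fun y : TangentBundle (𝓡 d) M => ‖y.2‖) (hzs w hw)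
    have e3 : ‖(z w).2‖ ≤ ‖projAlong E F w.1 (z w).2‖ + ‖projAlong F E w.1 (z w).2‖ := by
      conv_lhs => rw [← projAlong_add_projAlong (h.isCompl _ hw) (z w).2]
      exact norm_add_le _ _
    have e4 := mul_le_mul_of_nonneg_right h.a_le_one (norm_nonneg (projAlong E F w.1 (z w).2))
    linarith
  obtain ⟨z₀, -, hz₀⟩ := isCompact_iff_ultrafilter_le_nhds.1
    (isCompact_setOf_norm_le (d := d) (M := M) (2 * (‖(projTM E F y).2‖ + 1)))
    (𝒰.map z) (le_principal_iff.2 hbound)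
  have hz₀' : Tendsto z 𝒰 (𝓝 z₀) := hz₀
  have hbase : z₀.proj = y.proj := tendsto_nhds_unique ((hproj.tendsto z₀).comp hz₀') hb
  have hzU : z₀.1 ∈ U := hbase ▸ hy
  have hs : projTM E F z₀ = projTM E F y :=
    tendsto_nhds_unique (((hcE z₀ hzU).tendsto.comp hz₀').congr' (by
      filter_upwards [hUe] with w hw using hzs w hw)) ((hcE y hy).tendsto.mono_left h𝒰)
  have hcone : ∀ t ≥ 0, InCone E F a (tangentFlow X t z₀) := fun t ht => by
    have hft : Tendsto (fun w => tangentFlow X t (z w)) 𝒰 (𝓝 (tangentFlow X t z₀)) :=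
      ((hflow.comp (Continuous.prodMk_right t)).tendsto z₀).comp hz₀'
    have hU' : (tangentFlow X t z₀).1 ∈ U := h.mapsTo t ht _ hzU
    refine le_of_tendsto_of_tendsto
      ((continuous_norm_snd.tendsto _).comp ((hcF _ hU').tendsto.comp hft))
      (((continuous_norm_snd.tendsto _).comp ((hcE _ hU').tendsto.comp hft)).const_mul a) ?_
    filter_upwards [hUe] with w hw using hzcone w hw t ht
  have hfin : z₀ = z y := by
    obtain ⟨x, v⟩ := z₀
    obtain ⟨x', v'⟩ := y
    obtain rfl : x = x' := hbase
    have hs' : projAlong E F x v = projAlong E F x v' :=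
      eq_of_heq (TotalSpace.mk.inj hs).2
    have h1 : v ∈ stableBundle X E F a x := (h.mem_stableBundle_iff hX hG hy).2 hcone
    have h2 : v' - v ∈ F x := by
      rw [← projAlong_eq_zero_iff (h.isCompl x hy), map_sub, hs', sub_self]
    have h3 : projAlong (stableBundle X E F a) F x v' = v := by
      have hc := h.isCompl_stableBundle hX hG hy
      rw [← add_sub_cancel v v', map_add, projAlong_of_mem_left hc h1,
        projAlong_of_mem_right hc h2, add_zero]
    exact congrArg (TotalSpace.mk (F := EuclideanSpace ℝ (Fin d)) x) h3.symm
  rw [← hfin]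
  exact hz₀'

theorem isContinuousSubbundle_stableBundle (h : DominatedOn X U E F T a R) (hX : IsFlowOf G X)
    (hG : ContMDiff (𝓡 d) (𝓡 d).tangent 1 (fun x => (⟨x, G x⟩ : TangentBundle (𝓡 d) M)))
    (hU : IsOpen U)
    (hcE : ∀ y : TangentBundle (𝓡 d) M, y.1 ∈ U → ContinuousAt (projTM E F) y)
    (hcF : ∀ y : TangentBundle (𝓡 d) M, y.1 ∈ U → ContinuousAt (projTM F E) y) {k : ℕ}
    (hk : ∀ x ∈ U, Module.finrank ℝ (E x) = k) :
    IsContinuousSubbundle U (stableBundle X E F a) k := by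
  have hrank : ∀ x ∈ U, Module.finrank ℝ (stableBundle X E F a x) = k := fun x hx => by
    have h1 := Submodule.finrank_add_eq_of_isCompl (h.isCompl_stableBundle hX hG hx)
    have h2 := Submodule.finrank_add_eq_of_isCompl (h.isCompl x hx)
    have := hk x hx
    omega
  have hrange : ∀ x ∈ U, LinearMap.range (projAlong (stableBundle X E F a) F x) =
      stableBundle X E F a x := fun x hx => by
    have hc := h.isCompl_stableBundle hX hG hx
    refine le_antisymm ?_ fun v hv => ⟨v, projAlong_of_mem_left hc hv⟩
    rintro _ ⟨v, rfl⟩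
    exact projAlong_mem hc v
  have hr := isContinuousSubbundle_range hU
    (fun y hy => h.continuousAt_projTM_stableBundle hX hG hU hcE hcF hy)
    (fun x hx v => projAlong_of_mem_left (h.isCompl_stableBundle hX hG hx)
      (projAlong_mem (h.isCompl_stableBundle hX hG hx) v))
    (fun x hx => by rw [hrange x hx, hrank x hx])
  intro x₀ hx₀
  obtain ⟨u, hu, s, hs, hsu⟩ := hr x₀ hx₀
  exact ⟨u ∩ U, inter_mem hu self_mem_nhdsWithin, s, fun i => (hs i).mono inter_subset_left,
    fun x hx => ⟨(hsu x hx.1).1, (hsu x hx.1).2.trans (hrange x hx.2)⟩⟩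

end DominatedOn

end StableBundle

/-! ### Idempotents near almost idempotents -/

section Newton

variable {A : Type*} [NormedRing A]

/-- The Newton step for the equation `a ^ 2 = a`, that is `3 a ^ 2 - 2 a ^ 3`. -/
def newtonStep (a : A) : A := a + (a * a - a) * (1 - 2 * a)

/-- The limit of the Newton iteration for the equation `a ^ 2 = a`. -/
def newtonLimit (a : A) : A := limUnder atTop fun n => newtonStep^[n] a

theorem newtonStep_defect (a : A) :
    newtonStep a * newtonStep a - newtonStep a =
      (a * a - a) * (a * a - a) * (4 * (a * a - a) - 3) := by
  simp only [newtonStep]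
  noncomm_ring

theorem one_sub_newtonStep (a : A) :
    1 - 2 * newtonStep a = (1 - 2 * a) - 2 * (a * a - a) * (1 - 2 * a) := by
  simp only [newtonStep]
  noncomm_ring

theorem newtonStep_of_isIdempotentElem {a : A} (h : a * a = a) : newtonStep a = a := by
  rw [newtonStep, h, sub_self, zero_mul, add_zero]

theorem continuous_newtonStep : Continuous (newtonStep : A → A) := by
  unfold newtonStep
  fun_prop

/-- Along the Newton iteration the defect `a ^ 2 - a` decays faster than `1 - 2 a` grows. -/
theorem norm_newton_iterate [NormOneClass A] {a : A} (ha : ‖a * a - a‖ ≤ 1 / 8) (n : ℕ) :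
    ‖newtonStep^[n] a * newtonStep^[n] a - newtonStep^[n] a‖ ≤ 1 / 8 * (1 / 2) ^ n ∧
      ‖1 - 2 * newtonStep^[n] a‖ ≤ ‖1 - 2 * a‖ * (5 / 4) ^ n := by
  have h4 : ‖(4 : A)‖ ≤ 4 := by simpa using Nat.norm_cast_le (α := A) 4
  have h3 : ‖(3 : A)‖ ≤ 3 := by simpa using Nat.norm_cast_le (α := A) 3
  have h2 : ‖(2 : A)‖ ≤ 2 := by simpa using Nat.norm_cast_le (α := A) 2
  induction n with
  | zero => simpa using ha
  | succ n ih =>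
    rw [Function.iterate_succ_apply']
    set b := newtonStep^[n] a
    set e := b * b - b with he
    have hn : (1 / 2 : ℝ) ^ n ≤ 1 := pow_le_one₀ (by norm_num) (by norm_num)
    have he1 : ‖e‖ ≤ 1 / 8 := ih.1.trans (by linarith)
    have he0 := norm_nonneg e
    constructor
    · rw [newtonStep_defect, ← he]
      have h5 : ‖4 * e - 3‖ ≤ 4 := by
        refine (norm_sub_le _ _).trans ?_
        have := (norm_mul_le 4 e).trans (mul_le_mul_of_nonneg_right h4 he0)
        linarith
      calc ‖e * e * (4 * e - 3)‖ ≤ ‖e‖ * ‖e‖ * ‖4 * e - 3‖ :=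
            (norm_mul_le _ _).trans (mul_le_mul_of_nonneg_right (norm_mul_le _ _) (norm_nonneg _))
        _ ≤ ‖e‖ * (1 / 8) * 4 := by gcongr
        _ ≤ 1 / 8 * (1 / 2) ^ (n + 1) := by rw [pow_succ]; linarith [ih.1]
    · rw [one_sub_newtonStep, ← he]
      calc ‖(1 - 2 * b) - 2 * e * (1 - 2 * b)‖ ≤ ‖1 - 2 * b‖ + 2 * ‖e‖ * ‖1 - 2 * b‖ := by
            refine (norm_sub_le _ _).trans (add_le_add le_rfl ((norm_mul_le _ _).trans ?_))
            exact mul_le_mul_of_nonneg_right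
              ((norm_mul_le _ _).trans (mul_le_mul_of_nonneg_right h2 he0)) (norm_nonneg _)
        _ ≤ ‖1 - 2 * b‖ * (5 / 4) := by nlinarith [norm_nonneg (1 - 2 * b)]
        _ ≤ ‖1 - 2 * a‖ * (5 / 4) ^ (n + 1) := by
            rw [pow_succ]; linarith [ih.2]

theorem dist_newton_iterate [NormOneClass A] {a : A} (ha : ‖a * a - a‖ ≤ 1 / 8) (n : ℕ) :
    dist (newtonStep^[n] a) (newtonStep^[n + 1] a) ≤ ‖1 - 2 * a‖ * (5 / 8) ^ n := by
  obtain ⟨h1, h2⟩ := norm_newton_iterate ha n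
  rw [Function.iterate_succ_apply', dist_eq_norm', newtonStep, add_sub_cancel_left]
  have h58 : (5 / 8 : ℝ) ^ n = (1 / 2) ^ n * (5 / 4) ^ n := by rw [← mul_pow]; norm_num
  calc _ ≤ _ := norm_mul_le _ _
    _ ≤ 1 / 8 * (1 / 2) ^ n * (‖1 - 2 * a‖ * (5 / 4) ^ n) :=
      mul_le_mul h1 h2 (norm_nonneg _) (by positivity)
    _ = 1 / 8 * (‖1 - 2 * a‖ * (5 / 8) ^ n) := by rw [h58]; ring
    _ ≤ _ := by
      have : 0 ≤ ‖1 - 2 * a‖ * (5 / 8) ^ n := by positivity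
      linarith

theorem newtonLimit_of_isIdempotentElem {a : A} (h : a * a = a) : newtonLimit a = a := by
  refine Tendsto.limUnder_eq (tendsto_const_nhds.congr fun n => ?_)
  exact (Function.iterate_fixed (newtonStep_of_isIdempotentElem h) n).symm

variable [NormOneClass A] [CompleteSpace A]

theorem tendsto_newtonLimit {a : A} (ha : ‖a * a - a‖ ≤ 1 / 8) :
    Tendsto (fun n => newtonStep^[n] a) atTop (𝓝 (newtonLimit a)) :=
  (cauchySeq_of_le_geometric (5 / 8) _ (by norm_num) (dist_newton_iterate ha)).tendsto_limUnder

theorem newtonLimit_mul_self {a : A} (ha : ‖a * a - a‖ ≤ 1 / 8) :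
    newtonLimit a * newtonLimit a = newtonLimit a := by
  have h := tendsto_newtonLimit ha
  have h1 : Tendsto (fun n => newtonStep^[n] a * newtonStep^[n] a - newtonStep^[n] a) atTop
      (𝓝 0) := by
    refine squeeze_zero_norm (fun n => (norm_newton_iterate ha n).1) ?_
    have := (tendsto_pow_atTop_nhds_zero_of_lt_one (r := (1 / 2 : ℝ)) (by norm_num)
      (by norm_num)).const_mul (1 / 8)
    rwa [mul_zero] at this
  exact sub_eq_zero.1 (tendsto_nhds_unique ((h.mul h).sub h) h1)

theorem continuousAt_newtonLimit {a : A} (ha : ‖a * a - a‖ < 1 / 8) :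
    ContinuousAt newtonLimit a := by
  set s : Set A := {b | ‖b * b - b‖ < 1 / 8 ∧ ‖1 - 2 * b‖ < ‖1 - 2 * a‖ + 1}
  have hs : IsOpen s :=
    (isOpen_lt (f := fun b : A => ‖b * b - b‖) (by fun_prop) continuous_const).inter
    (isOpen_lt (f := fun b : A => ‖1 - 2 * b‖) (by fun_prop) continuous_const)
  have hu : TendstoUniformlyOn (fun n b => newtonStep^[n] b) newtonLimit atTop s := by
    rw [Metric.tendstoUniformlyOn_iff]
    intro ε hε
    have hlim : Tendsto (fun n : ℕ => (‖1 - 2 * a‖ + 1) * (5 / 8 : ℝ) ^ n / (1 - 5 / 8)) atTop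
        (𝓝 0) := by
      simpa using ((tendsto_pow_atTop_nhds_zero_of_lt_one (r := (5 / 8 : ℝ)) (by norm_num)
        (by norm_num)).const_mul (‖1 - 2 * a‖ + 1)).div_const (1 - 5 / 8)
    filter_upwards [hlim.eventually (gt_mem_nhds hε)] with n hn b hb
    rw [dist_comm]
    refine (dist_le_of_le_geometric_of_tendsto (5 / 8) _ (by norm_num)
      (fun n => (dist_newton_iterate hb.1.le n).trans
        (mul_le_mul_of_nonneg_right hb.2.le (by positivity)))
      (tendsto_newtonLimit hb.1.le) n).trans_lt hn
  exact (hu.continuousOn (.of_forall fun n =>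
    (continuous_newtonStep.iterate n).continuousOn)).continuousAt
    (hs.mem_nhds ⟨ha, by linarith⟩)

/-- The Newton iteration commutes with conjugation. The norm need not be invariant under it, so that
`g * a * f` need not satisfy the smallness condition itself. -/
theorem newtonLimit_conj {a f g : A} (hfg : f * g = 1) (hgf : g * f = 1)
    (ha : ‖a * a - a‖ ≤ 1 / 8) : newtonLimit (g * a * f) = g * newtonLimit a * f := by
  have hc : Continuous fun b => g * b * f := by fun_prop
  refine Tendsto.limUnder_eq (((hc.tendsto _).comp (tendsto_newtonLimit ha)).congr fun n => ?_)
  have hmul : ∀ b c, g * b * f * (g * c * f) = g * (b * c) * f := fun b c => by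
    rw [show g * b * f * (g * c * f) = g * b * (f * g) * (c * f) by noncomm_ring, hfg]
    noncomm_ring
  have h : Function.Semiconj (fun b => g * b * f) newtonStep newtonStep := fun b => by
    have h1 : (1 : A) - 2 * (g * b * f) = g * (1 - 2 * b) * f := by
      rw [mul_sub, sub_mul, mul_one, hgf]
      noncomm_ring
    simp only [newtonStep]
    rw [h1, hmul, ← sub_mul, ← mul_sub, hmul, mul_add, add_mul]
  exact h.iterate_right n a

end Newton

/-! ### Extension of a splitting -/

section Extension

variable {d : ℕ} {M : Type*} [TopologicalSpace M] [ChartedSpace (EuclideanSpace ℝ (Fin d)) M]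

instance instT2SpaceTangentSpace (x : M) : T2Space (TangentSpace (𝓡 d) x) :=
  inferInstanceAs (T2Space (EuclideanSpace ℝ (Fin d)))

variable [IsManifold (𝓡 d) 1 M]

/-- The trivialization at `x₀` of the bundle of endomorphisms of the tangent spaces. -/
abbrev endTriv (x₀ : M) := trivializationAt
  (EuclideanSpace ℝ (Fin d) →L[ℝ] EuclideanSpace ℝ (Fin d))
  (fun x : M => TangentSpace (𝓡 d) x →L[ℝ] TangentSpace (𝓡 d) x) x₀

/-- The tangent endomorphism `A` in the trivialization at `x₀`. -/
def endCoord (x₀ x : M) (A : TangentSpace (𝓡 d) x →L[ℝ] TangentSpace (𝓡 d) x) :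
    EuclideanSpace ℝ (Fin d) →L[ℝ] EuclideanSpace ℝ (Fin d) :=
  (endTriv x₀ ⟨x, A⟩).2

theorem mem_baseSet_endTriv {x₀ x : M} : x ∈ (endTriv (d := d) x₀).baseSet ↔
    x ∈ (trivializationAt (EuclideanSpace ℝ (Fin d)) (TangentSpace (𝓡 d)) x₀).baseSet := by
  rw [hom_trivializationAt_baseSet, inter_self]

theorem endCoord_apply {x₀ x : M} (A : TangentSpace (𝓡 d) x →L[ℝ] TangentSpace (𝓡 d) x)
    (w : EuclideanSpace ℝ (Fin d)) :
    endCoord x₀ x A w =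
      (trivializationAt (EuclideanSpace ℝ (Fin d)) (TangentSpace (𝓡 d)) x₀).continuousLinearMapAt
        ℝ x (A ((trivializationAt (EuclideanSpace ℝ (Fin d)) (TangentSpace (𝓡 d)) x₀).symmL
          ℝ x w)) :=
  rfl

/-- The continuous section of tangent endomorphisms given by a continuous map in a
trivialization. -/
theorem continuousAt_endTriv_symm {x₀ x : M} (hx : x ∈ (endTriv (d := d) x₀).baseSet)
    {Q : M → EuclideanSpace ℝ (Fin d) →L[ℝ] EuclideanSpace ℝ (Fin d)} (hQ : ContinuousAt Q x) :
    ContinuousAt (fun x => (⟨x, (endTriv x₀).symm x (Q x)⟩ :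
      TotalSpace (EuclideanSpace ℝ (Fin d) →L[ℝ] EuclideanSpace ℝ (Fin d))
        (fun x : M => TangentSpace (𝓡 d) x →L[ℝ] TangentSpace (𝓡 d) x))) x := by
  have h := (endTriv (d := d) x₀).continuousOn_symm.continuousAt (x := (x, Q x))
    (prod_mem_nhds ((endTriv (d := d) x₀).open_baseSet.mem_nhds hx) univ_mem)
  exact ContinuousAt.comp (x := x) (f := fun x => (x, Q x)) h (continuousAt_id.prodMk hQ)

theorem endTriv_symm_endCoord {x₀ x : M} (hx : x ∈ (endTriv (d := d) x₀).baseSet)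
    (A : TangentSpace (𝓡 d) x →L[ℝ] TangentSpace (𝓡 d) x) :
    (endTriv x₀).symm x (endCoord x₀ x A) = A :=
  (endTriv x₀).symm_apply_apply_mk hx A

theorem endCoord_endTriv_symm {x₀ x : M} (hx : x ∈ (endTriv (d := d) x₀).baseSet)
    (B : EuclideanSpace ℝ (Fin d) →L[ℝ] EuclideanSpace ℝ (Fin d)) :
    endCoord x₀ x ((endTriv x₀).symm x B) = B :=
  congrArg Prod.snd ((endTriv x₀).apply_mk_symm hx B)

/-- The projection along a continuous splitting over a closed set extends to a continuous section of
tangent endomorphisms: locally by Tietze's theorem, globally by a partition of unity. -/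
theorem IsContinuousSplitting.exists_extension_projAlong [T2Space M] [CompactSpace M] {Λ : Set M}
    {E F : ∀ x : M, Submodule ℝ (TangentSpace (𝓡 d) x)} {k l : ℕ} (hΛ : IsClosed Λ)
    [IsManifold (𝓡 d) ∞ M]
    (h : IsContinuousSplitting Λ E F k l) :
    ∃ q : ∀ x : M, TangentSpace (𝓡 d) x →L[ℝ] TangentSpace (𝓡 d) x,
      Continuous (fun x => (⟨x, q x⟩ :
        TotalSpace (EuclideanSpace ℝ (Fin d) →L[ℝ] EuclideanSpace ℝ (Fin d))
          (fun x : M => TangentSpace (𝓡 d) x →L[ℝ] TangentSpace (𝓡 d) x))) ∧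
      ∀ x ∈ Λ, ∀ v, q x v = projAlong E F x v := by
  let P : ∀ x : M, TangentSpace (𝓡 d) x →L[ℝ] TangentSpace (𝓡 d) x := fun x =>
    LinearMap.toContinuousLinearMap (projAlong E F x)
  have key := exists_contMDiffSection_forall_mem_convex_of_local (I := 𝓡 d) (n := 0)
    (F_fiber := EuclideanSpace ℝ (Fin d) →L[ℝ] EuclideanSpace ℝ (Fin d))
    (fun x : M => TangentSpace (𝓡 d) x →L[ℝ] TangentSpace (𝓡 d) x)
    (fun x => {A | x ∈ Λ → A = P x}) ?_ ?_
  · obtain ⟨q, hq⟩ := key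
    refine ⟨q, q.contMDiff.continuous, fun x hx v => ?_⟩
    rw [hq x hx]
    rfl
  · intro x A hA B hB s t hs ht hst hx
    rw [hA hx, hB hx, ← add_smul, hst, one_smul]
  · intro x₀
    let e := trivializationAt (EuclideanSpace ℝ (Fin d)) (TangentSpace (𝓡 d) (M := M)) x₀
    have hmem : x₀ ∈ e.baseSet := FiberBundle.mem_baseSet_trivializationAt' x₀
    obtain ⟨K, hK, hKc, hKe⟩ := exists_mem_nhds_isClosed_subset (e.open_baseSet.mem_nhds hmem)
    have hcont : ContinuousOn (fun x => endCoord x₀ x (P x)) (Λ ∩ K) := by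
      rw [continuousOn_clm_apply]
      intro w x hx
      have hxe : x ∈ e.baseSet := hKe hx.2
      have h1 : ContinuousWithinAt (fun x => (⟨x, e.symmL ℝ x w⟩ : TangentBundle (𝓡 d) M))
          (Λ ∩ K) x := by
        have h := (continuousOn_trivializationAt_symmL x₀).continuousAt
          (x := (x, w)) (prod_mem_nhds (e.open_baseSet.mem_nhds hxe) univ_mem)
        exact (ContinuousAt.comp (x := x) (f := fun x : M => (x, w)) h
          (continuousAt_id.prodMk continuousAt_const)).continuousWithinAt
      have h2 : ContinuousWithinAt (fun x => projTM E F ⟨x, e.symmL ℝ x w⟩) (Λ ∩ K) x :=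
        ContinuousWithinAt.comp (g := projTM E F) (x := x) (t := TotalSpace.proj ⁻¹' Λ)
          (f := fun x => (⟨x, e.symmL ℝ x w⟩ : TangentBundle (𝓡 d) M))
          (h.continuousWithinAt_projTM (y₀ := ⟨x, e.symmL ℝ x w⟩) hx.1) h1 (fun z hz => hz.1)
      have h3 := ContinuousAt.comp_continuousWithinAt
        (f := fun x => projTM E F ⟨x, e.symmL ℝ x w⟩) (x := x)
        (continuousAt_trivializationAt_snd (x₀ := x₀) hxe) h2
      refine h3.congr (fun z hz => ?_) ?_
      · rw [endCoord_apply]; exact continuousLinearMapAt_eq_snd (hKe hz.2) _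
      · rw [endCoord_apply]; exact continuousLinearMapAt_eq_snd (hKe hx.2) _
    obtain ⟨Q, hQ⟩ := ContinuousMap.exists_restrict_eq (hΛ.inter hKc)
      (⟨_, hcont.domRestrict⟩ :
        C(↥(Λ ∩ K), EuclideanSpace ℝ (Fin d) →L[ℝ] EuclideanSpace ℝ (Fin d)))
    refine ⟨K, hK, fun x => (endTriv x₀).symm x (Q x), ?_, fun x hxK hx => ?_⟩
    · have hz : ((0 : ℕ∞) : WithTop ℕ∞) = 0 := rfl
      rw [hz, contMDiffOn_zero_iff]
      exact fun x hx => (continuousAt_endTriv_symm (mem_baseSet_endTriv.2 (hKe hx))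
        Q.continuous.continuousAt).continuousWithinAt
    · have h1 : Q x = endCoord x₀ x (P x) := congrArg (fun f => f ⟨x, hx, hxK⟩) hQ
      change (endTriv x₀).symm x (Q x) = P x
      rw [h1, endTriv_symm_endCoord (mem_baseSet_endTriv.2 (hKe hxK))]

theorem endCoord_comp {x₀ x : M}
    (hx : x ∈ (trivializationAt (EuclideanSpace ℝ (Fin d)) (TangentSpace (𝓡 d)) x₀).baseSet)
    (A B : TangentSpace (𝓡 d) x →L[ℝ] TangentSpace (𝓡 d) x) :
    endCoord x₀ x (A.comp B) = endCoord x₀ x A * endCoord x₀ x B := by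
  ext1 w
  rw [mul_apply_eq_comp, endCoord_apply, endCoord_apply, endCoord_apply,
    Trivialization.symmL_continuousLinearMapAt _ hx, ContinuousLinearMap.comp_apply]

theorem endCoord_id_sub {x₀ x : M}
    (hx : x ∈ (trivializationAt (EuclideanSpace ℝ (Fin d)) (TangentSpace (𝓡 d)) x₀).baseSet)
    (A : TangentSpace (𝓡 d) x →L[ℝ] TangentSpace (𝓡 d) x) :
    endCoord x₀ x (ContinuousLinearMap.id ℝ _ - A) = 1 - endCoord x₀ x A := by
  ext1 w
  rw [sub_apply, endCoord_apply, endCoord_apply, sub_apply,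
    map_sub, ContinuousLinearMap.id_apply, Trivialization.continuousLinearMapAt_symmL _ hx,
    one_apply_eq_self]

theorem endCoord_injective {x₀ x : M}
    (hx : x ∈ (trivializationAt (EuclideanSpace ℝ (Fin d)) (TangentSpace (𝓡 d)) x₀).baseSet) :
    Function.Injective (endCoord (d := d) x₀ x) :=
  Function.LeftInverse.injective fun A => endTriv_symm_endCoord (mem_baseSet_endTriv.2 hx) A

/-- The idempotent obtained from a tangent endomorphism by Newton's iteration. It is computed
in a trivialization, but does not depend on it. -/
def newtonEnd (x : M) (A : TangentSpace (𝓡 d) x →L[ℝ] TangentSpace (𝓡 d) x) :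
    TangentSpace (𝓡 d) x →L[ℝ] TangentSpace (𝓡 d) x :=
  (endTriv x).symm x (newtonLimit (endCoord x x A))

/-- The idempotent `newtonEnd` may be computed in any trivialization. -/
theorem endCoord_newtonEnd [Nonempty (Fin d)] {x₀ x : M}
    (hx : x ∈ (trivializationAt (EuclideanSpace ℝ (Fin d)) (TangentSpace (𝓡 d)) x₀).baseSet)
    {A : TangentSpace (𝓡 d) x →L[ℝ] TangentSpace (𝓡 d) x}
    (hA : ‖endCoord x₀ x A * endCoord x₀ x A - endCoord x₀ x A‖ ≤ 1 / 8) :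
    endCoord x₀ x (newtonEnd x A) = newtonLimit (endCoord x₀ x A) := by
  have hxx : x ∈ (trivializationAt (EuclideanSpace ℝ (Fin d)) (TangentSpace (𝓡 d)) x).baseSet :=
    FiberBundle.mem_baseSet_trivializationAt' x
  let e₀ := trivializationAt (EuclideanSpace ℝ (Fin d)) (TangentSpace (𝓡 d) (M := M)) x₀
  let e := trivializationAt (EuclideanSpace ℝ (Fin d)) (TangentSpace (𝓡 d) (M := M)) x
  let f : EuclideanSpace ℝ (Fin d) →L[ℝ] EuclideanSpace ℝ (Fin d) :=
    (e₀.continuousLinearMapAt ℝ x).comp (e.symmL ℝ x)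
  let g : EuclideanSpace ℝ (Fin d) →L[ℝ] EuclideanSpace ℝ (Fin d) :=
    (e.continuousLinearMapAt ℝ x).comp (e₀.symmL ℝ x)
  have hfg : f * g = 1 := by
    ext1 w
    change e₀.continuousLinearMapAt ℝ x (e.symmL ℝ x (e.continuousLinearMapAt ℝ x
      (e₀.symmL ℝ x w))) = w
    rw [e.symmL_continuousLinearMapAt hxx, e₀.continuousLinearMapAt_symmL hx]
  have hgf : g * f = 1 := by
    ext1 w
    change e.continuousLinearMapAt ℝ x (e₀.symmL ℝ x (e₀.continuousLinearMapAt ℝ x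
      (e.symmL ℝ x w))) = w
    rw [e₀.symmL_continuousLinearMapAt hx, e.continuousLinearMapAt_symmL hxx]
  have hconj : ∀ B, endCoord x x B = g * endCoord x₀ x B * f := fun B => by
    ext1 w
    change e.continuousLinearMapAt ℝ x (B (e.symmL ℝ x w)) =
      e.continuousLinearMapAt ℝ x (e₀.symmL ℝ x (e₀.continuousLinearMapAt ℝ x
        (B (e₀.symmL ℝ x (e₀.continuousLinearMapAt ℝ x (e.symmL ℝ x w))))))
    rw [e₀.symmL_continuousLinearMapAt hx, e₀.symmL_continuousLinearMapAt hx]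
  set b := newtonLimit (endCoord x₀ x A) with hb
  have h1 : endCoord x₀ x ((endTriv x₀).symm x b) = b :=
    endCoord_endTriv_symm (mem_baseSet_endTriv.2 hx) b
  rw [newtonEnd, hconj, newtonLimit_conj hfg hgf hA, ← hb]
  conv_lhs => rw [← h1, ← hconj, endTriv_symm_endCoord (mem_baseSet_endTriv.2 hxx)]
  exact h1

/-- Newton's iteration turns a continuous section of tangent endomorphisms that is idempotent at
`x₀` into one that is idempotent near `x₀`. -/
theorem eventually_newtonEnd [Nonempty (Fin d)]
    {q : ∀ x : M, TangentSpace (𝓡 d) x →L[ℝ] TangentSpace (𝓡 d) x}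
    (hq : Continuous (fun x => (⟨x, q x⟩ :
        TotalSpace (EuclideanSpace ℝ (Fin d) →L[ℝ] EuclideanSpace ℝ (Fin d))
          (fun x : M => TangentSpace (𝓡 d) x →L[ℝ] TangentSpace (𝓡 d) x)))) {x₀ : M}
    (hx₀ : (q x₀).comp (q x₀) = q x₀) :
    newtonEnd x₀ (q x₀) = q x₀ ∧ ∀ᶠ x in 𝓝 x₀,
      (newtonEnd x (q x)).comp (newtonEnd x (q x)) = newtonEnd x (q x) ∧
      ContinuousAt (fun x => (⟨x, newtonEnd x (q x)⟩ :
        TotalSpace (EuclideanSpace ℝ (Fin d) →L[ℝ] EuclideanSpace ℝ (Fin d))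
          (fun x : M => TangentSpace (𝓡 d) x →L[ℝ] TangentSpace (𝓡 d) x))) x ∧
      ContinuousAt (fun x => (⟨x, ContinuousLinearMap.id ℝ _ - newtonEnd x (q x)⟩ :
        TotalSpace (EuclideanSpace ℝ (Fin d) →L[ℝ] EuclideanSpace ℝ (Fin d))
          (fun x : M => TangentSpace (𝓡 d) x →L[ℝ] TangentSpace (𝓡 d) x))) x := by
  let e := trivializationAt (EuclideanSpace ℝ (Fin d)) (TangentSpace (𝓡 d) (M := M)) x₀
  have hmem : x₀ ∈ e.baseSet := FiberBundle.mem_baseSet_trivializationAt' x₀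
  set a : M → EuclideanSpace ℝ (Fin d) →L[ℝ] EuclideanSpace ℝ (Fin d) :=
    fun x => endCoord x₀ x (q x) with ha
  have hac : ∀ x ∈ e.baseSet, ContinuousAt a x := fun x hx =>
    continuous_snd.continuousAt.comp (ContinuousAt.comp (x := x)
      (f := fun x => (⟨x, q x⟩ :
        TotalSpace (EuclideanSpace ℝ (Fin d) →L[ℝ] EuclideanSpace ℝ (Fin d))
          (fun x : M => TangentSpace (𝓡 d) x →L[ℝ] TangentSpace (𝓡 d) x)))
      ((endTriv x₀).continuousAt ((Trivialization.mem_source _).2 (mem_baseSet_endTriv.2 hx)))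
      hq.continuousAt)
  have ha₀ : a x₀ * a x₀ = a x₀ := by rw [ha, ← endCoord_comp hmem, hx₀]
  refine ⟨endCoord_injective hmem ?_, ?_⟩
  · rw [endCoord_newtonEnd hmem (by rw [ha₀, sub_self, norm_zero]; norm_num),
      newtonLimit_of_isIdempotentElem ha₀]
  have hev : ∀ᶠ x in 𝓝 x₀, x ∈ e.baseSet ∧ ‖a x * a x - a x‖ < 1 / 8 := by
    refine Filter.Eventually.and (e.open_baseSet.mem_nhds hmem) ?_
    refine (((hac x₀ hmem).mul (hac x₀ hmem)).sub (hac x₀ hmem)).norm.eventually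
      (gt_mem_nhds ?_)
    change ‖a x₀ * a x₀ - a x₀‖ < 1 / 8
    rw [ha₀, sub_self, norm_zero]
    norm_num
  filter_upwards [eventually_eventually_nhds.2 hev] with x hx
  obtain ⟨hxe, hxa⟩ := hx.self_of_nhds
  have hlim : ContinuousAt (fun x => newtonLimit (a x)) x :=
    ContinuousAt.comp (x := x) (f := a) (continuousAt_newtonLimit hxa) (hac x hxe)
  refine ⟨endCoord_injective hxe ?_, ?_, ?_⟩
  · rw [endCoord_comp hxe, endCoord_newtonEnd hxe hxa.le, newtonLimit_mul_self hxa.le]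
  · refine (continuousAt_endTriv_symm (mem_baseSet_endTriv.2 hxe) hlim).congr ?_
    filter_upwards [hx] with z hz
    rw [← endCoord_newtonEnd hz.1 hz.2.le, endTriv_symm_endCoord (mem_baseSet_endTriv.2 hz.1)]
  · refine (continuousAt_endTriv_symm (Q := fun x => 1 - newtonLimit (a x))
      (mem_baseSet_endTriv.2 hxe) (continuousAt_const.sub hlim)).congr ?_
    filter_upwards [hx] with z hz
    rw [← endCoord_newtonEnd hz.1 hz.2.le, ← endCoord_id_sub hz.1,
      endTriv_symm_endCoord (mem_baseSet_endTriv.2 hz.1)]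

theorem le_finrank_of_linearIndependent {V : Type*} [AddCommGroup V] [Module ℝ V]
    [FiniteDimensional ℝ V] {S : Submodule ℝ V} {k : ℕ} {s : Fin k → V}
    (hs : LinearIndependent ℝ s) (hS : ∀ i, s i ∈ S) : k ≤ Module.finrank ℝ S := by
  have h := Submodule.finrank_mono (Submodule.span_le.2 (range_subset_iff.2 hS))
  rwa [finrank_span_eq_card hs, Fintype.card_fin] at h

theorem isCompl_range_id_sub {V : Type*} [AddCommGroup V] [Module ℝ V] {p : V →ₗ[ℝ] V}
    (hp : ∀ v, p (p v) = p v) :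
    IsCompl (LinearMap.range p) (LinearMap.range (LinearMap.id - p)) := by
  constructor
  · rw [Submodule.disjoint_def]
    rintro _ ⟨v, rfl⟩ ⟨w, hw⟩
    have h1 := congrArg p hw
    rw [LinearMap.sub_apply, LinearMap.id_apply, map_sub, hp, sub_self, hp] at h1
    exact h1.symm
  · rw [Submodule.codisjoint_iff_exists_add_eq]
    exact fun v => ⟨p v, v - p v, ⟨v, rfl⟩, ⟨v, rfl⟩, add_sub_cancel _ _⟩

/-- A continuous splitting over a closed set extends to a neighbourhood, as the ranges of `p` and
`1 - p` for a continuous field `p` of projections that extends the projection of the splitting. -/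
theorem IsContinuousSplitting.exists_extension [T2Space M] [CompactSpace M] [Nonempty (Fin d)]
    {Λ : Set M} {E F : ∀ x : M, Submodule ℝ (TangentSpace (𝓡 d) x)} {k l : ℕ} (hΛ : IsClosed Λ)
    [IsManifold (𝓡 d) ∞ M] (h : IsContinuousSplitting Λ E F k l) :
    ∃ V ∈ 𝓝ˢ Λ, ∃ E' F' : ∀ x : M, Submodule ℝ (TangentSpace (𝓡 d) x),
      IsContinuousSplitting V E' F' k l ∧ ∀ x ∈ Λ, E' x = E x ∧ F' x = F x := by
  obtain ⟨q, hq, hqΛ⟩ := h.exists_extension_projAlong hΛ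
  set p : ∀ x : M, TangentSpace (𝓡 d) x →L[ℝ] TangentSpace (𝓡 d) x :=
    fun x => newtonEnd x (q x) with hp
  have hqid : ∀ x ∈ Λ, (q x).comp (q x) = q x := fun x hx => by
    ext1 v
    rw [ContinuousLinearMap.comp_apply, hqΛ x hx, hqΛ x hx,
      projAlong_of_mem_left (h.isCompl x hx) (projAlong_mem (h.isCompl x hx) v)]
  have hpΛ : ∀ x ∈ Λ, ∀ v, p x v = projAlong E F x v := fun x hx v => by
    rw [hp]
    change newtonEnd x (q x) v = _
    rw [(eventually_newtonEnd hq (hqid x hx)).1, hqΛ x hx]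
  let P : ∀ x : M, TangentSpace (𝓡 d) x →ₗ[ℝ] TangentSpace (𝓡 d) x := fun x => (p x).toLinearMap
  let P' : ∀ x : M, TangentSpace (𝓡 d) x →ₗ[ℝ] TangentSpace (𝓡 d) x := fun x => LinearMap.id - P x
  have hcompl : ∀ x, (p x).comp (p x) = p x →
      IsCompl (LinearMap.range (P x)) (LinearMap.range (P' x)) := fun x hx =>
    isCompl_range_id_sub fun v => congrArg (fun f => f v) hx
  -- continuity of the maps of the tangent bundle given by `P` and `P'`
  have hcP : ∀ y : TangentBundle (𝓡 d) M, ContinuousAt (fun x => (⟨x, p x⟩ :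
        TotalSpace (EuclideanSpace ℝ (Fin d) →L[ℝ] EuclideanSpace ℝ (Fin d))
          (fun x : M => TangentSpace (𝓡 d) x →L[ℝ] TangentSpace (𝓡 d) x))) y.1 →
      ContinuousAt (fun y : TangentBundle (𝓡 d) M =>
        (⟨y.1, P y.1 y.2⟩ : TangentBundle (𝓡 d) M)) y := fun y hy =>
    ContinuousAt.clm_bundle_apply (ϕ := fun y : TangentBundle (𝓡 d) M => p y.1)
      (b := fun y : TangentBundle (𝓡 d) M => y.1) (v := fun y => y.2)
      (ContinuousAt.comp (f := TotalSpace.proj) hy continuous_tangentBundle_proj.continuousAt)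
      continuousAt_id
  have hcP' : ∀ y : TangentBundle (𝓡 d) M,
      ContinuousAt (fun x => (⟨x, ContinuousLinearMap.id ℝ _ - p x⟩ :
        TotalSpace (EuclideanSpace ℝ (Fin d) →L[ℝ] EuclideanSpace ℝ (Fin d))
          (fun x : M => TangentSpace (𝓡 d) x →L[ℝ] TangentSpace (𝓡 d) x))) y.1 →
      ContinuousAt (fun y : TangentBundle (𝓡 d) M =>
        (⟨y.1, P' y.1 y.2⟩ : TangentBundle (𝓡 d) M)) y := fun y hy =>
    ContinuousAt.clm_bundle_apply
      (ϕ := fun y : TangentBundle (𝓡 d) M => ContinuousLinearMap.id ℝ _ - p y.1)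
      (b := fun y : TangentBundle (𝓡 d) M => y.1) (v := fun y => y.2)
      (ContinuousAt.comp (f := TotalSpace.proj) hy continuous_tangentBundle_proj.continuousAt)
      continuousAt_id
  have hrE : ∀ x ∈ Λ, LinearMap.range (P x) = E x := fun x hx => by
    refine le_antisymm ?_ fun v hv => ⟨v, ?_⟩
    · rintro _ ⟨v, rfl⟩
      exact (hpΛ x hx v) ▸ projAlong_mem (h.isCompl x hx) v
    · exact (hpΛ x hx v).trans (projAlong_of_mem_left (h.isCompl x hx) hv)
  have hP' : ∀ x ∈ Λ, ∀ v, P' x v = projAlong F E x v := fun x hx v => by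
    have h1 : P' x v = v - p x v := rfl
    rw [h1, hpΛ x hx]
    exact (eq_sub_of_add_eq' (projAlong_add_projAlong (h.isCompl x hx) v)).symm
  have hrF : ∀ x ∈ Λ, LinearMap.range (P' x) = F x := fun x hx => by
    refine le_antisymm ?_ fun v hv => ⟨v, ?_⟩
    · rintro _ ⟨v, rfl⟩
      exact (hP' x hx v) ▸ projAlong_mem (h.isCompl x hx).symm v
    · exact (hP' x hx v).trans (projAlong_of_mem_left (h.isCompl x hx).symm hv)
  let good : M → Prop := fun x => (p x).comp (p x) = p x ∧
    ContinuousAt (fun x => (⟨x, p x⟩ :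
        TotalSpace (EuclideanSpace ℝ (Fin d) →L[ℝ] EuclideanSpace ℝ (Fin d))
          (fun x : M => TangentSpace (𝓡 d) x →L[ℝ] TangentSpace (𝓡 d) x))) x ∧
    ContinuousAt (fun x => (⟨x, ContinuousLinearMap.id ℝ _ - p x⟩ :
        TotalSpace (EuclideanSpace ℝ (Fin d) →L[ℝ] EuclideanSpace ℝ (Fin d))
          (fun x : M => TangentSpace (𝓡 d) x →L[ℝ] TangentSpace (𝓡 d) x))) x
  have hid' : ∀ x, good x → ∀ v, P' x (P' x v) = P' x v := fun x hx v => by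
    have h1 : p x (p x v) = p x v := congrArg (fun f => f v) hx.1
    change (v - p x v) - p x (v - p x v) = v - p x v
    rw [map_sub, h1, sub_self, sub_zero]
  let ranks : M → Prop := fun x => Module.finrank ℝ (LinearMap.range (P x)) = k ∧
    Module.finrank ℝ (LinearMap.range (P' x)) = l
  -- both ranks are lower semicontinuous and their sum is constant
  have hgood : ∀ x₀ ∈ Λ, ∀ᶠ x in 𝓝 x₀, good x ∧ ranks x := by
    intro x₀ hx₀
    have hg : ∀ᶠ x in 𝓝 x₀, good x := (eventually_newtonEnd hq (hqid x₀ hx₀)).2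
    obtain ⟨u, hu, s, -, hs⟩ := exists_frame_of_continuousAt (p := P) (k := k) hg
      (fun y hy => hcP y hy.2.1) (fun v => congrArg (fun f => f v) hg.self_of_nhds.1)
      (by rw [hrE x₀ hx₀, h.left.finrank_eq hx₀])
    obtain ⟨u', hu', s', -, hs'⟩ := exists_frame_of_continuousAt (p := P') (k := l) hg
      (fun y hy => hcP' y hy.2.2) (hid' x₀ hg.self_of_nhds)
      (by rw [hrF x₀ hx₀, h.right.finrank_eq hx₀])
    filter_upwards [hg, hu, hu'] with x hx hxu hxu'
    refine ⟨hx, ?_⟩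
    have h1 := le_finrank_of_linearIndependent (hs x hxu).1 (hs x hxu).2
    have h2 := le_finrank_of_linearIndependent (hs' x hxu').1 (hs' x hxu').2
    have h3 := Submodule.finrank_add_eq_of_isCompl (hcompl x hx.1)
    have h4 := Submodule.finrank_add_eq_of_isCompl (h.isCompl x₀ hx₀)
    rw [h.left.finrank_eq hx₀, h.right.finrank_eq hx₀, finrank_tangentSpace] at h4
    rw [finrank_tangentSpace] at h3
    exact ⟨by omega, by omega⟩
  let V : Set M := {x₁ | ∀ᶠ x in 𝓝 x₁, good x ∧ ranks x}
  have hVo : IsOpen V := isOpen_iff_mem_nhds.2 fun x hx => eventually_eventually_nhds.2 hx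
  have hV : ∀ x ∈ V, good x ∧ ranks x := fun x hx => hx.self_of_nhds
  refine ⟨V, mem_nhdsSet_iff_forall.2 fun x hx => hVo.mem_nhds (hgood x hx),
    fun x => LinearMap.range (P x), fun x => LinearMap.range (P' x), ⟨?_, ?_, ?_⟩,
    fun x hx => ⟨hrE x hx, hrF x hx⟩⟩
  · exact isContinuousSubbundle_range hVo (fun y hy => hcP y (hV _ hy).1.2.1)
      (fun x hx v => congrArg (fun f => f v) (hV x hx).1.1) fun x hx => (hV x hx).2.1
  · exact isContinuousSubbundle_range hVo (fun y hy => hcP' y (hV _ hy).1.2.2)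
      (fun x hx => hid' x (hV x hx).1) fun x hx => (hV x hx).2.2
  · exact fun x hx => hcompl x (hV x hx).1.1

end Extension

end PHAttractor

end

theorem proposition3p2 {d : ℕ} {M : Type*} [TopologicalSpace M] [T2Space M] [CompactSpace M]
    [ChartedSpace (EuclideanSpace ℝ (Fin d)) M] [IsManifold (𝓡 d) ∞ M]
    [RiemannianBundle (fun x : M => TangentSpace (𝓡 d) x)]
    [IsContMDiffRiemannianBundle (𝓡 d) ∞ (EuclideanSpace ℝ (Fin d))
      (fun x : M => TangentSpace (𝓡 d) x)]
    {r : ℕ∞} (hr : 1 ≤ r) (G : ∀ x : M, TangentSpace (𝓡 d) x)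
    (hG : ContMDiff (𝓡 d) (𝓡 d).tangent r (fun x => (⟨x, G x⟩ : TangentBundle (𝓡 d) M)))
    (X : ℝ → M → M) (hX : PHAttractor.IsFlowOf G X)
    (Λ : Set M) (hΛ : PHAttractor.IsAttractor X Λ)
    (Es Ecu : ∀ x : M, Submodule ℝ (TangentSpace (𝓡 d) x)) (ds dcu : ℕ) (C lam : ℝ)
    (hPH : PHAttractor.IsPartiallyHyperbolic X Λ Es Ecu ds dcu C lam) :
    -- the splitting over `Λ` extends continuously to a neighbourhood of `Λ`
    (∃ V ∈ 𝓝ˢ Λ, ∃ Es' Ecu' : ∀ x : M, Submodule ℝ (TangentSpace (𝓡 d) x),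
      PHAttractor.IsContinuousSplitting V Es' Ecu' ds dcu ∧
      ∀ x ∈ Λ, Es' x = Es x ∧ Ecu' x = Ecu x) ∧
    -- and every continuous extension can be corrected near `Λ`
    ∀ V ∈ 𝓝ˢ Λ, ∀ Es' Ecu' : ∀ x : M, Submodule ℝ (TangentSpace (𝓡 d) x),
      PHAttractor.IsContinuousSplitting V Es' Ecu' ds dcu →
      (∀ x ∈ Λ, Es' x = Es x ∧ Ecu' x = Ecu x) →
      ∀ T : ℝ, C * lam ^ T = 1 / 150 → ∀ a : ℝ, 0 < a → a ≤ 1 / 4 →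
      ∃ U₀ : Set M, IsOpen U₀ ∧ Λ ⊆ U₀ ∧ U₀ ⊆ V ∧ (∀ t ≥ 0, X t '' U₀ ⊆ U₀) ∧
        (⋂ t ∈ Ici (0 : ℝ), X t '' U₀) = Λ ∧
        ∃ c lam' : ℝ, 0 < c ∧ 0 < lam' ∧ lam' < 1 ∧
          PHAttractor.ConeEstimates X U₀ Es' Ecu' a T c lam' ∧
          ∃ F : ∀ x : M, Submodule ℝ (TangentSpace (𝓡 d) x),
            PHAttractor.IsContinuousSplitting U₀ F Ecu' ds dcu ∧
            (∀ x ∈ Λ, F x = Es x) ∧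
            (∀ x ∈ U₀, (F x : Set (TangentSpace (𝓡 d) x)) =
              ⋂ t ∈ Ici (0 : ℝ), PHAttractor.pulledBackCone X Es' Ecu' a t x) ∧
            (∀ t ≥ 0, ∀ x ∈ U₀, (F x).map (PHAttractor.DX X t x).toLinearMap = F (X t x)) ∧
            ∀ t ≥ 0, ∀ x ∈ U₀, PHAttractor.normDXOn X t F x ≤ c⁻¹ * lam' ^ t := by
  open PHAttractor in
  have hG1 : ContMDiff (𝓡 d) (𝓡 d).tangent 1 (fun x => (⟨x, G x⟩ : TangentBundle (𝓡 d) M)) :=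
    hG.of_le (by exact_mod_cast hr)
  have : IsContinuousRiemannianBundle (EuclideanSpace ℝ (Fin d))
      (fun x : M => TangentSpace (𝓡 d) x) := by
    obtain ⟨g, h1, h2⟩ := IsContMDiffRiemannianBundle.exists_contMDiff (IB := 𝓡 d) (n := ∞)
      (F := EuclideanSpace ℝ (Fin d)) (E := fun x : M => TangentSpace (𝓡 d) x)
    exact ⟨g, h1.continuous, h2⟩
  obtain ⟨x₀, hx₀, -⟩ := hΛ.2
  have hd : ds + dcu = d := by
    have h := Submodule.finrank_add_eq_of_isCompl (hPH.splitting.isCompl x₀ hx₀)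
    rwa [hPH.splitting.left.finrank_eq hx₀, hPH.splitting.right.finrank_eq hx₀,
      finrank_tangentSpace] at h
  -- the Newton iteration needs a norm with `‖1‖ = 1` on the endomorphisms of the model space
  have : Nonempty (Fin d) := ⟨⟨0, by have := hPH.one_le_ds; omega⟩⟩
  refine ⟨hPH.splitting.exists_extension hPH.isCompact.isClosed, ?_⟩
  intro V hV Es' Ecu' hS hext T hT a ha ha4
  have hT0 := hPH.pos_of_mul_rpow_eq ⟨x₀, hx₀⟩ hX hG1 hT
  have hflow := hX.continuous_tangentFlow hG1
  have hstep := hPH.eventually_dominatedStep hX hG1 hV hS hext hT0 hT ha ha4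
  obtain ⟨R, hR1, hR⟩ := exists_norm_tangentFlow_le hflow T
  have hXc : Continuous (fun p : ℝ × M => X p.1 p.2) := by
    have h0 : Continuous (fun x : M => (⟨x, 0⟩ : TangentBundle (𝓡 d) M)) :=
      (Bundle.contMDiff_zeroSection (n := 1) (IB := 𝓡 d) ℝ (TangentSpace (𝓡 d) (M := M))).continuous
    exact continuous_tangentBundle_proj.comp (hflow.comp
      (continuous_fst.prodMk (h0.comp continuous_snd)))
  have hW : interior V ∩ {x | ∀ t ∈ Icc T (2 * T), DominatedStep (DX X t x).toLinearMap
      (projAlong Es' Ecu' x) (projAlong Ecu' Es' x)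
      (projAlong Es' Ecu' (X t x)) (projAlong Ecu' Es' (X t x)) a} ∈ 𝓝ˢ Λ :=
    inter_mem (isOpen_interior.mem_nhdsSet.2 (subset_interior_iff_mem_nhdsSet.2 hV)) hstep
  obtain ⟨U₀, hUo, hΛU, hUW, hUf, hUΛ⟩ := hΛ.1.exists_forward_invariant hXc hX.map_zero
    (fun s t x => hX.map_add hG1 s t x) hW
  have hUV : U₀ ⊆ V := fun x hx => interior_subset (hUW hx).1
  have hdom : DominatedOn X U₀ Es' Ecu' T a R :=
    { T_pos := hT0
      a_pos := ha
      a_le := ha4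
      one_le := hR1
      mapsTo := fun t ht x hx => hUf t ht (mem_image_of_mem _ hx)
      isCompl := fun x hx => hS.isCompl x (hUV hx)
      finrank_eq := fun x hx x' hx' => by
        rw [hS.right.finrank_eq (hUV hx), hS.right.finrank_eq (hUV hx')]
      step := fun x hx => (hUW hx).2
      norm_le := hR }
  have hS' : IsContinuousSplitting V Ecu' Es' dcu ds :=
    ⟨hS.right, hS.left, fun x hx => (hS.isCompl x hx).symm⟩
  have hmem : ∀ y : TangentBundle (𝓡 d) M, y.1 ∈ U₀ → TotalSpace.proj ⁻¹' V ∈ 𝓝 y := fun y hy =>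
    continuous_tangentBundle_proj.continuousAt.preimage_mem_nhds
      (mem_of_superset (hUo.mem_nhds hy) hUV)
  refine ⟨U₀, hUo, hΛU, hUV, hUf, hUΛ, (2 * R ^ 2)⁻¹, rate T, by positivity, rate_pos T,
    rate_lt_one hT0, hdom.coneEstimates hX hG1, stableBundle X Es' Ecu' a, ⟨?_, ?_, ?_⟩, ?_,
    fun x hx => hdom.coe_stableBundle hX hG1 hx,
    fun t ht x hx => hdom.map_stableBundle hX hG1 hx ht,
    fun t ht x hx => hdom.normDXOn_stableBundle_le hX hG1 hx ht⟩
  · exact hdom.isContinuousSubbundle_stableBundle hX hG1 hUo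
      (fun y hy => (hS.continuousWithinAt_projTM (hUV hy)).continuousAt (hmem y hy))
      (fun y hy => (hS'.continuousWithinAt_projTM (hUV hy)).continuousAt (hmem y hy))
      fun x hx => hS.left.finrank_eq (hUV hx)
  · exact hS.right.mono hUV
  · exact fun x hx => hdom.isCompl_stableBundle hX hG1 hx
  -- over `Λ` the splitting is invariant
  · intro x hx
    rw [hdom.stableBundle_eq hX hG1 (hΛU hx), (hext x hx).1]
    intro t _ v hv
    have hXx : X t x ∈ Λ := by rw [← hPH.isInvariantSet t]; exact mem_image_of_mem _ hx
    rw [(hext x hx).1] at hv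
    rw [(hext _ hXx).1, ← hPH.invariant_s t x hx]
    exact Submodule.mem_map_of_mem hv
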